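/- Let $G$ be a finite connected simple graph. A *straight-line planar drawing* of $G$ maps the vertices to distinct points of the plane and the edges to internally disjoint straight-line segments containing no vertices in their interiors; its *faces* are the connected components of the complement of the drawing, the unbounded one being the *outer* face and the others *internal*. The drawing is *strictly convex* if every angle in an internal face is smaller than $\pi$ and every angle in the outer face is larger than $\pi$. Two planar drawings of $G$ are *equivalent* if they determine the same clockwise orderings of the edges around the vertices and have the same outer face; a *plane graph* is a connected graph with an equivalence class (its *plane embedding*) of planar drawings, and it is a *strictly-convex graph* if this class contains a strictly-convex drawing. A *hierarchical plane graph* is a tuple $(G,\vec d,L,\gamma)$ where $G$ is a plane graph, $\vec d$ is an oriented straight line, $L$ is a set of lines orthogonal to $\vec d$, ordered as they are met along $\vec d$, and $\gamma:V(G)\to L$ maps adjacent vertices to distinct lines, such that the plane embedding of $G$ contains a *level* drawing, that is, a drawing with every vertex $v$ on the line $\gamma(v)$. Each line in $L$ is oriented so that $\vec d$ crosses it from its right to its left. A path $(u_1,\dots,u_k)$ in $G$ is *monotone* if $\gamma(u_1)<\dots<\gamma(u_k)$. A *hierarchical-st strictly-convex graph* is a hierarchical plane graph such that $G$ is a strictly-convex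 graph and every face (including the outer one) is delimited by a cycle composed of two internally disjoint monotone paths with the same source $s$ and the same sink $t$. Two level planar drawings $\Gamma_1,\Gamma_2$ of it are *left-to-right equivalent* if, for every line $\ell\in L$ and for any $x$ and $y$, each of which is a vertex or an edge of $G$, $x$ precedes $y$ on $\ell$ in $\Gamma_1$ if and only if $x$ precedes $y$ on $\ell$ in $\Gamma_2$ (that is, both meet $\ell$ and the intersection point of $x$ with $\ell$ comes before that of $y$). **Lemma.** Let $\Gamma_1$ and $\Gamma_2$ be two left-to-right equivalent strictly-convex level planar drawings of a hierarchical-st strictly-convex graph $(G,\vec d,L,\gamma)$, both respecting its plane embedding. Consider the linear morph, in which at time $t\in[0,1]$ each vertex $v$ is at $(1-t)\,\Gamma_1(v)+t\,\Gamma_2(v)$. This morph is unidirectional, i.e. the straight-line trajectories of all the vertices are parallel to a common direction. It is also strictly convex: at every $t\in[0,1]$ the drawing is planar, respects the plane embedding of $G$ and is strictly convex, and each of its faces (including the outer one) is delimited by a strictly-convex polygon. -/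

import Mathlib

open scoped Topology

noncomputable section

/-! The Euclidean plane is `ℂ`. A straight-line drawing of a graph on `V` is given by the positions
`Γ : V → ℂ` of the vertices; every edge is drawn as the segment between its end-vertices. -/

namespace PlaneDrawing

variable {V : Type*}

/-- The segment representing an edge in the drawing `Γ`. -/
def edgeSegment (Γ : V → ℂ) (e : Sym2 V) : Set ℂ :=
  Sym2.lift ⟨fun u v => segment ℝ (Γ u) (Γ v), fun u v => segment_symm ℝ (Γ u) (Γ v)⟩ e

/-- `Γ` is a straight-line planar drawing of `G`: distinct vertices are distinct points, no vertex
lies in the interior of an edge, and distinct edges are internally disjoint. -/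
structure IsPlanarDrawing (G : SimpleGraph V) (Γ : V → ℂ) : Prop where
  injective : Function.Injective Γ
  vertex_notMem : ∀ u v w : V, G.Adj u v → Γ w ∉ openSegment ℝ (Γ u) (Γ v)
  edges_disjoint : ∀ u v x y : V, G.Adj u v → G.Adj x y → s(u, v) ≠ s(x, y) →
    Disjoint (openSegment ℝ (Γ u) (Γ v)) (openSegment ℝ (Γ x) (Γ y))

/-- The set of points of the plane covered by the vertices and edges of the drawing. -/
def drawnSet (G : SimpleGraph V) (Γ : V → ℂ) : Set ℂ :=
  Set.range Γ ∪ ⋃ e ∈ G.edgeSet, edgeSegment Γ e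

/-- The faces of a drawing: the connected components of the complement of the drawing. A face is
internal if it is bounded; the unbounded face is the outer face. -/
def IsFace (G : SimpleGraph V) (Γ : V → ℂ) (F : Set ℂ) : Prop :=
  ∃ p ∈ (drawnSet G Γ)ᶜ, F = connectedComponentIn (drawnSet G Γ)ᶜ p

/-- The outer face. -/
def IsOuterFace (G : SimpleGraph V) (Γ : V → ℂ) (F : Set ℂ) : Prop :=
  IsFace G Γ F ∧ ¬ Bornology.IsBounded F

/-- The angle in `(0, 2π]` of the counter-clockwise rotation bringing the direction of `x` to the
direction of `y` (a full turn if these directions coincide). -/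
def ccwAngle (x y : ℂ) : ℝ :=
  if 0 < Complex.arg (y / x) then Complex.arg (y / x) else Complex.arg (y / x) + 2 * Real.pi

/-- The angle at `v` swept counter-clockwise from the edge `va` to the edge `vb` is an angle at
`v` in `F`: near `v`, the open sector between the two edges is contained in `F`. When `F` is a face,
no edge enters the sector, so `va` and `vb` are consecutive around `v`
(with `a = b` when `v` has degree one). -/
def IsAngleIn (G : SimpleGraph V) (Γ : V → ℂ) (v a b : V) (F : Set ℂ) : Prop :=
  G.Adj v a ∧ G.Adj v b ∧ ∃ ε > 0, ∀ r ∈ Set.Ioo (0 : ℝ) ε,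
    ∀ θ ∈ Set.Ioo (0 : ℝ) (ccwAngle (Γ a - Γ v) (Γ b - Γ v)),
      Γ v + (r : ℂ) * Complex.exp ((θ : ℂ) * Complex.I) * (Γ a - Γ v) ∈ F

/-- A strictly-convex drawing: planar, every angle in an internal face is smaller than `π`, and
every angle in the outer face is larger than `π`. -/
structure IsStrictlyConvexDrawing (G : SimpleGraph V) (Γ : V → ℂ) : Prop where
  planar : IsPlanarDrawing G Γ
  convex_of_internal : ∀ F, IsFace G Γ F → Bornology.IsBounded F → ∀ v a b : V,
    IsAngleIn G Γ v a b F → ccwAngle (Γ a - Γ v) (Γ b - Γ v) < Real.pi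
  concave_of_outer : ∀ F, IsOuterFace G Γ F → ∀ v a b : V,
    IsAngleIn G Γ v a b F → Real.pi < ccwAngle (Γ a - Γ v) (Γ b - Γ v)

/-- `F` lies immediately to the left of the edge `ab` traversed from `a` to `b`. -/
def IsLeftOfEdge (Γ : V → ℂ) (a b : V) (F : Set ℂ) : Prop :=
  ∀ᶠ ε : ℝ in 𝓝[>] 0, midpoint ℝ (Γ a) (Γ b) + (ε : ℂ) * Complex.I * (Γ b - Γ a) ∈ F

/-- Two drawings determine the same clockwise orderings of the edges around each vertex, and have
the same outer face, that is, the same directed edges have the outer face on their left. -/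
structure Equivalent (G : SimpleGraph V) (Γ Γ' : V → ℂ) : Prop where
  same_order : ∀ v a b c : V, G.Adj v a → G.Adj v b → G.Adj v c →
    (ccwAngle (Γ a - Γ v) (Γ b - Γ v) < ccwAngle (Γ a - Γ v) (Γ c - Γ v) ↔
      ccwAngle (Γ' a - Γ' v) (Γ' b - Γ' v) < ccwAngle (Γ' a - Γ' v) (Γ' c - Γ' v))
  same_outer : ∀ a b : V, G.Adj a b →
    ((∃ F, IsOuterFace G Γ F ∧ IsLeftOfEdge Γ a b F) ↔
      ∃ F, IsOuterFace G Γ' F ∧ IsLeftOfEdge Γ' a b F)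

/-- A plane graph: a connected graph together with an equivalence class of planar drawings. -/
structure PlaneGraph (V : Type*) where
  graph : SimpleGraph V
  connected : graph.Connected
  embedding : Set (V → ℂ)
  embedding_isClass : ∃ Γ₀, IsPlanarDrawing graph Γ₀ ∧
    embedding = {Γ | IsPlanarDrawing graph Γ ∧ Equivalent graph Γ₀ Γ}

/-- A strictly-convex graph: a plane graph admitting a strictly-convex drawing with the given plane
embedding. -/
def PlaneGraph.IsStrictlyConvex (P : PlaneGraph V) : Prop :=
  ∃ Γ ∈ P.embedding, IsStrictlyConvexDrawing P.graph Γ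

/-- The part of the drawing covered by the edges of a walk. -/
def drawnWalk {G : SimpleGraph V} (Γ : V → ℂ) {u v : V} (p : G.Walk u v) : Set ℂ :=
  ⋃ e ∈ p.edges, edgeSegment Γ e

/-- The line orthogonal to `d` through the point `h • d`, for a unit vector `d`. -/
def levelLine (d : ℂ) (h : ℝ) : Set ℂ := {p | inner ℝ d p = h}

/-- A point on a line orthogonal to `d` precedes another one on that line. The line is oriented so
that `d` crosses it from its right to its left, i.e. its direction is `d` turned clockwise by
`π / 2`. -/
def PointPrecedes (d p q : ℂ) : Prop :=
  inner ℝ (-Complex.I * d) p < inner ℝ (-Complex.I * d) q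

/-- `Γ` maps every vertex to its line; an edge `uv` with `γ u < γ v`, being straight, is then
monotone with respect to `d`. -/
def IsLevelDrawing (d : ℂ) {L : Set ℝ} (γ : V → L) (Γ : V → ℂ) : Prop :=
  ∀ v, Γ v ∈ levelLine d (γ v)

/-- A hierarchical plane graph `(G, d, L, γ)`. The oriented line enters only through its direction,
the unit vector `d`; a line orthogonal to it is given by its signed offset along `d`, so that `L` is
a set of offsets, and the order of the lines in `L` is the order of the offsets. -/
structure HierarchicalPlaneGraph (V : Type*) extends PlaneGraph V where
  d : ℂ
  norm_d : ‖d‖ = 1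
  L : Set ℝ
  γ : V → L
  adj_ne : ∀ u v, graph.Adj u v → γ u ≠ γ v
  exists_level_drawing : ∃ Γ ∈ embedding, IsLevelDrawing d γ Γ

namespace HierarchicalPlaneGraph

variable (H : HierarchicalPlaneGraph V)

/-- A path is monotone if the levels strictly increase along it. -/
def IsMonotone {u v : V} (p : H.graph.Walk u v) : Prop :=
  ∀ e ∈ p.darts, H.γ e.fst < H.γ e.snd

/-- The face `F` of the drawing `Γ` is an st-face: the polygon delimiting it is composed of two
internally disjoint monotone paths from a source `s` to a sink `t`. -/
def IsSTFace (Γ : V → ℂ) (F : Set ℂ) : Prop :=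
  ∃ (s t : V) (p q : H.graph.Walk s t), p.IsPath ∧ q.IsPath ∧ p ≠ q ∧
    (∀ w, w ∈ p.support → w ∈ q.support → w = s ∨ w = t) ∧
    H.IsMonotone p ∧ H.IsMonotone q ∧ frontier F = drawnWalk Γ p ∪ drawnWalk Γ q

/-- A hierarchical-st plane graph: every face of the plane graph is an st-face (the boundaries of
the faces are the same in all the drawings of the plane embedding). -/
def IsST : Prop :=
  ∀ Γ ∈ H.embedding, ∀ F, IsFace H.graph Γ F → H.IsSTFace Γ F

/-- A hierarchical-st strictly-convex graph. -/
def IsSTStrictlyConvex : Prop :=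
  H.IsST ∧ H.toPlaneGraph.IsStrictlyConvex

/-- A strictly-convex level planar drawing of the hierarchical plane graph. -/
def IsStrictlyConvexLevelDrawing (Γ : V → ℂ) : Prop :=
  Γ ∈ H.embedding ∧ IsLevelDrawing H.d H.γ Γ ∧ IsStrictlyConvexDrawing H.graph Γ

/-- The point or segment representing a vertex or an edge. -/
def item (Γ : V → ℂ) : V ⊕ H.graph.edgeSet → Set ℂ :=
  Sum.elim (fun v => {Γ v}) (fun e => edgeSegment Γ e)

/-- The vertex or edge `x` precedes the vertex or edge `y` on the line `h` in `Γ`. In a level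
drawing a vertex or edge has at most one point on the line. -/
def Precedes (Γ : V → ℂ) (h : ℝ) (x y : V ⊕ H.graph.edgeSet) : Prop :=
  ∃ p ∈ H.item Γ x ∩ levelLine H.d h, ∃ q ∈ H.item Γ y ∩ levelLine H.d h, PointPrecedes H.d p q

/-- Left-to-right equivalence (`x` follows `y` means that `y` precedes `x`). -/
def LeftToRightEquivalent (Γ₁ Γ₂ : V → ℂ) : Prop :=
  ∀ h ∈ H.L, ∀ x y : V ⊕ H.graph.edgeSet, H.Precedes Γ₁ h x y ↔ H.Precedes Γ₂ h x y

end HierarchicalPlaneGraph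

/-- The drawing at time `t ∈ [0, 1]` of the linear morph: each vertex moves at constant speed along
a straight line from its position in `Γ₁` to its position in `Γ₂`. -/
def linearMorph (Γ₁ Γ₂ : V → ℂ) (t : ℝ) : V → ℂ :=
  fun v => AffineMap.lineMap (Γ₁ v) (Γ₂ v) t

/-- The trajectories of the vertices in the linear morph are parallel to a common direction. -/
def IsUnidirectional (Γ₁ Γ₂ : V → ℂ) : Prop :=
  ∃ e : ℂ, e ≠ 0 ∧ ∀ v, ∃ c : ℝ, Γ₂ v - Γ₁ v = c • e

/-- Positive iff `y` points strictly to the left of the direction of `x`. -/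
def cross (x y : ℂ) : ℝ := x.re * y.im - x.im * y.re

/-- `F` is delimited by a strictly-convex polygon: its boundary is the polygon representing a cycle
of `G`, and, when this cycle is traversed in one of its two directions, every vertex of it lies
strictly to the left of each edge of it that it is not an end-vertex of. -/
def IsDelimitedByStrictlyConvexPolygon (G : SimpleGraph V) (Γ : V → ℂ) (F : Set ℂ) : Prop :=
  ∃ (u : V) (c : G.Walk u u), c.IsCycle ∧ frontier F = drawnWalk Γ c ∧
    ∀ e ∈ c.darts, ∀ w ∈ c.support, w ≠ e.fst → w ≠ e.snd →
      0 < cross (Γ e.snd - Γ e.fst) (Γ w - Γ e.fst)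

/-- The linear morph is strictly-convex: at any time instant it is a planar drawing of the plane
graph (with its plane embedding), it is a strictly-convex drawing, and each of its faces is delimited
by a strictly-convex polygon. -/
def IsStrictlyConvexMorph (P : PlaneGraph V) (Γ₁ Γ₂ : V → ℂ) : Prop :=
  ∀ t ∈ Set.Icc (0 : ℝ) 1, linearMorph Γ₁ Γ₂ t ∈ P.embedding ∧
    IsStrictlyConvexDrawing P.graph (linearMorph Γ₁ Γ₂ t) ∧
    ∀ F, IsFace P.graph (linearMorph Γ₁ Γ₂ t) F →
      IsDelimitedByStrictlyConvexPolygon P.graph (linearMorph Γ₁ Γ₂ t) F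

end PlaneDrawing

end

open scoped Topology

noncomputable section

namespace PlaneDrawing

variable {V : Type*}

/-! ### Angles -/

/-! In orthonormal coordinates with `d` as the vertical direction (`levelCoords`), all level
drawings have the same heights, so the morph moves vertices horizontally and changes abscissae
linearly in time. No edge is horizontal: an edge is the graph of an affine function of the height
(`edgeX`), and a monotone path is the graph of a continuous one (`walkX`).

The combinatorial part rests on the horizontal order of vertices and edges at each height
(`SameOrder`). Left-to-right equivalence gives it at the levels; since edges are affine and do not
cross, it extends to all heights (`SameOrder.of_order`). Abscissae at a fixed height are affine in
time, so the order survives averaging (`SameOrder.combo`). The order determines planarity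
(`SameOrder.isPlanarDrawing`) and the rotation around each vertex (`SameOrder.same_order`).

It also determines which sides of edges are outer, provided that the faces of one drawing are
bounded by two monotone walks (`SameOrder.same_outer`). If nothing is drawn beyond an edge at the
height of its midpoint, a free ray shows that this side is outer. Otherwise the face on this side
has another boundary walk further out, and the order traps the side in the bounded region between
two graphs. Hence every intermediate drawing belongs to the embedding.

For convexity, an angle is smaller than π exactly when a cross product is positive. With the heights
fixed, this cross product is linear in the abscissae, so its value at time `t` is a convex
combination of its values in `Γ₁` and `Γ₂`. Those have the same sign, because equivalent drawings
have the same angles in corresponding faces (`Equivalent.exists_isAngleIn`,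
`isStrictlyConvexDrawing_combo`).

Finally, the st condition applies to the intermediate drawing itself. The angle conditions give the
turns at the inner vertices of the two boundary paths of a face, and consistent local turns along a
monotone path imply global convexity (`edgeX_lt_of_turns`, `IsPathFace.isDelimited`). -/

lemma cross_mul_exp (x : ℂ) (r θ : ℝ) :
    cross x (r * Complex.exp (θ * Complex.I) * x) = r * Real.sin θ * ‖x‖ ^ 2 := by
  rw [← Complex.normSq_eq_norm_sq, Complex.normSq_apply, Complex.exp_mul_I, ← Complex.ofReal_cos,
    ← Complex.ofReal_sin]
  simp [cross, Complex.sin_ofReal_re]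
  ring

lemma ccwAngle_pos (x y : ℂ) : 0 < ccwAngle x y := by
  unfold ccwAngle
  split_ifs with h
  · exact h
  · linarith [Complex.neg_pi_lt_arg (y / x), Real.pi_pos]

lemma ccwAngle_le (x y : ℂ) : ccwAngle x y ≤ 2 * Real.pi := by
  unfold ccwAngle
  split_ifs with h
  · linarith [Complex.arg_le_pi (y / x), Real.pi_pos]
  · linarith

lemma ccwAngle_spec {x y : ℂ} (hx : x ≠ 0) (hy : y ≠ 0) :
    ∃ r : ℝ, 0 < r ∧ y = r * Complex.exp (ccwAngle x y * Complex.I) * x := by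
  refine ⟨‖y / x‖, norm_pos_iff.2 (div_ne_zero hy hx), ?_⟩
  have h : Complex.exp (ccwAngle x y * Complex.I) = Complex.exp ((y / x).arg * Complex.I) := by
    unfold ccwAngle
    split_ifs with h
    · rfl
    · push_cast
      rw [add_mul, Complex.exp_add, Complex.exp_two_pi_mul_I, mul_one]
  rw [h, Complex.norm_mul_exp_arg_mul_I, div_mul_cancel₀ _ hx]

lemma ccwAngle_eq {x y : ℂ} (hx : x ≠ 0) {r θ : ℝ} (hr : 0 < r) (h0 : 0 < θ)
    (h2 : θ ≤ 2 * Real.pi) (h : y = r * Complex.exp (θ * Complex.I) * x) : ccwAngle x y = θ := by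
  have hyx : y / x = r * Complex.exp (θ * Complex.I) := by rw [h, mul_div_cancel_right₀ _ hx]
  unfold ccwAngle
  rcases le_or_gt θ Real.pi with hθ | hθ
  · have : Complex.arg (y / x) = θ := by
      rw [hyx, Complex.exp_mul_I]
      exact Complex.arg_mul_cos_add_sin_mul_I hr ⟨by linarith [Real.pi_pos], hθ⟩
    rw [this, if_pos h0]
  · have : Complex.arg (y / x) = θ - 2 * Real.pi := by
      have h' : Complex.exp (θ * Complex.I) =
          Complex.exp ((θ - 2 * Real.pi : ℝ) * Complex.I) := by
        push_cast
        rw [sub_mul, Complex.exp_sub, Complex.exp_two_pi_mul_I, div_one]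
      rw [hyx, h', Complex.exp_mul_I]
      exact Complex.arg_mul_cos_add_sin_mul_I hr ⟨by linarith, by linarith [Real.pi_pos]⟩
    rw [this, if_neg (by linarith)]
    ring

lemma exists_cross_eq_mul_sin {x y : ℂ} (hx : x ≠ 0) (hy : y ≠ 0) :
    ∃ k : ℝ, 0 < k ∧ cross x y = k * Real.sin (ccwAngle x y) := by
  obtain ⟨r, hr, h⟩ := ccwAngle_spec hx hy
  refine ⟨r * ‖x‖ ^ 2, by have := norm_pos_iff.2 hx; positivity, ?_⟩
  conv_lhs => rw [h]
  rw [cross_mul_exp]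
  ring

lemma sin_neg_of_gt_pi {θ : ℝ} (h : Real.pi < θ) (h2 : θ < 2 * Real.pi) : Real.sin θ < 0 := by
  have := Real.sin_pos_of_pos_of_lt_pi (x := θ - Real.pi) (by linarith) (by linarith)
  rw [Real.sin_sub_pi] at this
  linarith

/-- The cross product is a positive multiple of the sine of the angle. This replaces a condition on
an angle by the sign of a bilinear expression, which can be interpolated. -/
lemma ccwAngle_lt_pi_iff {x y : ℂ} (hx : x ≠ 0) (hy : y ≠ 0) :
    ccwAngle x y < Real.pi ↔ 0 < cross x y := by
  obtain ⟨k, hk, h⟩ := exists_cross_eq_mul_sin hx hy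
  rw [h, mul_pos_iff_of_pos_left hk]
  refine ⟨fun h' => Real.sin_pos_of_pos_of_lt_pi (ccwAngle_pos _ _) h', fun h' => ?_⟩
  by_contra! h''
  rcases h''.eq_or_lt with h1 | h1
  · rw [← h1] at h'; simp at h'
  rcases (ccwAngle_le x y).eq_or_lt with h2 | h2
  · rw [h2] at h'; simp at h'
  linarith [sin_neg_of_gt_pi h1 h2]

lemma pi_lt_ccwAngle_of_cross_neg {x y : ℂ} (hx : x ≠ 0) (hy : y ≠ 0) (hc : cross x y < 0) :
    Real.pi < ccwAngle x y := by
  obtain ⟨k, hk, h⟩ := exists_cross_eq_mul_sin hx hy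
  by_contra! h'
  have := Real.sin_nonneg_of_nonneg_of_le_pi (ccwAngle_pos x y).le h'
  nlinarith

/-- The second alternative is the full turn, the only angle above π whose sine is not negative. -/
lemma cross_neg_or_of_pi_lt_ccwAngle {x y : ℂ} (hx : x ≠ 0) (hy : y ≠ 0)
    (hc : Real.pi < ccwAngle x y) : cross x y < 0 ∨ ∃ r : ℝ, 0 < r ∧ y = r * x := by
  rcases (ccwAngle_le x y).lt_or_eq with h2 | h2
  · obtain ⟨k, hk, h⟩ := exists_cross_eq_mul_sin hx hy
    rw [h]
    exact Or.inl (mul_neg_of_pos_of_neg hk (sin_neg_of_gt_pi hc h2))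
  · obtain ⟨r, hr, h⟩ := ccwAngle_spec hx hy
    rw [h2] at h
    push_cast at h
    rw [Complex.exp_two_pi_mul_I, mul_one] at h
    exact Or.inr ⟨r, hr, h⟩

lemma ccwAngle_self {x : ℂ} (hx : x ≠ 0) : ccwAngle x x = 2 * Real.pi :=
  ccwAngle_eq hx one_pos (by linarith [Real.pi_pos]) le_rfl (by simp)

/-- The angle from `x` to `y` in terms of their angles from a reference direction `u`. -/
lemma ccwAngle_eq_sub {u x y : ℂ} (hu : u ≠ 0) (hx : x ≠ 0) (hy : y ≠ 0) :
    ccwAngle x y = ccwAngle u y - ccwAngle u x +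
      if ccwAngle u x < ccwAngle u y then 0 else 2 * Real.pi := by
  obtain ⟨r, hr, h⟩ := ccwAngle_spec hu hx
  obtain ⟨s, hs, h'⟩ := ccwAngle_spec hu hy
  have := ccwAngle_pos u x
  have := ccwAngle_pos u y
  have := ccwAngle_le u x
  have := ccwAngle_le u y
  set α := ccwAngle u x
  set β := ccwAngle u y
  have hr' : (r : ℂ) ≠ 0 := by exact_mod_cast hr.ne'
  have key : y = (s / r : ℝ) * Complex.exp ((β - α : ℝ) * Complex.I) * x := by
    rw [h, h']
    push_cast
    rw [sub_mul, Complex.exp_sub]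
    field_simp
  apply ccwAngle_eq hx (div_pos hs hr)
  · split_ifs <;> linarith
  · split_ifs <;> linarith
  · rw [key]
    split_ifs
    · simp
    · congr 2
      push_cast
      rw [add_mul, Complex.exp_add, Complex.exp_two_pi_mul_I, mul_one]

/-- The comparison of two angles at the same base direction depends only on the order of the angles
from a reference direction. -/
lemma ccwAngle_lt_iff_of_order {u a b c a' b' c' : ℂ} (hu : u ≠ 0) (ha : a ≠ 0) (hb : b ≠ 0)
    (hc : c ≠ 0) (ha' : a' ≠ 0) (hb' : b' ≠ 0) (hc' : c' ≠ 0)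
    (hab : ccwAngle u a < ccwAngle u b ↔ ccwAngle u a' < ccwAngle u b')
    (hac : ccwAngle u a < ccwAngle u c ↔ ccwAngle u a' < ccwAngle u c')
    (hbc : ccwAngle u b < ccwAngle u c ↔ ccwAngle u b' < ccwAngle u c') :
    ccwAngle a b < ccwAngle a c ↔ ccwAngle a' b' < ccwAngle a' c' := by
  rw [ccwAngle_eq_sub hu ha hb, ccwAngle_eq_sub hu ha hc, ccwAngle_eq_sub hu ha' hb',
    ccwAngle_eq_sub hu ha' hc']
  have := Real.pi_pos
  have := ccwAngle_pos u a
  have := ccwAngle_le u a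
  have := ccwAngle_pos u b
  have := ccwAngle_le u b
  have := ccwAngle_pos u c
  have := ccwAngle_le u c
  have := ccwAngle_pos u a'
  have := ccwAngle_le u a'
  have := ccwAngle_pos u b'
  have := ccwAngle_le u b'
  have := ccwAngle_pos u c'
  have := ccwAngle_le u c'
  by_cases h1 : ccwAngle u a < ccwAngle u b <;> by_cases h2 : ccwAngle u a < ccwAngle u c
  · rw [if_pos h1, if_pos h2, if_pos (hab.1 h1), if_pos (hac.1 h2)]
    simpa using hbc
  · have h1' := hab.1 h1
    have h2' := mt hac.2 h2
    rw [if_pos h1, if_neg h2, if_pos h1', if_neg h2']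
    constructor <;> intro <;> linarith
  · have h1' := mt hab.2 h1
    have h2' := hac.1 h2
    rw [if_neg h1, if_pos h2, if_neg h1', if_pos h2']
    constructor <;> intro <;> linarith
  · rw [if_neg h1, if_neg h2, if_neg (mt hab.2 h1), if_neg (mt hac.2 h2)]
    simpa using hbc

/-- Among directions on the same side of the reference line, angles are ordered by `cross`. -/
lemma ccwAngle_lt_iff_cross {u a b : ℂ} (hu : u ≠ 0) (hab : 0 < cross u a * cross u b) :
    ccwAngle u a < ccwAngle u b ↔ 0 < cross a b := by
  have ha : a ≠ 0 := by rintro rfl; simp [cross] at hab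
  have hb : b ≠ 0 := by rintro rfl; simp [cross] at hab
  rw [← ccwAngle_lt_pi_iff ha hb, ccwAngle_eq_sub hu ha hb]
  have hpi := Real.pi_pos
  have h1 := ccwAngle_pos u a
  have h2 := ccwAngle_le u a
  have h3 := ccwAngle_pos u b
  have h4 := ccwAngle_le u b
  rcases pos_and_pos_or_neg_and_neg_of_mul_pos hab with ⟨h, h'⟩ | ⟨h, h'⟩
  · rw [← ccwAngle_lt_pi_iff hu ha] at h
    rw [← ccwAngle_lt_pi_iff hu hb] at h'
    split_ifs with h0 <;> simp only [h0, true_iff, false_iff, not_lt] <;> linarith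
  · have := pi_lt_ccwAngle_of_cross_neg hu ha h
    have := pi_lt_ccwAngle_of_cross_neg hu hb h'
    split_ifs with h0 <;> simp only [h0, true_iff, false_iff, not_lt] <;> linarith

lemma ccwAngle_lt_of_cross_pos_of_neg {u a b : ℂ} (hu : u ≠ 0) (ha : 0 < cross u a)
    (hb : cross u b < 0) : ccwAngle u a < ccwAngle u b := by
  have ha0 : a ≠ 0 := by rintro rfl; simp [cross] at ha
  have hb0 : b ≠ 0 := by rintro rfl; simp [cross] at hb
  have := pi_lt_ccwAngle_of_cross_neg hu hb0 hb
  have := (ccwAngle_lt_pi_iff hu ha0).2 ha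
  linarith

/-- A direction in the sector from `A` to `B`, on different sides of the line of `u`, is to the left
of `A` or to the right of `B`, according to its side. -/
lemma cross_pos_of_mem_sector {u A B : ℂ} (hu : u ≠ 0) (hA : 0 < cross u A) (hB : cross u B < 0)
    {r θ : ℝ} (hr : 0 < r) (hθ : θ ∈ Set.Ioo 0 (ccwAngle A B)) :
    (0 ≤ cross u (r * Complex.exp (θ * Complex.I) * A) →
      0 < cross A (r * Complex.exp (θ * Complex.I) * A)) ∧
    (cross u (r * Complex.exp (θ * Complex.I) * A) < 0 →
      0 < cross (r * Complex.exp (θ * Complex.I) * A) B) := by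
  have hA0 : A ≠ 0 := by rintro rfl; simp [cross] at hA
  have hB0 : B ≠ 0 := by rintro rfl; simp [cross] at hB
  have hlt := ccwAngle_lt_of_cross_pos_of_neg hu hA hB
  have hα := (ccwAngle_lt_pi_iff hu hA0).2 hA
  have hα0 := ccwAngle_pos u A
  have hβ2 := ccwAngle_le u B
  obtain ⟨h0, h1⟩ := hθ
  rw [ccwAngle_eq_sub hu hA0 hB0, if_pos hlt, add_zero] at h1
  obtain ⟨s, hs, hsA⟩ := ccwAngle_spec hu hA0
  obtain ⟨t, ht, htB⟩ := ccwAngle_spec hu hB0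
  set α := ccwAngle u A
  set β := ccwAngle u B
  -- Measured from `u`, the direction in the sector has angle `α + θ`, strictly between `α` and `β`;
  -- the sign of its cross product with `u` tells on which side of π this angle lies.
  have hw : (r : ℂ) * Complex.exp (θ * Complex.I) * A =
      (r * s : ℝ) * Complex.exp ((α + θ : ℝ) * Complex.I) * u := by
    rw [hsA]
    push_cast
    rw [add_mul, Complex.exp_add]
    ring
  have hupos := norm_pos_iff.2 hu
  have hApos := norm_pos_iff.2 hA0
  constructor
  · intro h
    rw [hw, cross_mul_exp] at h
    rw [cross_mul_exp]
    have h3 : α + θ ≤ Real.pi := by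
      by_contra! h3
      have := sin_neg_of_gt_pi h3 (by linarith)
      have : r * s * Real.sin (α + θ) * ‖u‖ ^ 2 < 0 :=
        mul_neg_of_neg_of_pos (mul_neg_of_pos_of_neg (by positivity) this) (by positivity)
      linarith
    have := Real.sin_pos_of_pos_of_lt_pi h0 (by linarith)
    positivity
  · intro h
    rw [hw, cross_mul_exp] at h
    have h3 : Real.pi < α + θ := by
      by_contra! h3
      have := Real.sin_nonneg_of_nonneg_of_le_pi (by linarith) h3
      have : 0 ≤ r * s * Real.sin (α + θ) * ‖u‖ ^ 2 := by positivity
      linarith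
    have h4 : B = (t / (r * s) : ℝ) * Complex.exp ((β - (α + θ) : ℝ) * Complex.I) *
        ((r : ℂ) * Complex.exp (θ * Complex.I) * A) := by
      have hr' : (r : ℂ) ≠ 0 := by exact_mod_cast hr.ne'
      have hs' : (s : ℂ) ≠ 0 := by exact_mod_cast hs.ne'
      rw [hw, htB, Complex.ofReal_sub β, sub_mul, Complex.exp_sub]
      push_cast
      field_simp
    have hw0 : (r : ℂ) * Complex.exp (θ * Complex.I) * A ≠ 0 :=
      mul_ne_zero (mul_ne_zero (by exact_mod_cast hr.ne') (Complex.exp_ne_zero _)) hA0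
    have hwpos := norm_pos_iff.2 hw0
    rw [h4, cross_mul_exp]
    have := Real.sin_pos_of_pos_of_lt_pi (x := β - (α + θ)) (by linarith) (by linarith)
    positivity

/-! ### Edges and monotone walks in coordinates -/

/-- The abscissa at height `h` of the line through the points `(x u, y u)` and `(x v, y v)`. -/
def edgeX (x y : V → ℝ) (u v : V) (h : ℝ) : ℝ :=
  x u + (h - y u) / (y v - y u) * (x v - x u)

lemma edgeX_left (x y : V → ℝ) (u v : V) : edgeX x y u v (y u) = x u := by simp [edgeX]

lemma edgeX_right (x y : V → ℝ) {u v : V} (h : y u < y v) : edgeX x y u v (y v) = x v := by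
  rw [edgeX, div_self (sub_pos.2 h).ne']; ring

/-- The quotient by zero is multiplied by `x u - x u = 0`, so a vertex can be treated as a
degenerate edge. -/
lemma edgeX_self (x y : V → ℝ) (u : V) (h : ℝ) : edgeX x y u u h = x u := by simp [edgeX]

lemma continuous_edgeX (x y : V → ℝ) (u v : V) : Continuous (edgeX x y u v) := by
  unfold edgeX; fun_prop

/-- The slope form of `edgeX`. -/
lemma exists_edgeX_eq (x y : V → ℝ) {u v : V} (h : y u < y v) :
    ∃ σ : ℝ, x v = x u + σ * (y v - y u) ∧ ∀ k, edgeX x y u v k = x u + σ * (k - y u) := by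
  have := (sub_pos.2 h).ne'
  refine ⟨(x v - x u) / (y v - y u), by field_simp; ring, fun k => ?_⟩
  unfold edgeX
  field_simp

lemma edgeX_neg (x y : V → ℝ) (u v : V) (h : ℝ) :
    edgeX (fun w => -x w) y u v h = -edgeX x y u v h := by
  unfold edgeX; ring

/-- `edgeX` is affine along an affine combination of abscissae. -/
lemma edgeX_combo {x x₁ x₂ y : V → ℝ} {t : ℝ} (hx : ∀ v, x v = (1 - t) * x₁ v + t * x₂ v)
    (u v : V) (h : ℝ) :
    edgeX x y u v h = (1 - t) * edgeX x₁ y u v h + t * edgeX x₂ y u v h := by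
  unfold edgeX; rw [hx, hx]; ring

section Walk

variable {G : SimpleGraph V}

/-- The function `y` increases along the walk. -/
def IncreasesAlong (y : V → ℝ) {u v : V} (p : G.Walk u v) : Prop :=
  ∀ e ∈ p.darts, y e.fst < y e.snd

/-- The abscissa at height `h` of a walk along which `y` increases. -/
def walkX (x y : V → ℝ) : {u v : V} → G.Walk u v → ℝ → ℝ
  | u, _, .nil, _ => x u
  | u, _, .cons (v := w) _ p, h => if h ≤ y w then edgeX x y u w h else walkX x y p h

lemma increasesAlong_cons {y : V → ℝ} {u v w : V} {a : G.Adj u v} {p : G.Walk v w} :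
    IncreasesAlong y (.cons a p) ↔ y u < y v ∧ IncreasesAlong y p := by
  simp [IncreasesAlong]

lemma walkX_start {x y : V → ℝ} {u v : V} {p : G.Walk u v} (hp : IncreasesAlong y p) :
    walkX x y p (y u) = x u := by
  cases p with
  | nil => rfl
  | cons a p =>
    rw [increasesAlong_cons] at hp
    rw [walkX, if_pos hp.1.le, edgeX_left]

/-- Consecutive edges agree at their common vertex. Outside the range of the walk the function is
still continuous: a nonempty walk continues its first edge as a line below the start, and the value
is constant above the end. -/
lemma continuous_walkX (x : V → ℝ) {y : V → ℝ} {u v : V} {p : G.Walk u v}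
    (hp : IncreasesAlong y p) : Continuous (walkX x y p) := by
  induction p with
  | nil => exact continuous_const
  | cons a p ih =>
    rw [increasesAlong_cons] at hp
    refine Continuous.if_le (continuous_edgeX _ _ _ _) (ih hp.2) continuous_id continuous_const ?_
    rintro _ rfl
    rw [edgeX_right _ _ hp.1, walkX_start hp.2]

lemma IncreasesAlong.le_of_mem_support {y : V → ℝ} {u v w : V} {p : G.Walk u v}
    (hp : IncreasesAlong y p) (hw : w ∈ p.support) : y u ≤ y w ∧ y w ≤ y v := by
  induction p generalizing w with
  | nil => simp at hw; subst hw; simp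
  | cons a p ih =>
    rw [increasesAlong_cons] at hp
    have h1 : w ∈ p.support → _ := ih hp.2
    have h2 := hp.1
    have h3 := (ih hp.2 p.start_mem_support)
    rw [SimpleGraph.Walk.support_cons, List.mem_cons] at hw
    rcases hw with rfl | hw
    · exact ⟨le_rfl, by linarith⟩
    · exact ⟨by linarith [h1 hw], (h1 hw).2⟩

lemma IncreasesAlong.lt_of_mem_support {y : V → ℝ} {u v w : V} {p : G.Walk u v}
    (hp : IncreasesAlong y p) (hw : w ∈ p.support) (hu : w ≠ u) : y u < y w := by
  cases p with
  | nil => simp at hw; exact absurd hw hu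
  | cons a p =>
    rw [increasesAlong_cons] at hp
    rw [SimpleGraph.Walk.support_cons, List.mem_cons] at hw
    exact hp.1.trans_le (hp.2.le_of_mem_support (hw.resolve_left hu)).1

lemma exists_dart_of_ne_end {u v w : V} {p : G.Walk u v} (hw : w ∈ p.support) (hv : w ≠ v) :
    ∃ e ∈ p.darts, e.fst = w := by
  induction p with
  | nil => simp at hw; exact absurd hw hv
  | cons a p ih =>
    rw [SimpleGraph.Walk.support_cons, List.mem_cons] at hw
    by_cases h : w ∈ p.support
    · obtain ⟨e, he, h'⟩ := ih h hv
      exact ⟨e, by simp [he], h'⟩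
    · obtain rfl := hw.resolve_right h
      exact ⟨_, by rw [SimpleGraph.Walk.darts_cons]; exact List.mem_cons_self, rfl⟩

lemma exists_dart_of_ne_start {u v w : V} {p : G.Walk u v} (hw : w ∈ p.support) (hv : w ≠ u) :
    ∃ e ∈ p.darts, e.snd = w := by
  obtain ⟨e, he, h⟩ := exists_dart_of_ne_end (p := p.reverse) (by simpa using hw) hv
  rw [SimpleGraph.Walk.mem_darts_reverse] at he
  exact ⟨e.symm, he, h⟩

lemma IncreasesAlong.lt_end_of_mem_support {y : V → ℝ} {u v w : V} {p : G.Walk u v}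
    (hp : IncreasesAlong y p) (hw : w ∈ p.support) (hu : w ≠ v) : y w < y v := by
  obtain ⟨e, he, rfl⟩ := exists_dart_of_ne_end hw hu
  exact (hp e he).trans_le (hp.le_of_mem_support (p.dart_snd_mem_support_of_mem_darts he)).2

lemma walkX_of_dart (x : V → ℝ) {y : V → ℝ} {u v : V} {p : G.Walk u v} (hp : IncreasesAlong y p)
    {e : G.Dart} (he : e ∈ p.darts) {h : ℝ} (h1 : y e.fst ≤ h) (h2 : h ≤ y e.snd) :
    walkX x y p h = edgeX x y e.fst e.snd h := by
  induction p with
  | nil => simp at he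
  | @cons u w v a p ih =>
    rw [increasesAlong_cons] at hp
    rw [SimpleGraph.Walk.darts_cons, List.mem_cons] at he
    rcases he with rfl | he
    · rw [walkX, if_pos h2]
    · have h3 := (hp.2.le_of_mem_support (p.dart_fst_mem_support_of_mem_darts he)).1
      rw [walkX, ← ih hp.2 he]
      split_ifs with h4
      · obtain rfl : h = y w := le_antisymm h4 (h3.trans h1)
        rw [edgeX_right _ _ hp.1, walkX_start hp.2]
      · rfl

lemma exists_dart_of_height {y : V → ℝ} {u v : V} {p : G.Walk u v} (hp : IncreasesAlong y p)
    (huv : y u < y v) {h : ℝ} (h1 : y u ≤ h) (h2 : h ≤ y v) :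
    ∃ e ∈ p.darts, y e.fst ≤ h ∧ h ≤ y e.snd := by
  induction p with
  | nil => exact absurd huv (lt_irrefl _)
  | @cons u w v a p ih =>
    rw [increasesAlong_cons] at hp
    rcases le_or_gt h (y w) with h3 | h3
    · exact ⟨⟨(u, w), a⟩, by simp, h1, h3⟩
    · obtain ⟨e, he, h⟩ := ih hp.2 (h3.trans_le h2) h3.le h2
      exact ⟨e, by simp [he], h⟩

lemma walkX_of_mem_support (x : V → ℝ) {y : V → ℝ} {u v w : V} {p : G.Walk u v}
    (hp : IncreasesAlong y p) (hw : w ∈ p.support) : walkX x y p (y w) = x w := by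
  by_cases h : w = u
  · rw [h]; exact walkX_start hp
  · obtain ⟨e, he, rfl⟩ := exists_dart_of_ne_start hw h
    rw [walkX_of_dart x hp he (hp e he).le le_rfl, edgeX_right _ _ (hp e he)]

lemma walkX_end (x : V → ℝ) {y : V → ℝ} {u v : V} {p : G.Walk u v}
    (hp : IncreasesAlong y p) : walkX x y p (y v) = x v :=
  walkX_of_mem_support x hp p.end_mem_support

lemma walkX_neg (x y : V → ℝ) {u v : V} (p : G.Walk u v) (h : ℝ) :
    walkX (fun w => -x w) y p h = -walkX x y p h := by
  induction p with
  | nil => rfl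
  | cons a p ih =>
    rw [walkX, walkX, ih, edgeX_neg]
    split_ifs <;> rfl

/-- A walk along which `y` increases is a single edge if it contains a dart joining its ends. -/
lemma IncreasesAlong.eq_of_dart {y : V → ℝ} {u v : V} {p : G.Walk u v} (hp : IncreasesAlong y p)
    {e : G.Dart} (he : e ∈ p.darts) (h1 : e.fst = u) (h2 : e.snd = v) :
    ∃ a : G.Adj u v, p = .cons a .nil := by
  cases p with
  | nil => simp at he
  | cons a p =>
    rw [increasesAlong_cons] at hp
    rw [SimpleGraph.Walk.darts_cons, List.mem_cons] at he
    rcases he with rfl | he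
    · obtain rfl : _ = v := h2
      cases p with
      | nil => exact ⟨a, rfl⟩
      | cons b p =>
        rw [increasesAlong_cons] at hp
        linarith [(hp.2.2.le_of_mem_support p.start_mem_support).2]
    · have := (hp.2.le_of_mem_support (p.dart_fst_mem_support_of_mem_darts he)).1
      rw [h1] at this
      linarith

/-- Along a walk that turns left at each of its inner vertices, every vertex lies to the right of
the line through each edge that does not contain it. -/
lemma edgeX_lt_of_turns {x y : V → ℝ} {u v : V} {p : G.Walk u v} (hp : IncreasesAlong y p)
    (hc : ∀ e ∈ p.darts, ∀ f ∈ p.darts, e.snd = f.fst → edgeX x y e.fst e.snd (y f.snd) < x f.snd)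
    {e : G.Dart} (he : e ∈ p.darts) {w : V} (hw : w ∈ p.support) (h1 : w ≠ e.fst)
    (h2 : w ≠ e.snd) : edgeX x y e.fst e.snd (y w) < x w := by
  induction p generalizing e w with
  | nil => simp at he
  | @cons u v t a p ih =>
    rw [increasesAlong_cons] at hp
    have ih' := @ih hp.2 (fun e he f hf => hc e (by simp [he]) f (by simp [hf]))
    rw [SimpleGraph.Walk.darts_cons, List.mem_cons] at he
    rw [SimpleGraph.Walk.support_cons, List.mem_cons] at hw
    cases p with
    | nil =>
      simp at he hw
      subst he
      rcases hw with rfl | rfl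
      · exact absurd rfl h1
      · exact absurd rfl h2
    | @cons _ v' _ a' p =>
      have hp' := hp
      rw [increasesAlong_cons] at hp'
      have hvv' := hp'.2.1
      have hturn := hc ⟨(u, v), a⟩ (by simp) ⟨(v, v'), a'⟩ (by simp) rfl
      obtain ⟨σ₀, hσ₀, hl₀⟩ := exists_edgeX_eq x y hp.1
      obtain ⟨σ₁, hσ₁, hl₁⟩ := exists_edgeX_eq x y hvv'
      have hturn' : edgeX x y u v (y v') < x v' := hturn
      rw [hl₀] at hturn'
      -- Slopes are abscissa per height, so turning at the second vertex means that the slope grows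
      -- from the first edge to the second.
      have hσ : σ₀ < σ₁ := by
        have : σ₀ * (y v' - y v) < σ₁ * (y v' - y v) := by linarith
        exact lt_of_mul_lt_mul_right this (sub_pos.2 hvv').le
      rcases he with rfl | he
      · replace hw := hw.resolve_left h1
        have hvw := hp.2.lt_of_mem_support hw h2
        have h3 : edgeX x y v v' (y w) ≤ x w := by
          by_cases h4 : w = v'
          · rw [h4, edgeX_right _ _ hvv']
          · exact (ih' (e := ⟨(v, v'), a'⟩) (by simp) hw h2 h4).le
        change edgeX x y u v (y w) < x w
        rw [hl₀]
        rw [hl₁] at h3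
        have : σ₀ * (y w - y v) < σ₁ * (y w - y v) := mul_lt_mul_of_pos_right hσ (sub_pos.2 hvw)
        linarith
      · by_cases hw' : w ∈ (SimpleGraph.Walk.cons a' p).support
        · exact ih' he hw' h1 h2
        obtain rfl := hw.resolve_right hw'
        obtain ⟨σ, hs, hl⟩ := exists_edgeX_eq x y (hp.2 e he)
        rw [hl]
        -- The line of a later edge passes weakly on the low side of `v` and has slope at least `σ₁
        -- > σ₀`; prolonged down to the first vertex, it therefore passes strictly on its low side.
        have hsig : σ₁ ≤ σ ∧ x e.fst + σ * (y v - y e.fst) ≤ x v := by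
          rw [SimpleGraph.Walk.darts_cons, List.mem_cons] at he
          rcases he with rfl | he
          · have h6 : σ₁ * (y v' - y v) = σ * (y v' - y v) := by
              have h7 : x v' = x v + σ * (y v' - y v) := hs
              linarith
            refine ⟨(mul_right_cancel₀ (sub_pos.2 hvv').ne' h6).le, ?_⟩
            simp
          · have hf := p.dart_fst_mem_support_of_mem_darts he
            have hf' := (hp'.2.2.le_of_mem_support hf).1
            have hev : v ≠ e.fst := by rintro h; rw [← h] at hf'; linarith
            have hev2 : v ≠ e.snd := by
              rintro h
              have := hp.2 e (by simp [he])
              rw [← h] at this; linarith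
            have h5 := ih' (e := e) (w := v) (by simp [he]) (by simp) hev hev2
            have h3 : edgeX x y v v' (y e.fst) ≤ x e.fst := by
              by_cases h4 : e.fst = v'
              · rw [h4, edgeX_right _ _ hvv']
              · exact (ih' (e := ⟨(v, v'), a'⟩) (by simp) (by simp [hf]) (Ne.symm hev) h4).le
            rw [hl₁] at h3
            rw [hl] at h5
            refine ⟨?_, h5.le⟩
            have : σ₁ * (y e.fst - y v) < σ * (y e.fst - y v) := by linarith
            exact (lt_of_mul_lt_mul_right this (by linarith)).le
        have : σ₀ * (y v - y w) < σ * (y v - y w) :=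
          mul_lt_mul_of_pos_right (hσ.trans_le hsig.1) (sub_pos.2 hp.1)
        linarith [hsig.2]

/-- Along a walk that turns left at each of its inner vertices, the inner vertices lie to the left
of the chord. -/
lemma lt_edgeX_of_turns {x y : V → ℝ} {u v : V} {p : G.Walk u v} (hp : IncreasesAlong y p)
    (hc : ∀ e ∈ p.darts, ∀ f ∈ p.darts, e.snd = f.fst → edgeX x y e.fst e.snd (y f.snd) < x f.snd)
    {w : V} (hw : w ∈ p.support) (h1 : w ≠ u) (h2 : w ≠ v) : x w < edgeX x y u v (y w) := by
  obtain ⟨e, he, rfl⟩ := exists_dart_of_ne_end hw h2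
  have hu := hp.lt_of_mem_support hw h1
  have hv := hp.lt_end_of_mem_support hw h2
  have hse := hp e he
  have hus : u ≠ e.snd := by rintro h; rw [← h] at hse; linarith
  have h3 := edgeX_lt_of_turns hp hc he p.start_mem_support (Ne.symm h1) hus
  have h4 : edgeX x y e.fst e.snd (y v) ≤ x v := by
    by_cases h : v = e.snd
    · rw [h, edgeX_right _ _ hse]
    · exact (edgeX_lt_of_turns hp hc he p.end_mem_support (Ne.symm h2) h).le
  obtain ⟨σ, hs, hl⟩ := exists_edgeX_eq x y hse
  obtain ⟨τ, ht, hk⟩ := exists_edgeX_eq x y (hu.trans hv)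
  rw [hl] at h3 h4
  rw [hk]
  -- The deviation of the chord from the line of `e` is affine in the height: at the inner vertex it
  -- is the weighted mean of the deviations at the ends, one positive and the other nonnegative.
  have : (x u + τ * (y e.fst - y u) - x e.fst) * (y v - y u) =
    (x u - x e.fst - σ * (y u - y e.fst)) * (y v - y e.fst) +
      (x v - x e.fst - σ * (y v - y e.fst)) * (y e.fst - y u) := by
    rw [ht]; ring
  have h5 : 0 < (x u + τ * (y e.fst - y u) - x e.fst) * (y v - y u) := by
    rw [this]
    have := mul_pos (show 0 < x u - x e.fst - σ * (y u - y e.fst) by linarith) (sub_pos.2 hv)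
    have := mul_nonneg (show 0 ≤ x v - x e.fst - σ * (y v - y e.fst) by linarith) (sub_pos.2 hu).le
    linarith
  have := pos_of_mul_pos_left h5 (by linarith)
  linarith

/-- If two walks with common ends turn left and right, respectively, at their inner vertices, then
the inner vertices of the second one lie to the right of the edges of the first one. -/
lemma edgeX_lt_of_turns_of_turns {x y : V → ℝ} {u v : V} {p q : G.Walk u v}
    (hp : IncreasesAlong y p) (hq : IncreasesAlong y q)
    (hc : ∀ e ∈ p.darts, ∀ f ∈ p.darts, e.snd = f.fst → edgeX x y e.fst e.snd (y f.snd) < x f.snd)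
    (hd : ∀ e ∈ q.darts, ∀ f ∈ q.darts, e.snd = f.fst → x f.snd < edgeX x y e.fst e.snd (y f.snd))
    {e : G.Dart} (he : e ∈ p.darts) {w : V} (hw : w ∈ q.support) (h1 : w ≠ u) (h2 : w ≠ v) :
    edgeX x y e.fst e.snd (y w) < x w := by
  have h3 := lt_edgeX_of_turns (x := fun w => -x w) hq
    (fun e he f hf h => by rw [edgeX_neg]; exact neg_lt_neg (hd e he f hf h)) hw h1 h2
  rw [edgeX_neg] at h3
  have hu := hq.lt_of_mem_support hw h1
  have hv := hq.lt_end_of_mem_support hw h2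
  have weak : ∀ z ∈ p.support, edgeX x y e.fst e.snd (y z) ≤ x z := by
    intro z hz
    by_cases h : z = e.fst
    · rw [h, edgeX_left]
    by_cases h' : z = e.snd
    · rw [h', edgeX_right _ _ (hp e he)]
    exact (edgeX_lt_of_turns hp hc he hz h h').le
  have h4 := weak u p.start_mem_support
  have h5 := weak v p.end_mem_support
  obtain ⟨σ, hs, hl⟩ := exists_edgeX_eq x y (hp e he)
  obtain ⟨τ, ht, hk⟩ := exists_edgeX_eq x y (hu.trans hv)
  rw [hl] at h4 h5
  rw [hl]
  rw [hk] at h3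
  -- The line of `e` and the common chord of the two walks are both affine in the height, so the
  -- inequality at the ends `u` and `v` holds at the height of `w`. The chord thus separates the
  -- edges of `p` from the inner vertices of `q`.
  have h6 : (x e.fst + σ * (y w - y e.fst)) * (y v - y u) =
    (x e.fst + σ * (y u - y e.fst)) * (y v - y w) +
      (x e.fst + σ * (y v - y e.fst)) * (y w - y u) := by ring
  have h7 : (x u + τ * (y w - y u)) * (y v - y u) = x u * (y v - y w) + x v * (y w - y u) := by
    rw [ht]; ring
  have h8 := mul_le_mul_of_nonneg_right h4 (sub_pos.2 hv).le
  have h9 := mul_le_mul_of_nonneg_right h5 (sub_pos.2 hu).le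
  have h10 : (x e.fst + σ * (y w - y e.fst)) * (y v - y u) ≤
    (x u + τ * (y w - y u)) * (y v - y u) := by linarith
  have := le_of_mul_le_mul_right h10 (by linarith)
  linarith

end Walk

/-! ### Segments in coordinates -/

section Coordinates

variable (φ : ℂ ≃L[ℝ] ℝ × ℝ) (Γ : V → ℂ)

/-- The abscissa of a vertex. -/
def xOf (v : V) : ℝ := (φ (Γ v)).1

/-- The ordinate of a vertex. -/
def yOf (v : V) : ℝ := (φ (Γ v)).2

variable {φ Γ}

/-- The height of a point of a non-horizontal segment determines its barycentric weight, so the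
segment is a graph over the heights. -/
lemma mem_segment_iff {u v : V} (h : yOf φ Γ u < yOf φ Γ v) (z : ℂ) :
    z ∈ segment ℝ (Γ u) (Γ v) ↔ (φ z).2 ∈ Set.Icc (yOf φ Γ u) (yOf φ Γ v) ∧
      (φ z).1 = edgeX (xOf φ Γ) (yOf φ Γ) u v (φ z).2 := by
  have h0 := sub_pos.2 h
  constructor
  · rintro ⟨a, b, ha, hb, hab, rfl⟩
    obtain rfl : a = 1 - b := by linarith
    have h1 : (φ ((1 - b) • Γ u + b • Γ v)).2 = yOf φ Γ u + b * (yOf φ Γ v - yOf φ Γ u) := by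
      simp only [map_add, map_smul, Prod.snd_add, Prod.smul_snd, smul_eq_mul]
      unfold yOf; ring
    have h2 : (φ ((1 - b) • Γ u + b • Γ v)).1 = xOf φ Γ u + b * (xOf φ Γ v - xOf φ Γ u) := by
      simp only [map_add, map_smul, Prod.fst_add, Prod.smul_fst, smul_eq_mul]
      unfold xOf; ring
    rw [h1, h2]
    refine ⟨⟨by nlinarith, by nlinarith⟩, ?_⟩
    unfold edgeX
    field_simp
    ring
  · rintro ⟨⟨h1, h2⟩, h3⟩
    set b := ((φ z).2 - yOf φ Γ u) / (yOf φ Γ v - yOf φ Γ u) with hb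
    have hb' : b * (yOf φ Γ v - yOf φ Γ u) = (φ z).2 - yOf φ Γ u := by rw [hb]; field_simp
    refine ⟨1 - b, b, ?_, div_nonneg (by linarith) h0.le, by ring, ?_⟩
    · rw [sub_nonneg, hb, div_le_one h0]; linarith
    · apply φ.injective
      ext
      · simp only [map_add, map_smul, Prod.fst_add, Prod.smul_fst, smul_eq_mul]
        rw [h3, edgeX, ← hb]
        unfold xOf; ring
      · simp only [map_add, map_smul, Prod.snd_add, Prod.smul_snd, smul_eq_mul]
        unfold yOf at hb'
        linarith

lemma mem_openSegment_iff {u v : V} (h : yOf φ Γ u < yOf φ Γ v) (z : ℂ) :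
    z ∈ openSegment ℝ (Γ u) (Γ v) ↔ (φ z).2 ∈ Set.Ioo (yOf φ Γ u) (yOf φ Γ v) ∧
      (φ z).1 = edgeX (xOf φ Γ) (yOf φ Γ) u v (φ z).2 := by
  have h0 := sub_pos.2 h
  constructor
  · intro hz
    obtain ⟨h1, h2⟩ := (mem_segment_iff h z).1 (openSegment_subset_segment _ _ _ hz)
    refine ⟨?_, h2⟩
    obtain ⟨a, b, ha, hb, hab, rfl⟩ := hz
    obtain rfl : a = 1 - b := by linarith
    have h1 : (φ ((1 - b) • Γ u + b • Γ v)).2 = yOf φ Γ u + b * (yOf φ Γ v - yOf φ Γ u) := by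
      simp only [map_add, map_smul, Prod.snd_add, Prod.smul_snd, smul_eq_mul]
      unfold yOf; ring
    rw [h1]
    constructor <;> nlinarith
  · rintro ⟨⟨h1, h2⟩, h3⟩
    apply mem_openSegment_of_ne_left_right _ _ ((mem_segment_iff h z).2 ⟨⟨h1.le, h2.le⟩, h3⟩)
    · rintro rfl; exact lt_irrefl _ h1
    · rintro rfl; exact lt_irrefl _ h2

/-- A monotone walk has exactly one point at each height in its range. With this, face boundaries
can be handled as graphs of continuous functions. -/
lemma mem_drawnWalk_iff {G : SimpleGraph V} {u v : V} {p : G.Walk u v}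
    (hp : IncreasesAlong (yOf φ Γ) p) (huv : yOf φ Γ u < yOf φ Γ v) (z : ℂ) :
    z ∈ drawnWalk Γ p ↔ (φ z).2 ∈ Set.Icc (yOf φ Γ u) (yOf φ Γ v) ∧
      (φ z).1 = walkX (xOf φ Γ) (yOf φ Γ) p (φ z).2 := by
  simp only [drawnWalk, Set.mem_iUnion, exists_prop, SimpleGraph.Walk.edges, List.mem_map]
  constructor
  · rintro ⟨_, ⟨e, he, rfl⟩, hz⟩
    obtain ⟨⟨h1, h2⟩, h3⟩ := (mem_segment_iff (hp e he) z).1 hz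
    rw [walkX_of_dart _ hp he h1 h2]
    have h4 := (hp.le_of_mem_support (p.dart_fst_mem_support_of_mem_darts he)).1
    have h5 := (hp.le_of_mem_support (p.dart_snd_mem_support_of_mem_darts he)).2
    exact ⟨⟨h4.trans h1, h2.trans h5⟩, h3⟩
  · rintro ⟨⟨h1, h2⟩, h3⟩
    obtain ⟨e, he, h4, h5⟩ := exists_dart_of_height hp huv h1 h2
    rw [walkX_of_dart _ hp he h4 h5] at h3
    exact ⟨_, ⟨e, he, rfl⟩, (mem_segment_iff (hp e he) z).2 ⟨⟨h4, h5⟩, h3⟩⟩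

end Coordinates

/-! ### Faces -/

section Faces

variable {G : SimpleGraph V} {Γ : V → ℂ}

lemma isCompact_edgeSegment (Γ : V → ℂ) (e : Sym2 V) : IsCompact (edgeSegment Γ e) := by
  induction e with
  | _ u v =>
    change IsCompact (segment ℝ (Γ u) (Γ v))
    rw [segment_eq_image_lineMap]
    exact isCompact_Icc.image AffineMap.lineMap_continuous

lemma isCompact_drawnSet [Finite V] (G : SimpleGraph V) (Γ : V → ℂ) : IsCompact (drawnSet G Γ) :=
  (Set.finite_range Γ).isCompact.union
    ((Set.toFinite G.edgeSet).isCompact_biUnion fun e _ => isCompact_edgeSegment Γ e)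

lemma isOpen_compl_drawnSet [Finite V] (G : SimpleGraph V) (Γ : V → ℂ) :
    IsOpen (drawnSet G Γ)ᶜ :=
  (isCompact_drawnSet G Γ).isClosed.isOpen_compl

lemma segment_subset_drawnSet {u v : V} (h : G.Adj u v) :
    segment ℝ (Γ u) (Γ v) ⊆ drawnSet G Γ := fun _ hz =>
  Or.inr (Set.mem_biUnion (show s(u, v) ∈ G.edgeSet from h) hz)

lemma mem_drawnSet_of_vertex (v : V) : Γ v ∈ drawnSet G Γ := Or.inl ⟨v, rfl⟩

lemma mem_drawnSet_iff {z : ℂ} : z ∈ drawnSet G Γ ↔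
    (∃ v, Γ v = z) ∨ ∃ u v, G.Adj u v ∧ z ∈ segment ℝ (Γ u) (Γ v) := by
  constructor
  · rintro (h | h)
    · exact Or.inl h
    · simp only [Set.mem_iUnion] at h
      obtain ⟨e, he, hz⟩ := h
      induction e with
      | _ u v => exact Or.inr ⟨u, v, he, hz⟩
  · rintro (⟨v, rfl⟩ | ⟨u, v, h, hz⟩)
    · exact mem_drawnSet_of_vertex v
    · exact segment_subset_drawnSet h hz

lemma IsFace.subset_compl {F : Set ℂ} (hF : IsFace G Γ F) : F ⊆ (drawnSet G Γ)ᶜ := by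
  obtain ⟨p, hp, rfl⟩ := hF
  exact connectedComponentIn_subset _ _

lemma IsFace.isPreconnected {F : Set ℂ} (hF : IsFace G Γ F) : IsPreconnected F := by
  obtain ⟨p, hp, rfl⟩ := hF
  exact isPreconnected_connectedComponentIn

lemma IsFace.nonempty {F : Set ℂ} (hF : IsFace G Γ F) : F.Nonempty := by
  obtain ⟨p, hp, rfl⟩ := hF
  exact ⟨p, mem_connectedComponentIn hp⟩

lemma IsFace.isOpen [Finite V] {F : Set ℂ} (hF : IsFace G Γ F) : IsOpen F := by
  obtain ⟨p, hp, rfl⟩ := hF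
  exact (isOpen_compl_drawnSet G Γ).connectedComponentIn

lemma IsFace.subset_of_isPreconnected {F S : Set ℂ} (hF : IsFace G Γ F) (hS : IsPreconnected S)
    (h : S ⊆ (drawnSet G Γ)ᶜ) {z : ℂ} (hzS : z ∈ S) (hzF : z ∈ F) : S ⊆ F := by
  obtain ⟨p, hp, rfl⟩ := hF
  rw [connectedComponentIn_eq hzF]
  exact hS.subset_connectedComponentIn hzS h

lemma IsFace.eq_of_mem {F F' : Set ℂ} (hF : IsFace G Γ F) (hF' : IsFace G Γ F') {z : ℂ}
    (h : z ∈ F) (h' : z ∈ F') : F = F' :=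
  (hF'.subset_of_isPreconnected hF.isPreconnected hF.subset_compl h h').antisymm
    (hF.subset_of_isPreconnected hF'.isPreconnected hF'.subset_compl h' h)

lemma exists_isFace_mem {z : ℂ} (hz : z ∉ drawnSet G Γ) : ∃ F, IsFace G Γ F ∧ z ∈ F :=
  ⟨_, ⟨z, hz, rfl⟩, mem_connectedComponentIn hz⟩

lemma IsFace.mem_frontier [Finite V] {F : Set ℂ} (hF : IsFace G Γ F) {z : ℂ}
    (hz : z ∈ drawnSet G Γ) (h : z ∈ closure F) : z ∈ frontier F := by
  rw [hF.isOpen.frontier_eq]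
  exact ⟨h, fun hzF => hF.subset_compl hzF hz⟩

/-- Without frontier points in `S`, the part of `S` in `F` is both open and closed in `S`. -/
lemma _root_.IsPreconnected.subset_of_disjoint_frontier {S F : Set ℂ} (hS : IsPreconnected S)
    (hF : IsOpen F) (hd : ∀ z ∈ S, z ∉ frontier F) (hSF : (S ∩ F).Nonempty) : S ⊆ F := by
  refine hS.subset_of_closure_inter_subset hF hSF fun z ⟨hz, hzS⟩ => ?_
  by_contra hzF
  exact hd z hzS (by rw [hF.frontier_eq]; exact ⟨hz, hzF⟩)

lemma exists_mem_segment_frontier {F : Set ℂ} (hF : IsOpen F) {z w : ℂ} (hz : z ∈ F)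
    (hw : w ∉ F) : ∃ f ∈ frontier F, f ∈ segment ℝ w z ∧ f ≠ z := by
  by_contra! h
  have := (convex_segment w z).isPreconnected.subset_of_disjoint_frontier hF
    (fun f hf hf' => by
      have := h f hf' hf
      subst this
      rw [hF.frontier_eq] at hf'
      exact hf'.2 hz)
    ⟨z, right_mem_segment ℝ w z, hz⟩
  exact hw (this (left_mem_segment ℝ w z))

/-- For nonnegative radii, polar coordinates exhibit this set as the continuous image of a
half-plane. -/
lemma isPreconnected_compl_closedBall (r : ℝ) : IsPreconnected (Metric.closedBall (0 : ℂ) r)ᶜ := by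
  rcases lt_or_ge r 0 with hr | hr
  · rw [Metric.closedBall_eq_empty.2 hr, Set.compl_empty]
    exact isPreconnected_univ
  have : (Metric.closedBall (0 : ℂ) r)ᶜ =
      (fun p : ℝ × ℝ => (p.1 : ℂ) * Complex.exp (p.2 * Complex.I)) ''
        (Set.Ioi r ×ˢ Set.univ) := by
    ext z
    simp only [Set.mem_compl_iff, mem_closedBall_zero_iff, not_le, Set.mem_image, Set.mem_prod,
      Set.mem_Ioi, Set.mem_univ, and_true, Prod.exists]
    constructor
    · intro hz
      exact ⟨‖z‖, z.arg, hz, Complex.norm_mul_exp_arg_mul_I z⟩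
    · rintro ⟨s, θ, hs, rfl⟩
      rw [norm_mul, Complex.norm_exp_ofReal_mul_I, mul_one, Complex.norm_real]
      exact hs.trans_le (le_abs_self s)
  rw [this]
  exact (isPreconnected_Ioi.prod isPreconnected_univ).image _ (by fun_prop)

/-- Both sets meet the complement of a ball containing the drawing, and this complement is connected
and free of the drawing. -/
lemma IsOuterFace.subset_of_not_isBounded [Finite V] {F S : Set ℂ} (hF : IsOuterFace G Γ F)
    (hS : IsPreconnected S) (h : S ⊆ (drawnSet G Γ)ᶜ) (hb : ¬ Bornology.IsBounded S) : S ⊆ F := by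
  obtain ⟨r, hr⟩ := (isCompact_drawnSet G Γ).isBounded.subset_closedBall 0
  have key : ∀ T : Set ℂ, ¬ Bornology.IsBounded T →
      ∃ z ∈ T, z ∈ (Metric.closedBall (0 : ℂ) r)ᶜ := by
    intro T hT
    by_contra! h'
    exact hT (Metric.isBounded_closedBall.subset fun z hz => not_not.1 (h' z hz))
  obtain ⟨z, hzF, hz⟩ := key F hF.2
  obtain ⟨w, hwS, hw⟩ := key S hb
  have := hF.1.subset_of_isPreconnected (isPreconnected_compl_closedBall r)
    (Set.compl_subset_compl.2 hr) hz hzF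
  exact hF.1.subset_of_isPreconnected hS h hwS (this hw)

end Faces

/-! ### The faces next to an edge -/

section Edge

variable {G : SimpleGraph V} {Γ : V → ℂ}

/-- The points close to `K` on the left of the line through an edge. -/
def leftZone (Γ : V → ℂ) (a b : V) (K : Set ℂ) (δ : ℝ) : Set ℂ :=
  Metric.thickening δ K ∩ {z | 0 < cross (Γ b - Γ a) (z - Γ a)}

lemma cross_eq_zero_of_mem_segment {P Q z : ℂ} (h : z ∈ segment ℝ P Q) :
    cross (Q - P) (z - P) = 0 := by
  obtain ⟨a, b, ha, hb, hab, rfl⟩ := h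
  obtain rfl : a = 1 - b := by linarith
  simp [cross]
  ring

lemma convex_leftZone (Γ : V → ℂ) (a b : V) {K : Set ℂ} (hK : Convex ℝ K) (δ : ℝ) :
    Convex ℝ (leftZone Γ a b K δ) := by
  refine (hK.thickening δ).inter ?_
  intro z hz w hw s t hs ht hst
  simp only [Set.mem_ofPred_eq] at hz hw ⊢
  have : cross (Γ b - Γ a) (s • z + t • w - Γ a) =
      s * cross (Γ b - Γ a) (z - Γ a) + t * cross (Γ b - Γ a) (w - Γ a) := by
    obtain rfl : s = 1 - t := by linarith
    simp [cross]
    ring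
  rw [this]
  rcases hs.eq_or_lt with rfl | hs
  · obtain rfl : t = 1 := by linarith
    simpa using hw
  · have := mul_pos hs hz
    have := mul_nonneg ht hw.le
    linarith

lemma mem_segment_cases {P Q z : ℂ} (h : z ∈ segment ℝ P Q) :
    z = P ∨ z = Q ∨ z ∈ openSegment ℝ P Q := by
  by_cases h1 : z = P
  · exact Or.inl h1
  by_cases h2 : z = Q
  · exact Or.inr (Or.inl h2)
  exact Or.inr (Or.inr (mem_openSegment_of_ne_left_right (Ne.symm h1) (Ne.symm h2) h))

/-- An inner point of an edge belongs to no other edge. -/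
lemma IsPlanarDrawing.eq_of_mem (h : IsPlanarDrawing G Γ) {a b u v : V} (hab : G.Adj a b)
    (huv : G.Adj u v) {z : ℂ} (hz : z ∈ openSegment ℝ (Γ a) (Γ b))
    (hz' : z ∈ segment ℝ (Γ u) (Γ v)) : s(u, v) = s(a, b) := by
  by_contra hne
  rcases mem_segment_cases hz' with rfl | rfl | hz'
  · exact h.vertex_notMem _ _ _ hab hz
  · exact h.vertex_notMem _ _ _ hab hz
  · exact Set.disjoint_left.1 (h.edges_disjoint _ _ _ _ huv hab hne) hz' hz

/-- A compact part of the open edge has positive distance from the vertices and the other edges,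
while the edge itself is excluded by the strict inequality in the zone. -/
lemma exists_leftZone_subset [Finite V] (h : IsPlanarDrawing G Γ) {a b : V} (hab : G.Adj a b)
    {K : Set ℂ} (hK : IsCompact K) (hKs : K ⊆ openSegment ℝ (Γ a) (Γ b)) :
    ∃ δ > 0, leftZone Γ a b K δ ⊆ (drawnSet G Γ)ᶜ := by
  set C : Set ℂ := Set.range Γ ∪ ⋃ e ∈ G.edgeSet \ {s(a, b)}, edgeSegment Γ e with hC
  have hCc : IsClosed C := ((Set.finite_range Γ).isCompact.union
    ((Set.toFinite _).isCompact_biUnion fun e _ => isCompact_edgeSegment Γ e)).isClosed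
  have hd : Disjoint K C := by
    rw [Set.disjoint_left]
    rintro z hz (⟨w, rfl⟩ | hz')
    · exact h.vertex_notMem _ _ _ hab (hKs hz)
    · simp only [Set.mem_iUnion] at hz'
      obtain ⟨e, ⟨he, hne⟩, hz'⟩ := hz'
      induction e with
      | _ u v => exact hne (h.eq_of_mem hab he (hKs hz) hz')
  obtain ⟨δ, hδ, hδd⟩ := hd.exists_thickenings hK hCc
  refine ⟨δ, hδ, fun z ⟨hz, hz0⟩ hzd => ?_⟩
  have hzC : z ∉ C := fun hzC =>
    Set.disjoint_left.1 hδd hz (Metric.self_subset_thickening hδ _ hzC)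
  rcases mem_drawnSet_iff.1 hzd with ⟨v, rfl⟩ | ⟨u, v, huv, hz'⟩
  · exact hzC (Or.inl ⟨v, rfl⟩)
  · by_cases he : s(u, v) = s(a, b)
    · have hz'' : z ∈ segment ℝ (Γ a) (Γ b) := by
        have : edgeSegment Γ s(u, v) = edgeSegment Γ s(a, b) := by rw [he]
        exact this.subset hz'
      exact absurd (cross_eq_zero_of_mem_segment hz'') (ne_of_gt hz0)
    · exact hzC (Or.inr (Set.mem_biUnion (show s(u, v) ∈ G.edgeSet \ {s(a, b)} from ⟨huv, he⟩) hz'))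

lemma IsPlanarDrawing.sub_ne_zero (h : IsPlanarDrawing G Γ) {a b : V} (hab : G.Adj a b) :
    Γ b - Γ a ≠ 0 := sub_ne_zero_of_ne fun h' => hab.ne (h.injective h'.symm)

lemma midpoint_mem_openSegment {P Q : ℂ} : midpoint ℝ P Q ∈ openSegment ℝ P Q :=
  ⟨1 / 2, 1 / 2, by norm_num, by norm_num, by norm_num, by
    rw [midpoint_eq_smul_add, smul_add]; norm_num⟩

/-- The points used to define the left side of an edge belong eventually to its left zone. -/
lemma eventually_mem_leftZone {a b : V} (hab : Γ b - Γ a ≠ 0) {K : Set ℂ} {δ : ℝ} (hδ : 0 < δ)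
    (hm : midpoint ℝ (Γ a) (Γ b) ∈ K) :
    ∀ᶠ ε : ℝ in 𝓝[>] 0,
      midpoint ℝ (Γ a) (Γ b) + (ε : ℂ) * Complex.I * (Γ b - Γ a) ∈ leftZone Γ a b K δ := by
  have hcont : Continuous fun ε : ℝ =>
      midpoint ℝ (Γ a) (Γ b) + (ε : ℂ) * Complex.I * (Γ b - Γ a) := by fun_prop
  have h1 : ∀ᶠ ε : ℝ in 𝓝 0,
      midpoint ℝ (Γ a) (Γ b) + (ε : ℂ) * Complex.I * (Γ b - Γ a) ∈ Metric.thickening δ K := by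
    refine hcont.tendsto 0 (Metric.isOpen_thickening.mem_nhds ?_)
    simpa using Metric.self_subset_thickening hδ _ hm
  filter_upwards [h1.filter_mono nhdsWithin_le_nhds, self_mem_nhdsWithin] with ε h1 h2
  refine ⟨h1, ?_⟩
  have h3 : cross (Γ b - Γ a) (midpoint ℝ (Γ a) (Γ b) + (ε : ℂ) * Complex.I * (Γ b - Γ a) - Γ a) =
      ε * ‖Γ b - Γ a‖ ^ 2 := by
    have h4 := cross_eq_zero_of_mem_segment
      (openSegment_subset_segment ℝ _ _ (midpoint_mem_openSegment (P := Γ a) (Q := Γ b)))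
    rw [← Complex.normSq_eq_norm_sq, Complex.normSq_apply]
    simp only [cross] at h4 ⊢
    simp only [Complex.sub_re, Complex.sub_im, Complex.add_re, Complex.add_im, Complex.mul_re,
      Complex.mul_im, Complex.I_re, Complex.I_im, Complex.ofReal_re, Complex.ofReal_im] at h4 ⊢
    linear_combination h4
  rw [Set.mem_ofPred_eq, h3]
  have := norm_pos_iff.2 hab
  have : 0 < ε := h2
  positivity

/-- The zone is convex and avoids the drawing, so a face meeting it contains all of it. Membership
can thus be carried along the edge to its midpoint, where the left side is defined. -/
lemma IsFace.isLeftOfEdge {F : Set ℂ} (hF : IsFace G Γ F) {a b : V} (hab : Γ b - Γ a ≠ 0)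
    {K : Set ℂ} {δ : ℝ} (hδ : 0 < δ) (hK : Convex ℝ K) (hm : midpoint ℝ (Γ a) (Γ b) ∈ K)
    (hz : leftZone Γ a b K δ ⊆ (drawnSet G Γ)ᶜ) {z : ℂ} (hzF : z ∈ F)
    (hzz : z ∈ leftZone Γ a b K δ) : IsLeftOfEdge Γ a b F := by
  have := hF.subset_of_isPreconnected (convex_leftZone Γ a b hK δ).isPreconnected hz hzz hzF
  exact (eventually_mem_leftZone hab hδ hm).mono fun ε h => this h

lemma IsFace.eq_of_isLeftOfEdge {F F' : Set ℂ} (hF : IsFace G Γ F) (hF' : IsFace G Γ F') {a b : V}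
    (h : IsLeftOfEdge Γ a b F) (h' : IsLeftOfEdge Γ a b F') : F = F' := by
  obtain ⟨ε, h1, h2⟩ := (h.and h').exists
  exact hF.eq_of_mem hF' h1 h2

/-! ### Angles in faces -/

/-- A face with an angle at `v` starting at the edge `va` is on the left of this edge. -/
lemma IsFace.isLeftOfEdge_of_isAngleIn [Finite V] (hΓ : IsPlanarDrawing G Γ) {F : Set ℂ}
    (hF : IsFace G Γ F) {v a b : V} (h : IsAngleIn G Γ v a b F) : IsLeftOfEdge Γ v a F := by
  obtain ⟨ha, hb, ε, hε, h⟩ := h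
  have hne := hΓ.sub_ne_zero ha
  obtain ⟨s, hs0, hs1⟩ : ∃ s : ℝ, 0 < s ∧ s < min ε 1 := exists_between (by positivity)
  set P : ℂ := Γ v + (s : ℂ) * (Γ a - Γ v) with hP
  have hPs : P ∈ openSegment ℝ (Γ v) (Γ a) := by
    refine ⟨1 - s, s, by linarith [min_le_right ε 1], hs0, by ring, ?_⟩
    rw [hP, Complex.real_smul, Complex.real_smul]
    push_cast; ring
  -- The zone follows the edge from `P`, which is within the radius of the angle at `v`, to the
  -- midpoint.
  obtain ⟨δ, hδ, hz⟩ := exists_leftZone_subset hΓ ha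
    (K := segment ℝ P (midpoint ℝ (Γ v) (Γ a)))
    (by rw [segment_eq_image_lineMap]; exact isCompact_Icc.image AffineMap.lineMap_continuous)
    ((convex_openSegment _ _).segment_subset hPs midpoint_mem_openSegment)
  have hcont : Continuous fun θ : ℝ =>
      Γ v + (s : ℂ) * Complex.exp ((θ : ℂ) * Complex.I) * (Γ a - Γ v) := by fun_prop
  have h1 : ∀ᶠ θ : ℝ in 𝓝 0, Γ v + (s : ℂ) * Complex.exp ((θ : ℂ) * Complex.I) * (Γ a - Γ v) ∈
      Metric.thickening δ (segment ℝ P (midpoint ℝ (Γ v) (Γ a))) := by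
    refine hcont.tendsto 0 (Metric.isOpen_thickening.mem_nhds ?_)
    apply Metric.self_subset_thickening hδ
    simpa [hP] using left_mem_segment ℝ P (midpoint ℝ (Γ v) (Γ a))
  have h2 : ∀ᶠ θ : ℝ in 𝓝[>] 0, θ ∈ Set.Ioo 0
      (min (ccwAngle (Γ a - Γ v) (Γ b - Γ v)) Real.pi) :=
    Ioo_mem_nhdsGT (lt_min (ccwAngle_pos _ _) Real.pi_pos)
  obtain ⟨θ, h1, h2, h3⟩ := ((h1.filter_mono nhdsWithin_le_nhds).and h2).exists
  refine hF.isLeftOfEdge hne hδ (convex_segment _ _) (right_mem_segment _ _ _) hz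
    (h s ⟨hs0, hs1.trans_le (min_le_left _ _)⟩ θ ⟨h2, h3.trans_le (min_le_left _ _)⟩) ⟨h1, ?_⟩
  rw [Set.mem_ofPred_eq, add_sub_cancel_left, cross_mul_exp]
  have := Real.sin_pos_of_pos_of_lt_pi h2 (h3.trans_le (min_le_right _ _))
  have := norm_pos_iff.2 hne
  positivity

/-- No edge enters an angle in a face. -/
lemma IsFace.not_ccwAngle_lt (hΓ : IsPlanarDrawing G Γ) {F : Set ℂ} (hF : IsFace G Γ F)
    {v a b c : V} (h : IsAngleIn G Γ v a b F) (hc : G.Adj v c) :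
    ¬ ccwAngle (Γ a - Γ v) (Γ c - Γ v) < ccwAngle (Γ a - Γ v) (Γ b - Γ v) := by
  intro hlt
  obtain ⟨ha, hb, ε, hε, h⟩ := h
  obtain ⟨r, hr, hrc⟩ := ccwAngle_spec (hΓ.sub_ne_zero ha) (hΓ.sub_ne_zero hc)
  obtain ⟨s, hs0, hs1⟩ : ∃ s : ℝ, 0 < s ∧ s < min ε r := exists_between (by positivity)
  refine hF.subset_compl (h s ⟨hs0, hs1.trans_le (min_le_left _ _)⟩ _ ⟨ccwAngle_pos _ _, hlt⟩)
    (segment_subset_drawnSet hc ?_)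
  have hsr : s / r < 1 := (div_lt_one hr).2 (hs1.trans_le (min_le_right _ _))
  refine ⟨1 - s / r, s / r, by linarith, by positivity, by ring, ?_⟩
  have hr' : (r : ℂ) ≠ 0 := by exact_mod_cast hr.ne'
  rw [Complex.real_smul, Complex.real_smul]
  push_cast
  have h5 : (s : ℂ) * Complex.exp (ccwAngle (Γ a - Γ v) (Γ c - Γ v) * Complex.I) * (Γ a - Γ v) =
      s / r * (Γ c - Γ v) := by
    conv_rhs => rw [hrc]
    field_simp
  rw [h5]
  ring

/-- If no edge enters the sector between two edges at `v`, then it is an angle in a face. -/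
lemma exists_isAngleIn [Finite V] (hΓ : IsPlanarDrawing G Γ) {v a b : V} (ha : G.Adj v a)
    (hb : G.Adj v b) (h : ∀ c, G.Adj v c →
      ¬ ccwAngle (Γ a - Γ v) (Γ c - Γ v) < ccwAngle (Γ a - Γ v) (Γ b - Γ v)) :
    ∃ F, IsFace G Γ F ∧ IsAngleIn G Γ v a b F := by
  have hne := hΓ.sub_ne_zero ha
  have hpos := norm_pos_iff.2 hne
  -- `C` collects the drawing without `v` and its incident edges. It is closed and misses `Γ v`, so
  -- in a small ball around `Γ v` only the incident edges matter.
  set C : Set ℂ := Γ '' {v}ᶜ ∪ ⋃ e ∈ {e | e ∈ G.edgeSet ∧ v ∉ e}, edgeSegment Γ e with hC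
  have hCc : IsClosed C := (((Set.toFinite _).image Γ).isCompact.union
    ((Set.toFinite _).isCompact_biUnion fun e _ => isCompact_edgeSegment Γ e)).isClosed
  have hvC : Γ v ∈ Cᶜ := by
    rintro (⟨w, hw, hwv⟩ | hz')
    · exact hw (hΓ.injective hwv)
    · simp only [Set.mem_iUnion] at hz'
      obtain ⟨e, ⟨he, hne⟩, hz'⟩ := hz'
      induction e with
      | _ x y =>
        simp only [Sym2.mem_iff, not_or] at hne
        rcases mem_segment_cases hz' with hz | hz | hz
        · exact hne.1 (hΓ.injective hz)
        · exact hne.2 (hΓ.injective hz)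
        · exact hΓ.vertex_notMem _ _ _ he hz
  obtain ⟨ρ, hρ, hρC⟩ := Metric.isOpen_iff.1 hCc.isOpen_compl _ hvC
  set f : ℝ × ℝ → ℂ := fun p => Γ v + (p.1 : ℂ) * Complex.exp ((p.2 : ℂ) * Complex.I) * (Γ a - Γ v)
  set ω := ccwAngle (Γ a - Γ v) (Γ b - Γ v)
  have hω : 0 < ω := ccwAngle_pos _ _
  have hω2 : ω ≤ 2 * Real.pi := ccwAngle_le _ _
  set S := f '' (Set.Ioo 0 (ρ / ‖Γ a - Γ v‖) ×ˢ Set.Ioo 0 ω) with hS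
  have hSc : IsPreconnected S :=
    (isPreconnected_Ioo.prod isPreconnected_Ioo).image _
      (Continuous.continuousOn (by fun_prop))
  have hSd : S ⊆ (drawnSet G Γ)ᶜ := by
    rintro _ ⟨⟨r, θ⟩, ⟨⟨hr, hr'⟩, hθ, hθ'⟩, rfl⟩ hd
    simp only at hr hr' hθ hθ'
    have hnorm : ‖(r : ℂ) * Complex.exp ((θ : ℂ) * Complex.I) * (Γ a - Γ v)‖ =
        r * ‖Γ a - Γ v‖ := by
      rw [norm_mul, norm_mul, Complex.norm_exp_ofReal_mul_I, Complex.norm_of_nonneg hr.le, mul_one]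
    have hzC : f (r, θ) ∉ C := by
      apply hρC
      rw [Metric.mem_ball, dist_eq_norm, add_sub_cancel_left, hnorm]
      exact (lt_div_iff₀ hpos).1 hr'
    have hzv : f (r, θ) ≠ Γ v := by
      intro h0
      have : (r : ℂ) * Complex.exp ((θ : ℂ) * Complex.I) * (Γ a - Γ v) = 0 := by
        simpa [f] using h0
      rw [this, norm_zero] at hnorm
      have := mul_pos hr hpos
      linarith
    rcases mem_drawnSet_iff.1 hd with ⟨w, hw⟩ | ⟨x, y, hxy, hz⟩
    · by_cases hwv : w = v
      · rw [hwv] at hw; exact hzv hw.symm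
      · exact hzC (Or.inl ⟨w, hwv, hw⟩)
    · have key : ∀ c, G.Adj v c → f (r, θ) ∉ segment ℝ (Γ v) (Γ c) := by
        rintro c hc hz
        obtain ⟨k, l, hk, hl, hkl, hz⟩ := hz
        obtain rfl : k = 1 - l := by linarith
        have hl0 : l ≠ 0 := by
          rintro rfl
          apply hzv
          rw [← hz]; simp
        have hl' : (l : ℂ) ≠ 0 := by exact_mod_cast hl0
        have hlpos : 0 < l := lt_of_le_of_ne hl (Ne.symm hl0)
        have h6 : Γ c - Γ v = (r / l : ℝ) * Complex.exp ((θ : ℂ) * Complex.I) * (Γ a - Γ v) := by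
          rw [Complex.real_smul, Complex.real_smul] at hz
          simp only [f] at hz
          push_cast at hz ⊢
          field_simp
          linear_combination hz
        refine h c hc ?_
        rw [ccwAngle_eq hne (div_pos hr hlpos) hθ (by linarith) h6]
        exact hθ'
      by_cases hvx : v = x
      · subst hvx; exact key y hxy hz
      by_cases hvy : v = y
      · subst hvy; exact key x hxy.symm (segment_symm ℝ (Γ x) (Γ v) ▸ hz)
      exact hzC (Or.inr (Set.mem_biUnion
        (show s(x, y) ∈ {e | e ∈ G.edgeSet ∧ v ∉ e} from ⟨hxy, by simp [hvx, hvy]⟩) hz))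
  have hmem : ∀ r ∈ Set.Ioo 0 (ρ / ‖Γ a - Γ v‖), ∀ θ ∈ Set.Ioo 0 ω, f (r, θ) ∈ S :=
    fun r hr θ hθ => ⟨(r, θ), ⟨hr, hθ⟩, rfl⟩
  have h0 : 0 < ρ / ‖Γ a - Γ v‖ := div_pos hρ hpos
  have hz0 := hmem (ρ / ‖Γ a - Γ v‖ / 2) ⟨by linarith, by linarith⟩ (ω / 2)
    ⟨by linarith, by linarith⟩
  obtain ⟨F, hF, hzF⟩ := exists_isFace_mem (hSd hz0)
  have hSF := hF.subset_of_isPreconnected hSc hSd hz0 hzF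
  exact ⟨F, hF, ha, hb, _, h0, fun r hr θ hθ => hSF (hmem r hr θ hθ)⟩

/-- Equivalent drawings have the same angles in corresponding faces. -/
lemma Equivalent.exists_isAngleIn [Finite V] {Γ' : V → ℂ} (hΓ : IsPlanarDrawing G Γ)
    (hΓ' : IsPlanarDrawing G Γ') (h : Equivalent G Γ Γ') {F' : Set ℂ} (hF' : IsFace G Γ' F')
    {v a b : V} (hab : IsAngleIn G Γ' v a b F') :
    ∃ F, IsFace G Γ F ∧ IsAngleIn G Γ v a b F ∧
      (Bornology.IsBounded F ↔ Bornology.IsBounded F') := by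
  obtain ⟨F, hF, hFa⟩ := PlaneDrawing.exists_isAngleIn hΓ hab.1 hab.2.1 fun c hc hlt =>
    hF'.not_ccwAngle_lt hΓ' hab hc ((h.same_order v a c b hab.1 hc hab.2.1).1 hlt)
  refine ⟨F, hF, hFa, ?_⟩
  -- Both faces lie to the left of the directed edge `va`, and `same_outer` says that such faces are
  -- outer together.
  have hl := hF.isLeftOfEdge_of_isAngleIn hΓ hFa
  have hl' := hF'.isLeftOfEdge_of_isAngleIn hΓ' hab
  rw [← not_iff_not]
  constructor
  · intro hb
    obtain ⟨F₁, hF₁, h₁⟩ := (h.same_outer v a hab.1).1 ⟨F, ⟨hF, hb⟩, hl⟩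
    rw [hF'.eq_of_isLeftOfEdge hF₁.1 hl' h₁]
    exact hF₁.2
  · intro hb
    obtain ⟨F₁, hF₁, h₁⟩ := (h.same_outer v a hab.1).2 ⟨F', ⟨hF', hb⟩, hl'⟩
    rw [hF.eq_of_isLeftOfEdge hF₁.1 hl h₁]
    exact hF₁.2

end Edge

/-! ### The region between two monotone walks -/

section Region

variable {φ : ℂ ≃L[ℝ] ℝ × ℝ} {Γ : V → ℂ} {G : SimpleGraph V}

/-- The points strictly between two walks with common ends. -/
def walkRegion (φ : ℂ ≃L[ℝ] ℝ × ℝ) (Γ : V → ℂ) {s t : V} (p q : G.Walk s t) : Set ℂ :=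
  {z | (φ z).2 ∈ Set.Ioo (yOf φ Γ s) (yOf φ Γ t) ∧
    (φ z).1 ∈ Set.Ioo (walkX (xOf φ Γ) (yOf φ Γ) p (φ z).2) (walkX (xOf φ Γ) (yOf φ Γ) q (φ z).2)}

variable {s t : V} {p q : G.Walk s t}

/-- Points of the closure satisfy the weak inequalities. Equality with either graph gives a point of
a walk, and at the extreme heights the two graphs meet at an end-vertex; a set avoiding the walks
therefore cannot leave the region. The walks may cross elsewhere. -/
lemma subset_walkRegion_of_isPreconnected (hp : IncreasesAlong (yOf φ Γ) p)
    (hq : IncreasesAlong (yOf φ Γ) q) (hst : yOf φ Γ s < yOf φ Γ t) {S : Set ℂ}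
    (hS : IsPreconnected S) (hSp : ∀ z ∈ S, z ∉ drawnWalk Γ p) (hSq : ∀ z ∈ S, z ∉ drawnWalk Γ q)
    {z₀ : ℂ} (h0 : z₀ ∈ S) (h0' : z₀ ∈ walkRegion φ Γ p q) : S ⊆ walkRegion φ Γ p q := by
  have hcp := continuous_walkX (xOf φ Γ) hp
  have hcq := continuous_walkX (xOf φ Γ) hq
  have hopen : IsOpen (walkRegion φ Γ p q) := by
    refine (isOpen_Ioo.preimage (continuous_snd.comp φ.continuous)).inter
      ((isOpen_lt (f := fun z => walkX (xOf φ Γ) (yOf φ Γ) p (φ z).2) (g := fun z => (φ z).1)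
        (by fun_prop) (by fun_prop)).inter
      (isOpen_lt (f := fun z => (φ z).1) (g := fun z => walkX (xOf φ Γ) (yOf φ Γ) q (φ z).2)
        (by fun_prop) (by fun_prop)))
  have hclosed : IsClosed {z | (φ z).2 ∈ Set.Icc (yOf φ Γ s) (yOf φ Γ t) ∧
      walkX (xOf φ Γ) (yOf φ Γ) p (φ z).2 ≤ (φ z).1 ∧
      (φ z).1 ≤ walkX (xOf φ Γ) (yOf φ Γ) q (φ z).2} := by
    refine (isClosed_Icc.preimage (continuous_snd.comp φ.continuous)).inter
      ((isClosed_le (f := fun z => walkX (xOf φ Γ) (yOf φ Γ) p (φ z).2) (g := fun z => (φ z).1)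
        (by fun_prop) (by fun_prop)).inter
      (isClosed_le (f := fun z => (φ z).1) (g := fun z => walkX (xOf φ Γ) (yOf φ Γ) q (φ z).2)
        (by fun_prop) (by fun_prop)))
  refine hS.subset_of_closure_inter_subset hopen ⟨z₀, h0, h0'⟩ fun z ⟨hz, hzS⟩ => ?_
  obtain ⟨h1, h2, h3⟩ := hclosed.closure_subset_iff.2
    (show walkRegion φ Γ p q ⊆ _ from
      fun w hw => ⟨Set.Ioo_subset_Icc_self hw.1, hw.2.1.le, hw.2.2.le⟩) hz
  have hnp : (φ z).1 ≠ walkX (xOf φ Γ) (yOf φ Γ) p (φ z).2 := fun h =>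
    hSp z hzS ((mem_drawnWalk_iff hp hst z).2 ⟨h1, h⟩)
  have hnq : (φ z).1 ≠ walkX (xOf φ Γ) (yOf φ Γ) q (φ z).2 := fun h =>
    hSq z hzS ((mem_drawnWalk_iff hq hst z).2 ⟨h1, h⟩)
  refine ⟨⟨lt_of_le_of_ne h1.1 fun h => ?_, lt_of_le_of_ne h1.2 fun h => ?_⟩,
    lt_of_le_of_ne h2 (Ne.symm hnp), lt_of_le_of_ne h3 hnq⟩
  · rw [← h, walkX_start hp] at h2 hnp
    rw [← h, walkX_start hq] at h3
    exact hnp (le_antisymm h3 h2)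
  · rw [h, walkX_end _ hp] at h2 hnp
    rw [h, walkX_end _ hq] at h3
    exact hnp (le_antisymm h3 h2)

/-- Height and relative position between the two graphs parametrize the region. The continuous
parametrization yields boundedness, and also connectedness when the graphs stay in order. -/
lemma walkRegion_subset_image (φ : ℂ ≃L[ℝ] ℝ × ℝ) (Γ : V → ℂ) (p q : G.Walk s t) :
    walkRegion φ Γ p q ⊆ (fun a : ℝ × ℝ => φ.symm
      ((1 - a.2) * walkX (xOf φ Γ) (yOf φ Γ) p a.1 + a.2 * walkX (xOf φ Γ) (yOf φ Γ) q a.1, a.1)) ''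
        (Set.Ioo (yOf φ Γ s) (yOf φ Γ t) ×ˢ Set.Ioo 0 1) := by
  rintro z ⟨h1, h2, h3⟩
  set A := walkX (xOf φ Γ) (yOf φ Γ) p (φ z).2
  set B := walkX (xOf φ Γ) (yOf φ Γ) q (φ z).2
  have hAB : 0 < B - A := by linarith
  refine ⟨((φ z).2, ((φ z).1 - A) / (B - A)), ⟨h1, div_pos (by linarith) hAB, ?_⟩, ?_⟩
  · rw [div_lt_one hAB]; linarith
  · change φ.symm ((1 - ((φ z).1 - A) / (B - A)) * A + ((φ z).1 - A) / (B - A) * B, (φ z).2) = z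
    rw [ContinuousLinearEquiv.symm_apply_eq]
    ext
    · field_simp; ring
    · rfl

lemma isBounded_walkRegion (hp : IncreasesAlong (yOf φ Γ) p) (hq : IncreasesAlong (yOf φ Γ) q) :
    Bornology.IsBounded (walkRegion φ Γ p q) := by
  have hcp := continuous_walkX (xOf φ Γ) hp
  have hcq := continuous_walkX (xOf φ Γ) hq
  refine Bornology.IsBounded.subset ?_ ((walkRegion_subset_image φ Γ p q).trans
    (Set.image_mono (Set.prod_mono Set.Ioo_subset_Icc_self Set.Ioo_subset_Icc_self)))
  exact ((isCompact_Icc.prod isCompact_Icc).image (by fun_prop)).isBounded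

lemma isPreconnected_walkRegion (hp : IncreasesAlong (yOf φ Γ) p)
    (hq : IncreasesAlong (yOf φ Γ) q) (h : ∀ k ∈ Set.Ioo (yOf φ Γ s) (yOf φ Γ t),
      walkX (xOf φ Γ) (yOf φ Γ) p k < walkX (xOf φ Γ) (yOf φ Γ) q k) :
    IsPreconnected (walkRegion φ Γ p q) := by
  have hcp := continuous_walkX (xOf φ Γ) hp
  have hcq := continuous_walkX (xOf φ Γ) hq
  rw [(walkRegion_subset_image φ Γ p q).antisymm]
  · exact (isPreconnected_Ioo.prod isPreconnected_Ioo).image _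
      (Continuous.continuousOn (by fun_prop))
  · rintro _ ⟨⟨k, l⟩, ⟨hk, hl0, hl1⟩, rfl⟩
    have := h k hk
    simp only at hl0 hl1
    simp only [walkRegion, Set.mem_ofPred_eq, ContinuousLinearEquiv.apply_symm_apply]
    refine ⟨hk, ?_, ?_⟩ <;> nlinarith

end Region

/-! ### The low side of an edge -/

section Outer

variable {φ : ℂ ≃L[ℝ] ℝ × ℝ} {Γ Γ' : V → ℂ} {G : SimpleGraph V}

lemma map_midpoint_snd (P Q : ℂ) :
    (φ (midpoint ℝ P Q)).2 = ((φ P).2 + (φ Q).2) / 2 := by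
  rw [midpoint_eq_smul_add, map_smul, map_add]
  simp; ring

/-- Nothing is drawn on the low side of the edge, at the height of its midpoint. -/
def IsLowest (G : SimpleGraph V) (φ : ℂ ≃L[ℝ] ℝ × ℝ) (Γ : V → ℂ) (a b : V) : Prop :=
  ∀ z ∈ drawnSet G Γ, (φ z).2 = (yOf φ Γ a + yOf φ Γ b) / 2 →
    edgeX (xOf φ Γ) (yOf φ Γ) a b ((yOf φ Γ a + yOf φ Γ b) / 2) ≤ (φ z).1

lemma not_isBounded_ray (φ : ℂ ≃L[ℝ] ℝ × ℝ) (k m : ℝ) :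
    ¬ Bornology.IsBounded ((fun x : ℝ => φ.symm (x, m)) '' Set.Iio k) := by
  intro hb
  have h1 := (φ.lipschitz.isBounded_image hb)
  have h2 := (LipschitzWith.prod_fst (α := ℝ) (β := ℝ)).isBounded_image h1
  have h3 : Set.Iio k ⊆ Prod.fst '' (φ '' ((fun x : ℝ => φ.symm (x, m)) '' Set.Iio k)) := by
    intro x hx
    exact ⟨φ (φ.symm (x, m)), ⟨_, ⟨x, hx, rfl⟩, rfl⟩, by simp⟩
  obtain ⟨r, hr⟩ := (h2.subset h3).bddBelow
  have := hr (show min k r - 1 ∈ Set.Iio k by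
    simp only [Set.mem_Iio]; linarith [min_le_left k r])
  linarith [min_le_right k r]

lemma isPreconnected_ray (φ : ℂ ≃L[ℝ] ℝ × ℝ) (k m : ℝ) :
    IsPreconnected ((fun x : ℝ => φ.symm (x, m)) '' Set.Iio k) :=
  isPreconnected_Iio.image _ (Continuous.continuousOn (by fun_prop))

/-- The left side of the directed edge `cd` is the side with smaller abscissae of the edge `ab`,
which is the same edge directed upwards. -/
structure LeftIsLow (G : SimpleGraph V) (φ : ℂ ≃L[ℝ] ℝ × ℝ) (Γ : V → ℂ) (a b c d : V) : Prop where
  adj : G.Adj a b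
  lt : yOf φ Γ a < yOf φ Γ b
  eq : c = a ∧ d = b ∨ c = b ∧ d = a
  iff : ∀ z, 0 < cross (Γ d - Γ c) (z - Γ c) ↔
    (φ z).1 < edgeX (xOf φ Γ) (yOf φ Γ) a b (φ z).2

namespace LeftIsLow

variable {a b c d : V}

lemma adj' (h : LeftIsLow G φ Γ a b c d) : G.Adj c d := by
  rcases h.eq with ⟨rfl, rfl⟩ | ⟨rfl, rfl⟩
  exacts [h.adj, h.adj.symm]

lemma midpoint_eq (h : LeftIsLow G φ Γ a b c d) :
    midpoint ℝ (Γ c) (Γ d) = midpoint ℝ (Γ a) (Γ b) := by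
  rcases h.eq with ⟨rfl, rfl⟩ | ⟨rfl, rfl⟩
  exacts [rfl, midpoint_comm _ _]

lemma map_midpoint (h : LeftIsLow G φ Γ a b c d) :
    φ (midpoint ℝ (Γ c) (Γ d)) =
      (edgeX (xOf φ Γ) (yOf φ Γ) a b ((yOf φ Γ a + yOf φ Γ b) / 2),
        (yOf φ Γ a + yOf φ Γ b) / 2) := by
  rw [h.midpoint_eq]
  have h2 : (φ (midpoint ℝ (Γ a) (Γ b))).2 = (yOf φ Γ a + yOf φ Γ b) / 2 := map_midpoint_snd _ _
  have := (mem_openSegment_iff h.lt _).1 (midpoint_mem_openSegment (P := Γ a) (Q := Γ b))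
  ext
  · rw [this.2, h2]
  · exact h2

lemma exists_leftZone [Finite V] (hΓ : IsPlanarDrawing G Γ) (h : LeftIsLow G φ Γ a b c d) :
    ∃ δ > 0, leftZone Γ c d {midpoint ℝ (Γ c) (Γ d)} δ ⊆ (drawnSet G Γ)ᶜ :=
  exists_leftZone_subset hΓ h.adj' isCompact_singleton
    (Set.singleton_subset_iff.2 midpoint_mem_openSegment)

lemma tendsto (h : LeftIsLow G φ Γ a b c d) :
    Filter.Tendsto (fun η : ℝ => φ.symm
      (edgeX (xOf φ Γ) (yOf φ Γ) a b ((yOf φ Γ a + yOf φ Γ b) / 2) - η,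
        (yOf φ Γ a + yOf φ Γ b) / 2)) (𝓝 0) (𝓝 (midpoint ℝ (Γ c) (Γ d))) := by
  refine Continuous.tendsto' (by fun_prop) _ _ ?_
  rw [ContinuousLinearEquiv.symm_apply_eq, h.map_midpoint, sub_zero]

lemma eventually_mem (h : LeftIsLow G φ Γ a b c d) {δ : ℝ} (hδ : 0 < δ) :
    ∀ᶠ η : ℝ in 𝓝[>] 0, φ.symm
      (edgeX (xOf φ Γ) (yOf φ Γ) a b ((yOf φ Γ a + yOf φ Γ b) / 2) - η,
        (yOf φ Γ a + yOf φ Γ b) / 2) ∈ leftZone Γ c d {midpoint ℝ (Γ c) (Γ d)} δ := by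
  have h1 := h.tendsto.eventually (Metric.isOpen_thickening.mem_nhds
    (Metric.self_subset_thickening hδ _ (Set.mem_singleton (midpoint ℝ (Γ c) (Γ d)))))
  filter_upwards [h1.filter_mono nhdsWithin_le_nhds, self_mem_nhdsWithin] with η h2 h3
  refine ⟨h2, ?_⟩
  rw [Set.mem_ofPred_eq, h.iff]
  have : (0 : ℝ) < η := h3
  simpa using this

/-- The horizontal ray leaving the midpoint on the low side avoids the drawing, so it lies in a
single face, unbounded and adjacent to the edge. -/
lemma exists_isOuterFace [Finite V] (hΓ : IsPlanarDrawing G Γ) (h : LeftIsLow G φ Γ a b c d)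
    (hl : IsLowest G φ Γ a b) : ∃ F, IsOuterFace G Γ F ∧ IsLeftOfEdge Γ c d F := by
  set m := (yOf φ Γ a + yOf φ Γ b) / 2 with hm
  set k := edgeX (xOf φ Γ) (yOf φ Γ) a b m with hk
  have hS : (fun x : ℝ => φ.symm (x, m)) '' Set.Iio k ⊆ (drawnSet G Γ)ᶜ := by
    rintro _ ⟨x, hx, rfl⟩ hd
    have := hl _ hd (by simp [hm])
    simp only [ContinuousLinearEquiv.apply_symm_apply] at this
    exact absurd hx (not_lt.2 this)
  have hmem : ∀ η : ℝ, 0 < η → φ.symm (k - η, m) ∈ (fun x : ℝ => φ.symm (x, m)) '' Set.Iio k :=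
    fun η hη => ⟨k - η, by simpa using hη, rfl⟩
  obtain ⟨F, hF, hzF⟩ := exists_isFace_mem (hS (hmem 1 one_pos))
  have hSF := hF.subset_of_isPreconnected (isPreconnected_ray φ k m) hS (hmem 1 one_pos) hzF
  refine ⟨F, ⟨hF, fun hb => not_isBounded_ray φ k m (hb.subset hSF)⟩, ?_⟩
  obtain ⟨δ, hδ, hz⟩ := h.exists_leftZone hΓ
  obtain ⟨η, h1, h2⟩ := ((h.eventually_mem hδ).and self_mem_nhdsWithin).exists
  exact hF.isLeftOfEdge (hΓ.sub_ne_zero h.adj') hδ (convex_singleton _) (Set.mem_singleton _) hz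
    (hSF (hmem η h2)) h1

end LeftIsLow

/-- A vertex (if `u = v`) or an edge directed upwards. -/
def IsItem (G : SimpleGraph V) (y : V → ℝ) (u v : V) : Prop := u = v ∨ G.Adj u v ∧ y u < y v

/-- Two drawings with the same heights and the same horizontal order of the vertices and edges at
each height. -/
structure SameOrder (G : SimpleGraph V) (φ : ℂ ≃L[ℝ] ℝ × ℝ) (Γ Γ' : V → ℂ) : Prop where
  y_eq : yOf φ Γ' = yOf φ Γ
  lt_iff : ∀ u v u' v', IsItem G (yOf φ Γ) u v → IsItem G (yOf φ Γ) u' v' → ∀ h,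
    h ∈ Set.Icc (yOf φ Γ u) (yOf φ Γ v) → h ∈ Set.Icc (yOf φ Γ u') (yOf φ Γ v') →
    (edgeX (xOf φ Γ) (yOf φ Γ) u v h < edgeX (xOf φ Γ) (yOf φ Γ) u' v' h ↔
      edgeX (xOf φ Γ') (yOf φ Γ) u v h < edgeX (xOf φ Γ') (yOf φ Γ) u' v' h)

lemma SameOrder.refl : SameOrder G φ Γ Γ := ⟨rfl, fun _ _ _ _ _ _ _ _ _ => Iff.rfl⟩

lemma mem_drawnSet_iff_item (hy : ∀ u v, G.Adj u v → yOf φ Γ u ≠ yOf φ Γ v) {z : ℂ} :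
    z ∈ drawnSet G Γ ↔ ∃ u v, IsItem G (yOf φ Γ) u v ∧
      (φ z).2 ∈ Set.Icc (yOf φ Γ u) (yOf φ Γ v) ∧
      (φ z).1 = edgeX (xOf φ Γ) (yOf φ Γ) u v (φ z).2 := by
  rw [mem_drawnSet_iff]
  constructor
  · rintro (⟨v, rfl⟩ | ⟨u, v, huv, hz⟩)
    · exact ⟨v, v, Or.inl rfl, ⟨le_rfl, le_rfl⟩, (edgeX_self _ _ _ _).symm⟩
    · rcases lt_or_gt_of_ne (hy u v huv) with h | h
      · exact ⟨u, v, Or.inr ⟨huv, h⟩, (mem_segment_iff h z).1 hz⟩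
      · rw [segment_symm] at hz
        exact ⟨v, u, Or.inr ⟨huv.symm, h⟩, (mem_segment_iff h z).1 hz⟩
  · rintro ⟨u, v, rfl | ⟨huv, h⟩, h1, h2⟩
    · left
      refine ⟨u, φ.injective (Prod.ext ?_ (le_antisymm h1.1 h1.2))⟩
      rw [h2, edgeX_self]; rfl
    · exact Or.inr ⟨u, v, huv, (mem_segment_iff h z).2 ⟨h1, h2⟩⟩

/-- A vertex or edge beyond `ab` at this height in one drawing is beyond it in the other. -/
lemma SameOrder.isLowest (hy : ∀ u v, G.Adj u v → yOf φ Γ u ≠ yOf φ Γ v)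
    (h : SameOrder G φ Γ Γ') {a b : V} (hab : G.Adj a b) (hlt : yOf φ Γ a < yOf φ Γ b)
    (hl : IsLowest G φ Γ a b) : IsLowest G φ Γ' a b := by
  intro z hz hzm
  rw [mem_drawnSet_iff_item (by rwa [h.y_eq])] at hz
  obtain ⟨u, v, hi, h1, h2⟩ := hz
  rw [h.y_eq] at *
  rw [h2, hzm]
  rw [hzm] at h1
  by_contra! hcon
  have hm : (yOf φ Γ a + yOf φ Γ b) / 2 ∈ Set.Icc (yOf φ Γ a) (yOf φ Γ b) :=
    ⟨by linarith, by linarith⟩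
  rw [← h.lt_iff u v a b hi (Or.inr ⟨hab, hlt⟩) _ h1 hm] at hcon
  have := hl (φ.symm (edgeX (xOf φ Γ) (yOf φ Γ) u v ((yOf φ Γ a + yOf φ Γ b) / 2),
    (yOf φ Γ a + yOf φ Γ b) / 2)) ((mem_drawnSet_iff_item hy).2 ⟨u, v, hi, by simpa using h1,
      by simp⟩) (by simp)
  simp only [ContinuousLinearEquiv.apply_symm_apply] at this
  linarith

/-- The boundary of the face is composed of two walks directed upwards. -/
def IsUpwardFace (G : SimpleGraph V) (φ : ℂ ≃L[ℝ] ℝ × ℝ) (Γ : V → ℂ) (F : Set ℂ) : Prop :=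
  ∃ (s t : V) (p q : G.Walk s t), yOf φ Γ s < yOf φ Γ t ∧ IncreasesAlong (yOf φ Γ) p ∧
    IncreasesAlong (yOf φ Γ) q ∧ frontier F = drawnWalk Γ p ∪ drawnWalk Γ q

lemma drawnWalk_subset {s t : V} (p : G.Walk s t) : drawnWalk Γ p ⊆ drawnSet G Γ := by
  intro z hz
  simp only [drawnWalk, Set.mem_iUnion] at hz
  obtain ⟨e, he, hz⟩ := hz
  exact Or.inr (Set.mem_biUnion (p.edges_subset_edgeSet he) hz)

/-- At the height of the midpoint, `p` is strictly on the low side of `q`, which runs through the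
edge. The order carries this over to `Γ'`, so points of `Γ'` just beside the edge lie between the
two graphs. Faces do not meet the walks, so a face there stays in a bounded region. -/
lemma not_isLeftOfEdge_of_walks [Finite V] (hΓ : IsPlanarDrawing G Γ) (hΓ' : IsPlanarDrawing G Γ')
    {a b c d : V} (h : LeftIsLow G φ Γ a b c d) (h' : LeftIsLow G φ Γ' a b c d)
    (ho : SameOrder G φ Γ Γ') {s t : V} {p q : G.Walk s t} (hst : yOf φ Γ s < yOf φ Γ t)
    (hp : IncreasesAlong (yOf φ Γ) p) (hq : IncreasesAlong (yOf φ Γ) q) {f : ℂ}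
    (hfp : f ∈ drawnWalk Γ p) (hf2 : (φ f).2 = (yOf φ Γ a + yOf φ Γ b) / 2)
    (hf1 : (φ f).1 < edgeX (xOf φ Γ) (yOf φ Γ) a b ((yOf φ Γ a + yOf φ Γ b) / 2))
    (hmq : midpoint ℝ (Γ c) (Γ d) ∈ drawnWalk Γ q) {F : Set ℂ} (hF : IsOuterFace G Γ' F) :
    ¬ IsLeftOfEdge Γ' c d F := by
  intro hleft
  have hm := h.map_midpoint
  obtain ⟨δ, hδ, hz⟩ := h'.exists_leftZone hΓ'
  have hev := h'.eventually_mem hδ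
  rw [ho.y_eq] at hev
  set m := (yOf φ Γ a + yOf φ Γ b) / 2 with hmdef
  have hlt := h.lt
  rw [mem_drawnWalk_iff hp hst, hf2] at hfp
  obtain ⟨hmst, hfp⟩ := hfp
  obtain ⟨g, hg, hg1, hg2⟩ := exists_dart_of_height hp hst hmst.1 hmst.2
  obtain ⟨e, he, he1, he2⟩ := exists_dart_of_height hq hst hmst.1 hmst.2
  have hmid := (mem_drawnWalk_iff hq hst _).1 hmq
  rw [hm] at hmid
  have hmid2 : edgeX (xOf φ Γ) (yOf φ Γ) a b m = walkX (xOf φ Γ) (yOf φ Γ) q m := hmid.2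
  have heab : e.fst = a ∧ e.snd = b := by
    have h1 : midpoint ℝ (Γ c) (Γ d) ∈ segment ℝ (Γ e.fst) (Γ e.snd) := by
      rw [mem_segment_iff (hq e he), hm]
      refine ⟨⟨he1, he2⟩, ?_⟩
      rw [← walkX_of_dart (xOf φ Γ) hq he he1 he2]
      exact hmid2
    have h2 := hΓ.eq_of_mem h.adj e.adj (h.midpoint_eq ▸ midpoint_mem_openSegment) h1
    rw [Sym2.eq_iff] at h2
    rcases h2 with h2 | ⟨h2, h3⟩
    · exact h2
    · have := hq e he
      rw [h2, h3] at this
      linarith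
  obtain ⟨rfl, rfl⟩ := heab
  have hgt : edgeX (xOf φ Γ) (yOf φ Γ) g.fst g.snd m < edgeX (xOf φ Γ) (yOf φ Γ) e.fst e.snd m := by
    rw [← walkX_of_dart (xOf φ Γ) hp hg hg1 hg2, ← hfp]
    exact hf1
  rw [ho.lt_iff _ _ _ _ (Or.inr ⟨g.adj, hp g hg⟩) (Or.inr ⟨e.adj, hq e he⟩) m ⟨hg1, hg2⟩
    ⟨he1, he2⟩] at hgt
  have hp' : IncreasesAlong (yOf φ Γ') p := by rwa [ho.y_eq]
  have hq' : IncreasesAlong (yOf φ Γ') q := by rwa [ho.y_eq]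
  have hs := (hq.le_of_mem_support (q.dart_fst_mem_support_of_mem_darts he)).1
  have ht := (hq.le_of_mem_support (q.dart_snd_mem_support_of_mem_darts he)).2
  have h3 : ∀ᶠ η : ℝ in 𝓝[>] 0, η ∈ Set.Ioo 0 (edgeX (xOf φ Γ') (yOf φ Γ) e.fst e.snd m -
      edgeX (xOf φ Γ') (yOf φ Γ) g.fst g.snd m) := Ioo_mem_nhdsGT (by linarith)
  obtain ⟨η, h1, h2, h3⟩ := (hev.and h3).exists
  have hzF : leftZone Γ' c d {midpoint ℝ (Γ' c) (Γ' d)} δ ⊆ F := by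
    obtain ⟨ε, h4, h5⟩ := ((eventually_mem_leftZone (hΓ'.sub_ne_zero h'.adj') hδ
      (Set.mem_singleton _)).and hleft).exists
    exact hF.1.subset_of_isPreconnected
      (convex_leftZone Γ' c d (convex_singleton _) δ).isPreconnected hz h4 h5
  refine hF.2 ((isBounded_walkRegion hp' hq').subset
    (subset_walkRegion_of_isPreconnected hp' hq' (by rwa [ho.y_eq]) hF.1.isPreconnected
      (fun z hz hzp => hF.1.subset_compl hz (drawnWalk_subset p hzp))
      (fun z hz hzp => hF.1.subset_compl hz (drawnWalk_subset q hzp)) (hzF h1) ?_))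
  simp only [walkRegion, Set.mem_ofPred_eq, ContinuousLinearEquiv.apply_symm_apply, ho.y_eq]
  rw [walkX_of_dart _ hp hg hg1 hg2, walkX_of_dart _ hq he he1 he2]
  refine ⟨⟨by linarith, by linarith⟩, by linarith, by linarith⟩

/-- Moving horizontally from the face beside the edge towards a drawn point further out, one meets
the frontier of the face. This frontier point and the midpoint have the same height but different
abscissae, so they lie on different boundary walks. -/
lemma not_isLeftOfEdge_of_not_isLowest [Finite V] (hΓ : IsPlanarDrawing G Γ)
    (hΓ' : IsPlanarDrawing G Γ') (hup : ∀ F, IsFace G Γ F → IsUpwardFace G φ Γ F)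
    {a b c d : V} (h : LeftIsLow G φ Γ a b c d) (h' : LeftIsLow G φ Γ' a b c d)
    (ho : SameOrder G φ Γ Γ') (hl : ¬ IsLowest G φ Γ a b) {F' : Set ℂ}
    (hF' : IsOuterFace G Γ' F') : ¬ IsLeftOfEdge Γ' c d F' := by
  unfold IsLowest at hl
  push Not at hl
  obtain ⟨z', hz'd, hz'2, hz'1⟩ := hl
  obtain ⟨δ, hδ, hz⟩ := h.exists_leftZone hΓ
  have hev := h.eventually_mem hδ
  have htend := h.tendsto
  have hm := h.map_midpoint
  set m := (yOf φ Γ a + yOf φ Γ b) / 2 with hmdef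
  set k := edgeX (xOf φ Γ) (yOf φ Γ) a b m with hk
  have h3 : ∀ᶠ η : ℝ in 𝓝[>] 0, η ∈ Set.Ioo 0 (k - (φ z').1) := Ioo_mem_nhdsGT (by linarith)
  obtain ⟨η, h1, h2, h3⟩ := (hev.and h3).exists
  obtain ⟨F, hF, hzF⟩ := exists_isFace_mem (hz h1)
  have hzone := hF.subset_of_isPreconnected
    (convex_leftZone Γ c d (convex_singleton _) δ).isPreconnected hz h1 hzF
  have hmidd : midpoint ℝ (Γ c) (Γ d) ∈ drawnSet G Γ :=
    segment_subset_drawnSet h.adj' (openSegment_subset_segment _ _ _ midpoint_mem_openSegment)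
  have hmidF : midpoint ℝ (Γ c) (Γ d) ∈ frontier F :=
    hF.mem_frontier hmidd (mem_closure_of_tendsto (htend.mono_left nhdsWithin_le_nhds)
      (hev.mono fun _ hx => hzone hx))
  obtain ⟨f, hfF, hfs, hfz⟩ := exists_mem_segment_frontier hF.isOpen hzF
    (fun hz'F => hF.subset_compl hz'F hz'd)
  have hf : (φ f).2 = m ∧ (φ f).1 < k := by
    obtain ⟨α, β, hα, hβ, hαβ, rfl⟩ := hfs
    simp only [map_add, map_smul, ContinuousLinearEquiv.apply_symm_apply, Prod.snd_add,
      Prod.smul_snd, Prod.fst_add, Prod.smul_fst, smul_eq_mul, hz'2]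
    obtain rfl : α = 1 - β := by linarith
    constructor
    · ring
    · nlinarith
  obtain ⟨s, t, p, q, hst, hp, hq, hfr⟩ := hup F hF
  rw [hfr] at hfF hmidF
  have hne : ∀ r : G.Walk s t, IncreasesAlong (yOf φ Γ) r → f ∈ drawnWalk Γ r →
      midpoint ℝ (Γ c) (Γ d) ∈ drawnWalk Γ r → False := by
    intro r hr h4 h5
    rw [mem_drawnWalk_iff hr hst] at h4 h5
    rw [hm] at h5
    rw [hf.1] at h4
    have h6 : k = walkX (xOf φ Γ) (yOf φ Γ) r m := h5.2
    linarith [hf.2, h4.2]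
  rcases hfF with hfp | hfq
  · exact not_isLeftOfEdge_of_walks hΓ hΓ' h h' ho hst hp hq hfp hf.1 hf.2
      (hmidF.resolve_left (hne p hp hfp)) hF'
  · exact not_isLeftOfEdge_of_walks hΓ hΓ' h h' ho hst hq hp hfq hf.1 hf.2
      (hmidF.resolve_right (hne q hq hfq)) hF'

/-- The dichotomy is read off in `Γ` and transferred. Only the faces of `Γ` need monotone
boundaries; this avoids circularity, since `Γ'` need not be known to belong to the embedding. -/
lemma exists_isOuterFace_iff [Finite V] (hΓ : IsPlanarDrawing G Γ)
    (hΓ' : IsPlanarDrawing G Γ') (hy : ∀ u v, G.Adj u v → yOf φ Γ u ≠ yOf φ Γ v)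
    (hup : ∀ F, IsFace G Γ F → IsUpwardFace G φ Γ F)
    {a b c d : V} (h : LeftIsLow G φ Γ a b c d) (h' : LeftIsLow G φ Γ' a b c d)
    (ho : SameOrder G φ Γ Γ') :
    (∃ F, IsOuterFace G Γ F ∧ IsLeftOfEdge Γ c d F) ↔
      ∃ F, IsOuterFace G Γ' F ∧ IsLeftOfEdge Γ' c d F := by
  by_cases hl : IsLowest G φ Γ a b
  · exact iff_of_true (h.exists_isOuterFace hΓ hl)
      (h'.exists_isOuterFace hΓ' (ho.isLowest hy h.adj h.lt hl))
  · exact iff_of_false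
      (fun ⟨F, hF, hF'⟩ => not_isLeftOfEdge_of_not_isLowest hΓ hΓ hup h h .refl hl hF hF')
      (fun ⟨F, hF, hF'⟩ => not_isLeftOfEdge_of_not_isLowest hΓ hΓ' hup h h' ho hl hF hF')

end Outer

/-! ### The horizontal order in level drawings -/

section Order

variable {φ : ℂ ≃L[ℝ] ℝ × ℝ} {Γ Γ' : V → ℂ} {G : SimpleGraph V}

/-- A reversal of the order would force a crossing strictly between `h` and `k`, interior to both
edges. The inequality is weak because the edges may share an end at height `k`. -/
lemma edgeX_lt_of_lt (hΓ : IsPlanarDrawing G Γ) {u v u' v' : V} (huv : G.Adj u v)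
    (hlt : yOf φ Γ u < yOf φ Γ v) (huv' : G.Adj u' v') (hlt' : yOf φ Γ u' < yOf φ Γ v') {h k : ℝ}
    (hh : h ∈ Set.Ioo (yOf φ Γ u) (yOf φ Γ v)) (hh' : h ∈ Set.Ioo (yOf φ Γ u') (yOf φ Γ v'))
    (hk : k ∈ Set.Icc (yOf φ Γ u) (yOf φ Γ v)) (hk' : k ∈ Set.Icc (yOf φ Γ u') (yOf φ Γ v'))
    (hx : edgeX (xOf φ Γ) (yOf φ Γ) u v h < edgeX (xOf φ Γ) (yOf φ Γ) u' v' h) :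
    edgeX (xOf φ Γ) (yOf φ Γ) u v k ≤ edgeX (xOf φ Γ) (yOf φ Γ) u' v' k := by
  by_contra! hcon
  obtain ⟨l, hl, hl'⟩ : ∃ l ∈ Set.uIcc h k,
      edgeX (xOf φ Γ) (yOf φ Γ) u v l - edgeX (xOf φ Γ) (yOf φ Γ) u' v' l = 0 := by
    have hc := ((continuous_edgeX (xOf φ Γ) (yOf φ Γ) u v).sub
      (continuous_edgeX (xOf φ Γ) (yOf φ Γ) u' v')).continuousOn (s := Set.uIcc h k)
    exact intermediate_value_uIcc hc (Set.mem_uIcc.2 (Or.inl ⟨(sub_neg.2 hx).le, (sub_pos.2 hcon).le⟩))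
  have hlk : l ≠ k := by rintro rfl; linarith
  have hbet : ∀ α β : ℝ, h ∈ Set.Ioo α β → k ∈ Set.Icc α β → l ∈ Set.Ioo α β := by
    rintro α β ⟨h1, h2⟩ ⟨h3, h4⟩
    rcases Set.mem_uIcc.1 hl with ⟨h5, h6⟩ | ⟨h5, h6⟩
    · exact ⟨h1.trans_le h5, (lt_of_le_of_ne h6 hlk).trans_le h4⟩
    · exact ⟨h3.trans_lt (lt_of_le_of_ne h5 (Ne.symm hlk)), h6.trans_lt h2⟩
  set z := φ.symm (edgeX (xOf φ Γ) (yOf φ Γ) u v l, l) with hz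
  have h1 : z ∈ openSegment ℝ (Γ u) (Γ v) := by
    rw [mem_openSegment_iff hlt, hz, ContinuousLinearEquiv.apply_symm_apply]
    exact ⟨hbet _ _ hh hk, rfl⟩
  have h2 : z ∈ openSegment ℝ (Γ u') (Γ v') := by
    rw [mem_openSegment_iff hlt', hz, ContinuousLinearEquiv.apply_symm_apply]
    exact ⟨hbet _ _ hh' hk', sub_eq_zero.1 hl'⟩
  have h3 := hΓ.eq_of_mem huv huv' h1 (openSegment_subset_segment _ _ _ h2)
  rw [Sym2.eq_iff] at h3
  rcases h3 with ⟨rfl, rfl⟩ | ⟨rfl, rfl⟩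
  · exact lt_irrefl _ hx
  · linarith

/-- The order at the heights of the vertices determines the order at all heights. -/
lemma edgeX_lt_of_order (hΓ : IsPlanarDrawing G Γ)
    (ho : ∀ u v u' v', IsItem G (yOf φ Γ) u v → IsItem G (yOf φ Γ) u' v' → ∀ w,
      yOf φ Γ w ∈ Set.Icc (yOf φ Γ u) (yOf φ Γ v) → yOf φ Γ w ∈ Set.Icc (yOf φ Γ u') (yOf φ Γ v') →
      (edgeX (xOf φ Γ) (yOf φ Γ) u v (yOf φ Γ w) < edgeX (xOf φ Γ) (yOf φ Γ) u' v' (yOf φ Γ w) ↔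
        edgeX (xOf φ Γ') (yOf φ Γ) u v (yOf φ Γ w) < edgeX (xOf φ Γ') (yOf φ Γ) u' v' (yOf φ Γ w)))
    {u v u' v' : V} (hi : IsItem G (yOf φ Γ) u v) (hi' : IsItem G (yOf φ Γ) u' v') {h : ℝ}
    (hh : h ∈ Set.Icc (yOf φ Γ u) (yOf φ Γ v)) (hh' : h ∈ Set.Icc (yOf φ Γ u') (yOf φ Γ v'))
    (hx : edgeX (xOf φ Γ) (yOf φ Γ) u v h < edgeX (xOf φ Γ) (yOf φ Γ) u' v' h) :
    edgeX (xOf φ Γ') (yOf φ Γ) u v h < edgeX (xOf φ Γ') (yOf φ Γ) u' v' h := by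
  by_cases hw : ∃ w, h = yOf φ Γ w
  · obtain ⟨w, rfl⟩ := hw
    exact (ho u v u' v' hi hi' w hh hh').1 hx
  push Not at hw
  have hh1 : h ∈ Set.Ioo (yOf φ Γ u) (yOf φ Γ v) :=
    ⟨lt_of_le_of_ne hh.1 (hw u).symm, lt_of_le_of_ne hh.2 (hw v)⟩
  have hh1' : h ∈ Set.Ioo (yOf φ Γ u') (yOf φ Γ v') :=
    ⟨lt_of_le_of_ne hh'.1 (hw u').symm, lt_of_le_of_ne hh'.2 (hw v')⟩
  have hlt := hh1.1.trans hh1.2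
  have hlt' := hh1'.1.trans hh1'.2
  have huv : G.Adj u v := by
    rcases hi with rfl | hi
    · exact absurd hlt (lt_irrefl _)
    · exact hi.1
  have huv' : G.Adj u' v' := by
    rcases hi' with rfl | hi
    · exact absurd hlt' (lt_irrefl _)
    · exact hi.1
  -- `l` is the higher of the two lower ends and `r` below is the lower of the two upper ends:
  -- vertex heights around `h` that both edges span.
  obtain ⟨l, hlo, hl1, hl2⟩ : ∃ w, yOf φ Γ w < h ∧ yOf φ Γ u ≤ yOf φ Γ w ∧
      yOf φ Γ u' ≤ yOf φ Γ w := by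
    rcases le_total (yOf φ Γ u) (yOf φ Γ u') with h1 | h1
    · exact ⟨u', hh1'.1, h1, le_rfl⟩
    · exact ⟨u, hh1.1, le_rfl, h1⟩
  obtain ⟨r, hro, hr1, hr2⟩ : ∃ w, h < yOf φ Γ w ∧ yOf φ Γ w ≤ yOf φ Γ v ∧
      yOf φ Γ w ≤ yOf φ Γ v' := by
    rcases le_total (yOf φ Γ v) (yOf φ Γ v') with h1 | h1
    · exact ⟨v, hh1.2, le_rfl, h1⟩
    · exact ⟨v', hh1'.2, h1, le_rfl⟩
  have hlu : yOf φ Γ l ∈ Set.Icc (yOf φ Γ u) (yOf φ Γ v) := ⟨hl1, by linarith [hh.2]⟩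
  have hlu' : yOf φ Γ l ∈ Set.Icc (yOf φ Γ u') (yOf φ Γ v') := ⟨hl2, by linarith [hh'.2]⟩
  have hru : yOf φ Γ r ∈ Set.Icc (yOf φ Γ u) (yOf φ Γ v) := ⟨by linarith [hh.1], hr1⟩
  have hru' : yOf φ Γ r ∈ Set.Icc (yOf φ Γ u') (yOf φ Γ v') := ⟨by linarith [hh'.1], hr2⟩
  have a1 := edgeX_lt_of_lt hΓ huv hlt huv' hlt' hh1 hh1' hlu hlu' hx
  have a2 := edgeX_lt_of_lt hΓ huv hlt huv' hlt' hh1 hh1' hru hru' hx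
  have b1 := ho u v u' v' hi hi' l hlu hlu'
  have b1' := ho u' v' u v hi' hi l hlu' hlu
  have b2 := ho u v u' v' hi hi' r hru hru'
  have b2' := ho u' v' u v hi' hi r hru' hru
  have c1 := not_lt.1 (mt b1'.2 (not_lt.2 a1))
  have c2 := not_lt.1 (mt b2'.2 (not_lt.2 a2))
  obtain ⟨σ, -, h1⟩ := exists_edgeX_eq (xOf φ Γ) (yOf φ Γ) hlt
  obtain ⟨σ', -, h1'⟩ := exists_edgeX_eq (xOf φ Γ) (yOf φ Γ) hlt'
  obtain ⟨τ, -, h2⟩ := exists_edgeX_eq (xOf φ Γ') (yOf φ Γ) hlt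
  obtain ⟨τ', -, h2'⟩ := exists_edgeX_eq (xOf φ Γ') (yOf φ Γ) hlt'
  rw [h1, h1'] at hx a1 b1 a2 b2
  rw [h2, h2'] at b1 b2 c1 c2
  rw [h2, h2']
  -- the differences of the two edges at `l`, `r` and `h` are affinely related
  have hstrict : xOf φ Γ u + σ * (yOf φ Γ l - yOf φ Γ u) <
        xOf φ Γ u' + σ' * (yOf φ Γ l - yOf φ Γ u') ∨
      xOf φ Γ u + σ * (yOf φ Γ r - yOf φ Γ u) < xOf φ Γ u' + σ' * (yOf φ Γ r - yOf φ Γ u') := by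
    by_contra! hcon
    have e1 := le_antisymm a1 hcon.1
    have e2 := le_antisymm a2 hcon.2
    have : (xOf φ Γ u + σ * (h - yOf φ Γ u) - (xOf φ Γ u' + σ' * (h - yOf φ Γ u'))) *
        (yOf φ Γ r - yOf φ Γ l) = 0 := by
      linear_combination (yOf φ Γ r - h) * e1 + (h - yOf φ Γ l) * e2
    rcases mul_eq_zero.1 this with h3 | h3 <;> linarith
  have key : (xOf φ Γ' u' + τ' * (h - yOf φ Γ u') - (xOf φ Γ' u + τ * (h - yOf φ Γ u))) *
      (yOf φ Γ r - yOf φ Γ l) =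
      (xOf φ Γ' u' + τ' * (yOf φ Γ l - yOf φ Γ u') - (xOf φ Γ' u + τ * (yOf φ Γ l - yOf φ Γ u))) *
        (yOf φ Γ r - h) +
      (xOf φ Γ' u' + τ' * (yOf φ Γ r - yOf φ Γ u') - (xOf φ Γ' u + τ * (yOf φ Γ r - yOf φ Γ u))) *
        (h - yOf φ Γ l) := by ring
  have hpos : 0 < (xOf φ Γ' u' + τ' * (h - yOf φ Γ u') - (xOf φ Γ' u + τ * (h - yOf φ Γ u))) *
      (yOf φ Γ r - yOf φ Γ l) := by
    rw [key]
    rcases hstrict with h3 | h3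
    · exact add_pos_of_pos_of_nonneg (mul_pos (sub_pos.2 (b1.1 h3)) (sub_pos.2 hro))
        (mul_nonneg (sub_nonneg.2 c2) (sub_pos.2 hlo).le)
    · exact add_pos_of_nonneg_of_pos (mul_nonneg (sub_nonneg.2 c1) (sub_pos.2 hro).le)
        (mul_pos (sub_pos.2 (b2.1 h3)) (sub_pos.2 hlo))
  have := pos_of_mul_pos_left hpos (by linarith)
  linarith

/-- Drawings with the same heights and the same order at the heights of the vertices have the same
order at all heights. -/
lemma SameOrder.of_order (hΓ : IsPlanarDrawing G Γ) (hΓ' : IsPlanarDrawing G Γ')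
    (hy : yOf φ Γ' = yOf φ Γ)
    (ho : ∀ u v u' v', IsItem G (yOf φ Γ) u v → IsItem G (yOf φ Γ) u' v' → ∀ w,
      yOf φ Γ w ∈ Set.Icc (yOf φ Γ u) (yOf φ Γ v) → yOf φ Γ w ∈ Set.Icc (yOf φ Γ u') (yOf φ Γ v') →
      (edgeX (xOf φ Γ) (yOf φ Γ) u v (yOf φ Γ w) < edgeX (xOf φ Γ) (yOf φ Γ) u' v' (yOf φ Γ w) ↔
        edgeX (xOf φ Γ') (yOf φ Γ) u v (yOf φ Γ w) <
          edgeX (xOf φ Γ') (yOf φ Γ) u' v' (yOf φ Γ w))) :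
    SameOrder G φ Γ Γ' := by
  refine ⟨hy, fun u v u' v' hi hi' h hh hh' => ⟨edgeX_lt_of_order hΓ ho hi hi' hh hh', ?_⟩⟩
  rw [← hy] at *
  exact edgeX_lt_of_order hΓ' (fun u v u' v' hi hi' w hw hw' => (ho u v u' v' hi hi' w hw hw').symm)
    hi hi' hh hh'

/-- The order is kept by averaging two drawings with the same order. -/
lemma SameOrder.combo {Γt : V → ℂ} (ho : SameOrder G φ Γ Γ') {t : ℝ} (ht : t ∈ Set.Icc (0 : ℝ) 1)
    (hx : ∀ v, xOf φ Γt v = (1 - t) * xOf φ Γ v + t * xOf φ Γ' v) (hy : yOf φ Γt = yOf φ Γ) :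
    SameOrder G φ Γ Γt := by
  refine ⟨hy, fun u v u' v' hi hi' h hh hh' => ?_⟩
  rw [edgeX_combo hx, edgeX_combo hx]
  have h1 := ho.lt_iff u v u' v' hi hi' h hh hh'
  obtain ⟨ht0, ht1⟩ := ht
  constructor
  · intro h2
    have h3 := h1.1 h2
    rcases ht0.eq_or_lt with rfl | ht0
    · simpa using h2
    · have := mul_pos ht0 (sub_pos.2 h3)
      have := mul_nonneg (sub_nonneg.2 ht1) (sub_pos.2 h2).le
      linarith
  · intro h2
    by_contra h3
    have h4 := not_lt.1 (mt h1.2 h3)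
    have h5 := not_lt.1 h3
    nlinarith

/-- Equality is the failure of both strict inequalities, so incidences are preserved together with
the order. -/
lemma SameOrder.eq_iff (ho : SameOrder G φ Γ Γ') {u v u' v' : V} (hi : IsItem G (yOf φ Γ) u v)
    (hi' : IsItem G (yOf φ Γ) u' v') {h : ℝ} (hh : h ∈ Set.Icc (yOf φ Γ u) (yOf φ Γ v))
    (hh' : h ∈ Set.Icc (yOf φ Γ u') (yOf φ Γ v')) :
    edgeX (xOf φ Γ) (yOf φ Γ) u v h = edgeX (xOf φ Γ) (yOf φ Γ) u' v' h ↔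
      edgeX (xOf φ Γ') (yOf φ Γ) u v h = edgeX (xOf φ Γ') (yOf φ Γ) u' v' h := by
  have h1 := ho.lt_iff u v u' v' hi hi' h hh hh'
  have h2 := ho.lt_iff u' v' u v hi' hi h hh' hh
  rw [eq_iff_le_not_lt, eq_iff_le_not_lt, ← not_lt, ← not_lt, h1, h2]

/-- Planarity depends only on the order. -/
lemma SameOrder.isPlanarDrawing (ho : SameOrder G φ Γ Γ')
    (hy : ∀ u v, G.Adj u v → yOf φ Γ u ≠ yOf φ Γ v) (hΓ : IsPlanarDrawing G Γ) :
    IsPlanarDrawing G Γ' := by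
  have hyv : ∀ v, (φ (Γ' v)).2 = yOf φ Γ v := fun v => congrFun ho.y_eq v
  have hvert : ∀ u v w : V, G.Adj u v → yOf φ Γ u < yOf φ Γ v →
      Γ' w ∉ openSegment ℝ (Γ' u) (Γ' v) := by
    intro u v w huv hlt hw
    rw [mem_openSegment_iff (by rwa [ho.y_eq]), hyv, ho.y_eq] at hw
    refine hΓ.vertex_notMem u v w huv ((mem_openSegment_iff hlt _).2 ⟨hw.1, ?_⟩)
    have := (ho.eq_iff (u := w) (v := w) (Or.inl rfl) (Or.inr ⟨huv, hlt⟩) (h := yOf φ Γ w)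
      ⟨le_rfl, le_rfl⟩ ⟨hw.1.1.le, hw.1.2.le⟩).2 (by rw [edgeX_self]; exact hw.2)
    rwa [edgeX_self] at this
  have hedge : ∀ u v x y : V, G.Adj u v → yOf φ Γ u < yOf φ Γ v → G.Adj x y →
      yOf φ Γ x < yOf φ Γ y → s(u, v) ≠ s(x, y) →
      Disjoint (openSegment ℝ (Γ' u) (Γ' v)) (openSegment ℝ (Γ' x) (Γ' y)) := by
    intro u v x y huv hlt hxy hlt' hne
    rw [Set.disjoint_left]
    intro z hz hz'
    rw [mem_openSegment_iff (by rwa [ho.y_eq]), ho.y_eq] at hz hz'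
    have h1 := (ho.eq_iff (Or.inr ⟨huv, hlt⟩) (Or.inr ⟨hxy, hlt'⟩) (h := (φ z).2)
      ⟨hz.1.1.le, hz.1.2.le⟩ ⟨hz'.1.1.le, hz'.1.2.le⟩).2 (hz.2.symm.trans hz'.2)
    have hd := Set.disjoint_left.1 (hΓ.edges_disjoint u v x y huv hxy hne)
    refine @hd (φ.symm (edgeX (xOf φ Γ) (yOf φ Γ) u v (φ z).2, (φ z).2)) ?_ ?_
    · rw [mem_openSegment_iff hlt, ContinuousLinearEquiv.apply_symm_apply]
      exact ⟨hz.1, rfl⟩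
    · rw [mem_openSegment_iff hlt', ContinuousLinearEquiv.apply_symm_apply]
      exact ⟨hz'.1, h1⟩
  refine ⟨fun u v huv => ?_, fun u v w huv => ?_, fun u v x y huv hxy hne => ?_⟩
  · have h2 : yOf φ Γ u = yOf φ Γ v := by rw [← hyv, ← hyv, huv]
    have h1 := (ho.eq_iff (u := u) (v := u) (u' := v) (v' := v) (Or.inl rfl) (Or.inl rfl)
      (h := yOf φ Γ u) ⟨le_rfl, le_rfl⟩ ⟨h2.ge, h2.le⟩).2
      (by rw [edgeX_self, edgeX_self]; unfold xOf; rw [huv])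
    rw [edgeX_self, edgeX_self] at h1
    exact hΓ.injective (φ.injective (Prod.ext h1 h2))
  · rcases lt_or_gt_of_ne (hy u v huv) with h | h
    · exact hvert u v w huv h
    · rw [openSegment_symm]
      exact hvert v u w huv.symm h
  · rcases lt_or_gt_of_ne (hy u v huv) with h | h <;>
      rcases lt_or_gt_of_ne (hy x y hxy) with h' | h'
    · exact hedge u v x y huv h hxy h' hne
    · rw [openSegment_symm ℝ (Γ' x)]
      exact hedge u v y x huv h hxy.symm h' (by rwa [Sym2.eq_swap (a := y)])
    · rw [openSegment_symm ℝ (Γ' u)]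
      exact hedge v u x y huv.symm h hxy h' (by rwa [Sym2.eq_swap (a := v)])
    · rw [openSegment_symm ℝ (Γ' x), openSegment_symm ℝ (Γ' u)]
      exact hedge v u y x huv.symm h hxy.symm h'
        (by rwa [Sym2.eq_swap (a := v), Sym2.eq_swap (a := y)])

end Order

/-! ### Orientation -/

section Orientation

variable {φ : ℂ ≃L[ℝ] ℝ × ℝ} {Γ Γ' : V → ℂ} {G : SimpleGraph V}

/-- The coordinates preserve areas and the orientation. -/
def IsOriented (φ : ℂ ≃L[ℝ] ℝ × ℝ) : Prop :=
  ∀ P Q, cross P Q = (φ P).1 * (φ Q).2 - (φ P).2 * (φ Q).1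

/-- The coordinates with the first one negated. -/
def mirror (φ : ℂ ≃L[ℝ] ℝ × ℝ) : ℂ ≃L[ℝ] ℝ × ℝ :=
  φ.trans ((ContinuousLinearEquiv.neg ℝ).prodCongr (ContinuousLinearEquiv.refl ℝ ℝ))

lemma mirror_fst (φ : ℂ ≃L[ℝ] ℝ × ℝ) (z : ℂ) : (mirror φ z).1 = -(φ z).1 := rfl

lemma mirror_snd (φ : ℂ ≃L[ℝ] ℝ × ℝ) (z : ℂ) : (mirror φ z).2 = (φ z).2 := rfl

lemma yOf_mirror : yOf (mirror φ) Γ = yOf φ Γ := rfl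

lemma edgeX_mirror (u v : V) (h : ℝ) :
    edgeX (xOf (mirror φ) Γ) (yOf φ Γ) u v h = -edgeX (xOf φ Γ) (yOf φ Γ) u v h :=
  edgeX_neg (xOf φ Γ) _ u v h

/-- Negating abscissae exchanges the roles of the two items. Statements about the high side of an
edge thereby reduce to the low side. -/
lemma SameOrder.mirror (ho : SameOrder G φ Γ Γ') : SameOrder G (mirror φ) Γ Γ' := by
  refine ⟨ho.y_eq, fun u v u' v' hi hi' h hh hh' => ?_⟩
  rw [yOf_mirror] at *
  change edgeX (fun w => -xOf φ Γ w) _ _ _ _ < edgeX (fun w => -xOf φ Γ w) _ _ _ _ ↔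
    edgeX (fun w => -xOf φ Γ' w) _ _ _ _ < edgeX (fun w => -xOf φ Γ' w) _ _ _ _
  rw [edgeX_neg, edgeX_neg, edgeX_neg, edgeX_neg, neg_lt_neg_iff, neg_lt_neg_iff]
  exact ho.lt_iff u' v' u v hi' hi h hh' hh

lemma IsUpwardFace.mirror {F : Set ℂ} (h : IsUpwardFace G φ Γ F) :
    IsUpwardFace G (mirror φ) Γ F := h

lemma IsOriented.cross_sub (hφ : IsOriented φ) (u v : V) (z : ℂ) :
    cross (Γ v - Γ u) (z - Γ u) = (xOf φ Γ v - xOf φ Γ u) * ((φ z).2 - yOf φ Γ u) -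
      (yOf φ Γ v - yOf φ Γ u) * ((φ z).1 - xOf φ Γ u) := by
  rw [hφ, map_sub, map_sub]; rfl

/-- This links orientation with the horizontal order: up to the height difference, the cross product
is the signed horizontal distance to the line of the edge. -/
lemma IsOriented.cross_eq (hφ : IsOriented φ) {u v : V} (h : yOf φ Γ u ≠ yOf φ Γ v) (z : ℂ) :
    cross (Γ v - Γ u) (z - Γ u) = (yOf φ Γ v - yOf φ Γ u) *
      (edgeX (xOf φ Γ) (yOf φ Γ) u v (φ z).2 - (φ z).1) := by
  rw [hφ.cross_sub, edgeX]
  have := sub_ne_zero.2 h.symm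
  field_simp
  ring

lemma edgeX_symm (x y : V → ℝ) {u v : V} (h : y u ≠ y v) (k : ℝ) :
    edgeX x y u v k = edgeX x y v u k := by
  unfold edgeX
  have h1 := sub_ne_zero.2 h
  have h2 := sub_ne_zero.2 h.symm
  have : y u - y v = -(y v - y u) := by ring
  rw [this]
  field_simp
  ring

lemma IsOriented.leftIsLow (hφ : IsOriented φ) {a b : V} (hab : G.Adj a b)
    (h : yOf φ Γ a < yOf φ Γ b) : LeftIsLow G φ Γ a b a b := by
  refine ⟨hab, h, Or.inl ⟨rfl, rfl⟩, fun z => ?_⟩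
  rw [hφ.cross_eq h.ne, mul_pos_iff_of_pos_left (sub_pos.2 h), sub_pos]

lemma IsOriented.leftIsLow_mirror (hφ : IsOriented φ) {a b : V} (hab : G.Adj a b)
    (h : yOf φ Γ a < yOf φ Γ b) : LeftIsLow G (mirror φ) Γ a b b a := by
  refine ⟨hab, h, Or.inr ⟨rfl, rfl⟩, fun z => ?_⟩
  rw [hφ.cross_eq h.ne', yOf_mirror, edgeX_mirror, mirror_fst, mirror_snd, neg_lt_neg_iff,
    edgeX_symm _ _ h.ne, ← neg_mul_neg, neg_sub, neg_sub, mul_pos_iff_of_pos_left (sub_pos.2 h),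
    sub_pos]

/-- The faces to the left of an edge are outer in both or in none of two drawings with the same
order. -/
lemma SameOrder.same_outer [Finite V] (hφ : IsOriented φ) (hΓ : IsPlanarDrawing G Γ)
    (hΓ' : IsPlanarDrawing G Γ') (hy : ∀ u v, G.Adj u v → yOf φ Γ u ≠ yOf φ Γ v)
    (hup : ∀ F, IsFace G Γ F → IsUpwardFace G φ Γ F) (ho : SameOrder G φ Γ Γ') {a b : V}
    (hab : G.Adj a b) :
    (∃ F, IsOuterFace G Γ F ∧ IsLeftOfEdge Γ a b F) ↔
      ∃ F, IsOuterFace G Γ' F ∧ IsLeftOfEdge Γ' a b F := by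
  rcases lt_or_gt_of_ne (hy a b hab) with h | h
  · exact exists_isOuterFace_iff hΓ hΓ' hy hup (hφ.leftIsLow hab h)
      (hφ.leftIsLow hab (by rwa [ho.y_eq])) ho
  · exact exists_isOuterFace_iff (φ := PlaneDrawing.mirror φ) hΓ hΓ' hy
      (fun F hF => (hup F hF).mirror) (hφ.leftIsLow_mirror hab.symm h)
      (hφ.leftIsLow_mirror hab.symm (by rwa [ho.y_eq])) ho.mirror

/-- Two edges leaving a vertex upwards (or downwards) turn in the same direction in two drawings
with the same order. -/
lemma SameOrder.cross_pos_iff (hφ : IsOriented φ) (ho : SameOrder G φ Γ Γ') {v a b : V}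
    (ha : G.Adj v a) (hb : G.Adj v b)
    (hab : 0 < (yOf φ Γ a - yOf φ Γ v) * (yOf φ Γ b - yOf φ Γ v)) :
    0 < cross (Γ a - Γ v) (Γ b - Γ v) ↔ 0 < cross (Γ' a - Γ' v) (Γ' b - Γ' v) := by
  have hyv : ∀ v, (φ (Γ' v)).2 = yOf φ Γ v := fun v => congrFun ho.y_eq v
  have hanti : ∀ x y : ℂ, cross x y = -cross y x := fun x y => by unfold cross; ring
  have hva : yOf φ Γ v ≠ yOf φ Γ a := fun h => by simp [h] at hab
  have hvb : yOf φ Γ v ≠ yOf φ Γ b := fun h => by simp [h] at hab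
  have e1 : ∀ c d : V, yOf φ Γ v ≠ yOf φ Γ c → cross (Γ c - Γ v) (Γ d - Γ v) =
      (yOf φ Γ c - yOf φ Γ v) * (edgeX (xOf φ Γ) (yOf φ Γ) v c (yOf φ Γ d) - xOf φ Γ d) :=
    fun c d h => hφ.cross_eq h (Γ d)
  have e2 : ∀ c d : V, yOf φ Γ v ≠ yOf φ Γ c → cross (Γ' c - Γ' v) (Γ' d - Γ' v) =
      (yOf φ Γ c - yOf φ Γ v) * (edgeX (xOf φ Γ') (yOf φ Γ) v c (yOf φ Γ d) - xOf φ Γ' d) := by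
    intro c d h
    have := hφ.cross_eq (Γ := Γ') (u := v) (v := c) (by rwa [ho.y_eq]) (Γ' d)
    rwa [ho.y_eq, hyv] at this
  have self : ∀ (x : V → ℝ) (c : V), x c = edgeX x (yOf φ Γ) c c (yOf φ Γ c) :=
    fun x c => (edgeX_self _ _ _ _).symm
  -- In each case, the end nearer in height to `v` is compared, as a vertex at its own height, with
  -- the other edge, which spans that height.
  rcases pos_and_pos_or_neg_and_neg_of_mul_pos hab with ⟨h1, h2⟩ | ⟨h1, h2⟩
  · rcases le_total (yOf φ Γ a) (yOf φ Γ b) with h | h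
    · rw [hanti, e1 b a hvb, hanti (Γ' a - Γ' v), e2 b a hvb, ← mul_neg, ← mul_neg, neg_sub,
        neg_sub, mul_pos_iff_of_pos_left h2, mul_pos_iff_of_pos_left h2, sub_pos, sub_pos,
        self (xOf φ Γ) a, self (xOf φ Γ') a]
      exact ho.lt_iff _ _ _ _ (Or.inr ⟨hb, by linarith⟩) (Or.inl rfl) _ ⟨by linarith, h⟩
        ⟨le_rfl, le_rfl⟩
    · rw [e1 a b hva, e2 a b hva, mul_pos_iff_of_pos_left h1, mul_pos_iff_of_pos_left h1, sub_pos,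
        sub_pos, self (xOf φ Γ) b, self (xOf φ Γ') b]
      exact ho.lt_iff _ _ _ _ (Or.inl rfl) (Or.inr ⟨ha, by linarith⟩) _ ⟨le_rfl, le_rfl⟩
        ⟨by linarith, h⟩
  · rw [← neg_pos] at h1 h2
    rcases le_total (yOf φ Γ a) (yOf φ Γ b) with h | h
    · rw [e1 a b hva, e2 a b hva, ← neg_mul_neg, ← neg_mul_neg (yOf φ Γ a - yOf φ Γ v),
        mul_pos_iff_of_pos_left h1, mul_pos_iff_of_pos_left h1, neg_sub, neg_sub, sub_pos, sub_pos,
        self (xOf φ Γ) b, self (xOf φ Γ') b, edgeX_symm _ _ hva, edgeX_symm _ _ hva]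
      exact ho.lt_iff _ _ _ _ (Or.inr ⟨ha.symm, by linarith⟩) (Or.inl rfl) _ ⟨h, by linarith⟩
        ⟨le_rfl, le_rfl⟩
    · rw [hanti, e1 b a hvb, hanti (Γ' a - Γ' v), e2 b a hvb, ← neg_mul, ← neg_mul,
        mul_pos_iff_of_pos_left h2, mul_pos_iff_of_pos_left h2, sub_pos, sub_pos,
        self (xOf φ Γ) a, self (xOf φ Γ') a, edgeX_symm _ _ hvb, edgeX_symm _ _ hvb]
      exact ho.lt_iff _ _ _ _ (Or.inl rfl) (Or.inr ⟨hb.symm, by linarith⟩) _ ⟨le_rfl, le_rfl⟩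
        ⟨h, by linarith⟩

/-- The rotation around each vertex depends only on the order. -/
lemma SameOrder.same_order (hφ : IsOriented φ) (hΓ : IsPlanarDrawing G Γ)
    (hΓ' : IsPlanarDrawing G Γ') (hy : ∀ u v, G.Adj u v → yOf φ Γ u ≠ yOf φ Γ v)
    (ho : SameOrder G φ Γ Γ') {v a b c : V} (ha : G.Adj v a) (hb : G.Adj v b) (hc : G.Adj v c) :
    ccwAngle (Γ a - Γ v) (Γ b - Γ v) < ccwAngle (Γ a - Γ v) (Γ c - Γ v) ↔
      ccwAngle (Γ' a - Γ' v) (Γ' b - Γ' v) < ccwAngle (Γ' a - Γ' v) (Γ' c - Γ' v) := by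
  have hyv : ∀ v, (φ (Γ' v)).2 = yOf φ Γ v := fun v => congrFun ho.y_eq v
  set u := φ.symm (1, 0) with hu
  have hu0 : u ≠ 0 := by
    rw [hu, Ne, map_eq_zero_iff _ φ.symm.injective]
    simp
  have hcu : ∀ z, cross u z = (φ z).2 := fun z => by rw [hφ, hu]; simp
  have h1 : ∀ x, cross u (Γ x - Γ v) = yOf φ Γ x - yOf φ Γ v := fun x => by rw [hcu, map_sub]; rfl
  have h2 : ∀ x, cross u (Γ' x - Γ' v) = yOf φ Γ x - yOf φ Γ v := fun x => by
    rw [hcu, map_sub, Prod.snd_sub, hyv, hyv]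
  -- From a horizontal reference direction, upward edges precede downward ones, and edges on the
  -- same side are compared by their cross product.
  have key : ∀ x y, G.Adj v x → G.Adj v y →
      (ccwAngle u (Γ x - Γ v) < ccwAngle u (Γ y - Γ v) ↔
        ccwAngle u (Γ' x - Γ' v) < ccwAngle u (Γ' y - Γ' v)) := by
    intro x y hx hy'
    rcases lt_or_gt_of_ne (hy v x hx) with hvx | hvx <;>
      rcases lt_or_gt_of_ne (hy v y hy') with hvy | hvy
    · have h : 0 < (yOf φ Γ x - yOf φ Γ v) * (yOf φ Γ y - yOf φ Γ v) :=
        mul_pos (sub_pos.2 hvx) (sub_pos.2 hvy)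
      rw [ccwAngle_lt_iff_cross hu0 (by rwa [h1, h1]), ccwAngle_lt_iff_cross hu0 (by rwa [h2, h2])]
      exact ho.cross_pos_iff hφ hx hy' h
    · exact iff_of_true
        (ccwAngle_lt_of_cross_pos_of_neg hu0 (by rw [h1]; linarith) (by rw [h1]; linarith))
        (ccwAngle_lt_of_cross_pos_of_neg hu0 (by rw [h2]; linarith) (by rw [h2]; linarith))
    · exact iff_of_false
        (ccwAngle_lt_of_cross_pos_of_neg hu0 (by rw [h1]; linarith) (by rw [h1]; linarith)).asymm
        (ccwAngle_lt_of_cross_pos_of_neg hu0 (by rw [h2]; linarith) (by rw [h2]; linarith)).asymm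
    · have h : 0 < (yOf φ Γ x - yOf φ Γ v) * (yOf φ Γ y - yOf φ Γ v) :=
        mul_pos_of_neg_of_neg (sub_neg.2 hvx) (sub_neg.2 hvy)
      rw [ccwAngle_lt_iff_cross hu0 (by rwa [h1, h1]), ccwAngle_lt_iff_cross hu0 (by rwa [h2, h2])]
      exact ho.cross_pos_iff hφ hx hy' h
  exact ccwAngle_lt_iff_of_order hu0 (hΓ.sub_ne_zero ha) (hΓ.sub_ne_zero hb) (hΓ.sub_ne_zero hc)
    (hΓ'.sub_ne_zero ha) (hΓ'.sub_ne_zero hb) (hΓ'.sub_ne_zero hc) (key a b ha hb) (key a c ha hc)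
    (key b c hb hc)

lemma SameOrder.equivalent [Finite V] (hφ : IsOriented φ) (hΓ : IsPlanarDrawing G Γ)
    (hΓ' : IsPlanarDrawing G Γ') (hy : ∀ u v, G.Adj u v → yOf φ Γ u ≠ yOf φ Γ v)
    (hup : ∀ F, IsFace G Γ F → IsUpwardFace G φ Γ F) (ho : SameOrder G φ Γ Γ') :
    Equivalent G Γ Γ' :=
  ⟨fun _ _ _ _ ha hb hc => ho.same_order hφ hΓ hΓ' hy ha hb hc,
    fun _ _ hab => ho.same_outer hφ hΓ hΓ' hy hup hab⟩

lemma Equivalent.trans {Γ'' : V → ℂ} (h : Equivalent G Γ Γ') (h' : Equivalent G Γ' Γ'') :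
    Equivalent G Γ Γ'' :=
  ⟨fun v a b c ha hb hc => (h.same_order v a b c ha hb hc).trans (h'.same_order v a b c ha hb hc),
    fun a b hab => (h.same_outer a b hab).trans (h'.same_outer a b hab)⟩

/-- A planar drawing between two strictly convex drawings of the same plane graph, all of them with
the same heights, is strictly convex. -/
lemma isStrictlyConvexDrawing_combo [Finite V] (hφ : IsOriented φ) {Γt : V → ℂ}
    (hΓ : IsStrictlyConvexDrawing G Γ) (hΓ' : IsStrictlyConvexDrawing G Γ')
    (hΓt : IsPlanarDrawing G Γt) (h : Equivalent G Γ Γt) (h' : Equivalent G Γ' Γt) {t : ℝ}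
    (ht : t ∈ Set.Icc (0 : ℝ) 1) (hx : ∀ v, xOf φ Γt v = (1 - t) * xOf φ Γ v + t * xOf φ Γ' v)
    (hy : yOf φ Γt = yOf φ Γ) (hy' : yOf φ Γ' = yOf φ Γ) : IsStrictlyConvexDrawing G Γt := by
  -- Bilinearity alone would give a quadratic function of time; it is linear here because the
  -- heights are constant.
  have hcross : ∀ v a b, cross (Γt a - Γt v) (Γt b - Γt v) =
      (1 - t) * cross (Γ a - Γ v) (Γ b - Γ v) + t * cross (Γ' a - Γ' v) (Γ' b - Γ' v) := by
    intro v a b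
    have e : ∀ (Δ : V → ℂ), cross (Δ a - Δ v) (Δ b - Δ v) =
        (xOf φ Δ a - xOf φ Δ v) * (yOf φ Δ b - yOf φ Δ v) -
          (yOf φ Δ a - yOf φ Δ v) * (xOf φ Δ b - xOf φ Δ v) := fun Δ => hφ.cross_sub v a (Δ b)
    rw [e, e, e, hy, hy', hx, hx, hx]
    ring
  obtain ⟨ht0, ht1⟩ := ht
  have convex : ∀ α β : ℝ, 0 < α → 0 < β → 0 < (1 - t) * α + t * β := by
    intro α β hα hβ
    rcases ht0.eq_or_lt with rfl | ht0
    · simpa using hα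
    · have := mul_nonneg (sub_nonneg.2 ht1) hα.le
      have := mul_pos ht0 hβ
      linarith
  refine ⟨hΓt, fun F hF hb v a b hab => ?_, fun F hF v a b hab => ?_⟩
  · obtain ⟨F₁, hF₁, hab₁, hb₁⟩ := h.exists_isAngleIn hΓ.planar hΓt hF hab
    obtain ⟨F₂, hF₂, hab₂, hb₂⟩ := h'.exists_isAngleIn hΓ'.planar hΓt hF hab
    have c₁ := hΓ.convex_of_internal F₁ hF₁ (hb₁.2 hb) v a b hab₁
    have c₂ := hΓ'.convex_of_internal F₂ hF₂ (hb₂.2 hb) v a b hab₂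
    rw [ccwAngle_lt_pi_iff (hΓ.planar.sub_ne_zero hab.1) (hΓ.planar.sub_ne_zero hab.2.1)] at c₁
    rw [ccwAngle_lt_pi_iff (hΓ'.planar.sub_ne_zero hab.1) (hΓ'.planar.sub_ne_zero hab.2.1)] at c₂
    rw [ccwAngle_lt_pi_iff (hΓt.sub_ne_zero hab.1) (hΓt.sub_ne_zero hab.2.1), hcross]
    exact convex _ _ c₁ c₂
  · by_cases heq : a = b
    · subst heq
      rw [ccwAngle_self (hΓt.sub_ne_zero hab.1)]
      linarith [Real.pi_pos]
    obtain ⟨F₁, hF₁, hab₁, hb₁⟩ := h.exists_isAngleIn hΓ.planar hΓt hF.1 hab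
    obtain ⟨F₂, hF₂, hab₂, hb₂⟩ := h'.exists_isAngleIn hΓ'.planar hΓt hF.1 hab
    have c₁ := hΓ.concave_of_outer F₁ ⟨hF₁, mt hb₁.1 hF.2⟩ v a b hab₁
    have c₂ := hΓ'.concave_of_outer F₂ ⟨hF₂, mt hb₂.1 hF.2⟩ v a b hab₂
    have neg : ∀ Δ : V → ℂ, IsPlanarDrawing G Δ →
        Real.pi < ccwAngle (Δ a - Δ v) (Δ b - Δ v) → cross (Δ a - Δ v) (Δ b - Δ v) < 0 := by
      intro Δ hΔ hpi
      have ha0 := hΔ.sub_ne_zero hab.1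
      have hb0 := hΔ.sub_ne_zero hab.2.1
      rcases cross_neg_or_of_pi_lt_ccwAngle ha0 hb0 hpi with h2 | ⟨r, hr, hrb⟩
      · exact h2
      · exfalso
        -- Two edges leaving `v` in the same direction would overlap, with the nearer end on the
        -- other edge.
        have key : ∀ c d : V, G.Adj v c → G.Adj v d → c ≠ d → ∀ s : ℝ, 0 < s → s ≤ 1 →
            Δ d - Δ v = s * (Δ c - Δ v) → False := by
          intro c d hc hd hcd s hs hs1 hdc
          have hmem : Δ d ∈ segment ℝ (Δ v) (Δ c) := by
            refine ⟨1 - s, s, by linarith, hs.le, by ring, ?_⟩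
            rw [Complex.real_smul, Complex.real_smul]
            push_cast
            linear_combination -hdc
          rcases mem_segment_cases hmem with h3 | h3 | h3
          · exact hd.ne (hΔ.injective h3).symm
          · exact hcd (hΔ.injective h3).symm
          · exact hΔ.vertex_notMem v c d hc h3
        rcases le_total r 1 with h3 | h3
        · exact key a b hab.1 hab.2.1 heq r hr h3 hrb
        · refine key b a hab.2.1 hab.1 (Ne.symm heq) r⁻¹ (inv_pos.2 hr) (inv_le_one_of_one_le₀ h3) ?_
          have : (r : ℂ) ≠ 0 := by exact_mod_cast hr.ne'
          rw [hrb]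
          push_cast
          field_simp
    have n₁ := neg Γ hΓ.planar c₁
    have n₂ := neg Γ' hΓ'.planar c₂
    apply pi_lt_ccwAngle_of_cross_neg (hΓt.sub_ne_zero hab.1) (hΓt.sub_ne_zero hab.2.1)
    rw [hcross]
    have := convex _ _ (neg_pos.2 n₁) (neg_pos.2 n₂)
    linarith

end Orientation

section PathFaces

variable {φ : ℂ ≃L[ℝ] ℝ × ℝ} {Γ : V → ℂ} {G : SimpleGraph V}

/-! ### Faces bounded by two monotone paths -/

lemma lt_of_increasesAlong_of_ne {y : V → ℝ} {s t : V} {p q : G.Walk s t}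
    (hp : IncreasesAlong y p) (hq : IncreasesAlong y q) (hpq : p ≠ q) : y s < y t := by
  cases p with
  | nil =>
    cases q with
    | nil => exact absurd rfl hpq
    | cons a q =>
      rw [increasesAlong_cons] at hq
      linarith [(hq.2.le_of_mem_support q.start_mem_support).2]
  | cons a p =>
    rw [increasesAlong_cons] at hp
    exact hp.1.trans_le (hp.2.le_of_mem_support p.start_mem_support).2

/-- Two monotone paths that share only their ends do not meet between them. -/
lemma walkX_ne (hΓ : IsPlanarDrawing G Γ) {s t : V} {p q : G.Walk s t}
    (hp : IncreasesAlong (yOf φ Γ) p) (hq : IncreasesAlong (yOf φ Γ) q) (hpq : p ≠ q)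
    (hd : ∀ w, w ∈ p.support → w ∈ q.support → w = s ∨ w = t) {k : ℝ}
    (hk : k ∈ Set.Ioo (yOf φ Γ s) (yOf φ Γ t)) :
    walkX (xOf φ Γ) (yOf φ Γ) p k ≠ walkX (xOf φ Γ) (yOf φ Γ) q k := by
  intro heq
  have hst := hk.1.trans hk.2
  obtain ⟨e, he, he1, he2⟩ := exists_dart_of_height hp hst hk.1.le hk.2.le
  obtain ⟨f, hf, hf1, hf2⟩ := exists_dart_of_height hq hst hk.1.le hk.2.le
  rw [walkX_of_dart _ hp he he1 he2, walkX_of_dart _ hq hf hf1 hf2] at heq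
  set z := φ.symm (edgeX (xOf φ Γ) (yOf φ Γ) e.fst e.snd k, k) with hz
  have hzk : (φ z).2 = k := by simp [hz]
  have hze : z ∈ segment ℝ (Γ e.fst) (Γ e.snd) := by
    rw [mem_segment_iff (hp e he), hz, ContinuousLinearEquiv.apply_symm_apply]
    exact ⟨⟨he1, he2⟩, rfl⟩
  have hzf : z ∈ segment ℝ (Γ f.fst) (Γ f.snd) := by
    rw [mem_segment_iff (hq f hf), hz, ContinuousLinearEquiv.apply_symm_apply]
    exact ⟨⟨hf1, hf2⟩, heq⟩
  have hef := p.dart_fst_mem_support_of_mem_darts he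
  have hes := p.dart_snd_mem_support_of_mem_darts he
  have hff := q.dart_fst_mem_support_of_mem_darts hf
  have hfs := q.dart_snd_mem_support_of_mem_darts hf
  -- A vertex of `p` lying on `q` is a vertex of `q`, hence `s` or `t`, but `k` is strictly between
  -- their heights.
  have hvert : ∀ w ∈ p.support, z ≠ Γ w := by
    intro w hw hzw
    have hwk : yOf φ Γ w = k := by rw [← hzk, hzw]; rfl
    have hwq : w ∈ q.support := by
      rw [hzw] at hzf
      rcases mem_segment_cases hzf with h | h | h
      · rwa [hΓ.injective h]
      · rwa [hΓ.injective h]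
      · exact absurd h (hΓ.vertex_notMem _ _ _ f.adj)
    rcases hd w hw hwq with rfl | rfl
    · exact hk.1.ne hwk
    · exact hk.2.ne' hwk
  rcases mem_segment_cases hze with h | h | h
  · exact hvert _ hef h
  · exact hvert _ hes h
  -- Meeting inside an edge means sharing it. Its ends are then common to both paths, so they are
  -- `s` and `t`, and each path is this single edge.
  · have h1 := hΓ.eq_of_mem e.adj f.adj h hzf
    have hle := hp e he
    have hlf := hq f hf
    obtain ⟨h2, h3⟩ : f.fst = e.fst ∧ f.snd = e.snd := by
      rw [Sym2.eq_iff] at h1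
      rcases h1 with h1 | ⟨h1, h2⟩
      · exact h1
      · rw [h1, h2] at hlf; linarith
    have h4 : e.fst = s := by
      refine (hd _ hef (h2 ▸ hff)).resolve_right fun h => ?_
      have := (hp.le_of_mem_support hes).2
      rw [h] at hle; linarith
    have h5 : e.snd = t := by
      refine (hd _ hes (h3 ▸ hfs)).resolve_left fun h => ?_
      have := (hp.le_of_mem_support hef).1
      rw [h] at hle; linarith
    obtain ⟨a, rfl⟩ := hp.eq_of_dart he h4 h5
    obtain ⟨b, rfl⟩ := hq.eq_of_dart hf (h2.trans h4) (h3.trans h5)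
    exact hpq rfl

lemma forall_lt_or_forall_lt {g h : ℝ → ℝ} (hg : Continuous g) (hh : Continuous h) {α β : ℝ}
    (hne : ∀ k ∈ Set.Ioo α β, g k ≠ h k) :
    (∀ k ∈ Set.Ioo α β, g k < h k) ∨ ∀ k ∈ Set.Ioo α β, h k < g k := by
  by_contra! hcon
  obtain ⟨⟨k, hk, h1⟩, l, hl, h2⟩ := hcon
  obtain ⟨m, hm, h3⟩ := isPreconnected_Ioo.intermediate_value₂ hk hl hh.continuousOn
    hg.continuousOn h1 h2
  exact hne m hm h3.symm

/-! ### Which points lie in the face -/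

/-- A bounded set cannot contain the whole horizontal ray, which must therefore leave it through the
frontier. -/
lemma exists_frontier_left (φ : ℂ ≃L[ℝ] ℝ × ℝ) {F : Set ℂ} (hF : IsOpen F)
    (hb : Bornology.IsBounded F) {z : ℂ} (hz : z ∈ F) :
    ∃ f ∈ frontier F, (φ f).2 = (φ z).2 ∧ (φ f).1 < (φ z).1 := by
  obtain ⟨x, hx, hxF⟩ : ∃ x < (φ z).1, φ.symm (x, (φ z).2) ∉ F := by
    by_contra! h
    refine not_isBounded_ray φ (φ z).1 (φ z).2 (hb.subset ?_)
    rintro _ ⟨x, hx, rfl⟩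
    exact h x hx
  obtain ⟨f, hfF, ⟨α, β, hα, hβ, hαβ, rfl⟩, hne⟩ := exists_mem_segment_frontier hF hz hxF
  obtain rfl : β = 1 - α := by linarith
  have hα0 : α ≠ 0 := by rintro rfl; simp at hne
  have hα' : 0 < α := lt_of_le_of_ne hα hα0.symm
  refine ⟨_, hfF, ?_, ?_⟩
  · simp only [map_add, map_smul, ContinuousLinearEquiv.apply_symm_apply, Prod.snd_add,
      Prod.smul_snd, smul_eq_mul]
    ring
  · simp only [map_add, map_smul, ContinuousLinearEquiv.apply_symm_apply, Prod.fst_add,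
      Prod.smul_fst, smul_eq_mul]
    nlinarith

/-- Any point of the face has frontier points on both sides at its height. The frontier consists of
two graphs, so the point lies between them; the connected region, free of the frontier, then lies in
the face. -/
lemma walkRegion_subset_face [Finite V] {F : Set ℂ} (hF : IsFace G Γ F)
    (hb : Bornology.IsBounded F) {s t : V} {p q : G.Walk s t} (hst : yOf φ Γ s < yOf φ Γ t)
    (hp : IncreasesAlong (yOf φ Γ) p) (hq : IncreasesAlong (yOf φ Γ) q)
    (hlt : ∀ k ∈ Set.Ioo (yOf φ Γ s) (yOf φ Γ t),
      walkX (xOf φ Γ) (yOf φ Γ) p k < walkX (xOf φ Γ) (yOf φ Γ) q k)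
    (hfr : frontier F = drawnWalk Γ p ∪ drawnWalk Γ q) : walkRegion φ Γ p q ⊆ F := by
  obtain ⟨z, hz⟩ := hF.nonempty
  obtain ⟨f, hf, hf2, hf1⟩ := exists_frontier_left φ hF.isOpen hb hz
  obtain ⟨g, hg, hg2, hg1⟩ := exists_frontier_left (mirror φ) hF.isOpen hb hz
  rw [mirror_snd, mirror_snd] at hg2
  rw [mirror_fst, mirror_fst, neg_lt_neg_iff] at hg1
  have hfr' := hfr
  rw [hfr, Set.mem_union, mem_drawnWalk_iff hp hst, mem_drawnWalk_iff hq hst] at hf hg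
  rw [hf2] at hf
  rw [hg2] at hg
  have hk : (φ z).2 ∈ Set.Icc (yOf φ Γ s) (yOf φ Γ t) := hf.elim (·.1) (·.1)
  have hk' : (φ z).2 ∈ Set.Ioo (yOf φ Γ s) (yOf φ Γ t) := by
    refine ⟨lt_of_le_of_ne hk.1 fun h => ?_, lt_of_le_of_ne hk.2 fun h => ?_⟩
    · rw [← h, walkX_start hp, walkX_start hq] at hf hg
      have := hf.elim (·.2) (·.2)
      have := hg.elim (·.2) (·.2)
      linarith
    · rw [h, walkX_end _ hp, walkX_end _ hq] at hf hg
      have := hf.elim (·.2) (·.2)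
      have := hg.elim (·.2) (·.2)
      linarith
  have := hlt _ hk'
  have hzR : z ∈ walkRegion φ Γ p q := by
    refine ⟨hk', ?_, ?_⟩ <;> rcases hf with ⟨-, hf⟩ | ⟨-, hf⟩ <;>
      rcases hg with ⟨-, hg⟩ | ⟨-, hg⟩ <;> linarith
  refine (isPreconnected_walkRegion hp hq hlt).subset_of_disjoint_frontier hF.isOpen ?_ ⟨z, hzR, hz⟩
  rintro w ⟨hw2, hw1⟩ hwF
  rw [hfr, Set.mem_union, mem_drawnWalk_iff hp hst, mem_drawnWalk_iff hq hst] at hwF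
  rcases hwF with hw | hw
  · exact hw1.1.ne' hw.2
  · exact hw1.2.ne hw.2

/-- The drawn point of least abscissa at the given height is approached by a free ray, so it is on
the frontier of the outer face. It cannot lie on `q`, which is strictly beyond `p`; it is therefore
on `p`, and nothing is drawn before `p`. -/
lemma mem_outerFace_of_lt [Finite V] {F : Set ℂ} (hF : IsOuterFace G Γ F) {s t : V}
    {p q : G.Walk s t} (hst : yOf φ Γ s < yOf φ Γ t)
    (hp : IncreasesAlong (yOf φ Γ) p) (hq : IncreasesAlong (yOf φ Γ) q)
    (hlt : ∀ k ∈ Set.Ioo (yOf φ Γ s) (yOf φ Γ t),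
      walkX (xOf φ Γ) (yOf φ Γ) p k < walkX (xOf φ Γ) (yOf φ Γ) q k)
    (hfr : frontier F = drawnWalk Γ p ∪ drawnWalk Γ q) {z : ℂ}
    (hz2 : (φ z).2 ∈ Set.Ioo (yOf φ Γ s) (yOf φ Γ t))
    (hz1 : (φ z).1 < walkX (xOf φ Γ) (yOf φ Γ) p (φ z).2) : z ∈ F := by
  set k := (φ z).2 with hk
  have hDc : IsCompact (drawnSet G Γ ∩ {w | (φ w).2 = k}) :=
    (isCompact_drawnSet G Γ).inter_right
      (isClosed_eq (continuous_snd.comp φ.continuous) continuous_const)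
  have hpD : φ.symm (walkX (xOf φ Γ) (yOf φ Γ) p k, k) ∈ drawnSet G Γ ∩ {w | (φ w).2 = k} := by
    refine ⟨drawnWalk_subset p ?_, by simp⟩
    rw [mem_drawnWalk_iff hp hst, ContinuousLinearEquiv.apply_symm_apply]
    exact ⟨Set.Ioo_subset_Icc_self hz2, rfl⟩
  obtain ⟨w, ⟨hwd, hw2⟩, hmin⟩ := hDc.exists_isMinOn ⟨_, hpD⟩
    (f := fun w => (φ w).1) (continuous_fst.comp φ.continuous).continuousOn
  have hwle : (φ w).1 ≤ walkX (xOf φ Γ) (yOf φ Γ) p k := by simpa using hmin hpD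
  have hS : (fun x : ℝ => φ.symm (x, k)) '' Set.Iio (φ w).1 ⊆ (drawnSet G Γ)ᶜ := by
    rintro _ ⟨x, hx, rfl⟩ hd
    have : (φ w).1 ≤ (φ (φ.symm (x, k))).1 := hmin ⟨hd, by simp⟩
    simp only [ContinuousLinearEquiv.apply_symm_apply] at this
    exact absurd hx (not_lt.2 this)
  have hSF := hF.subset_of_not_isBounded (isPreconnected_ray φ _ k) hS (not_isBounded_ray φ _ k)
  have htend : Filter.Tendsto (fun x : ℝ => φ.symm (x, k)) (𝓝[<] (φ w).1) (𝓝 w) := by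
    refine (Continuous.tendsto' (by fun_prop) _ _ ?_).mono_left nhdsWithin_le_nhds
    rw [ContinuousLinearEquiv.symm_apply_eq]
    exact Prod.ext rfl hw2.symm
  have hwF : w ∈ frontier F := hF.1.mem_frontier hwd (mem_closure_of_tendsto htend
    (Filter.eventually_of_mem self_mem_nhdsWithin fun x hx => hSF ⟨x, hx, rfl⟩))
  have hw2' : (φ w).2 = k := hw2
  rw [hfr, Set.mem_union, mem_drawnWalk_iff hp hst, mem_drawnWalk_iff hq hst, hw2'] at hwF
  have hltk := hlt k hz2
  have hwp : (φ w).1 = walkX (xOf φ Γ) (yOf φ Γ) p k := by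
    rcases hwF with ⟨-, h⟩ | ⟨-, h⟩
    · exact h
    · linarith
  refine hSF ⟨(φ z).1, by rw [hwp]; exact hz1, ?_⟩
  exact φ.symm_apply_apply z

/-! ### Angles at the inner vertices of the boundary paths -/

lemma yOf_ref (hφ : IsOriented φ) : ∃ u : ℂ, u ≠ 0 ∧ ∀ z, cross u z = (φ z).2 := by
  refine ⟨φ.symm (1, 0), ?_, fun z => by rw [hφ]; simp⟩
  rw [Ne, map_eq_zero_iff _ φ.symm.injective]
  simp

lemma cross_neg_left (x y : ℂ) : cross (-x) y = -cross x y := by simp [cross]; ring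

lemma cross_swap (x y : ℂ) : cross x y = -cross y x := by unfold cross; ring

section Corner

variable {s t : V} {p : G.Walk s t} {e f : G.Dart}

/-- If the points close to `v` on the right of an upward path through `a`, `v` and `b` belong to a
face, then the face has an angle at `v` from `va` to `vb`. -/
lemma isAngleIn_right (hφ : IsOriented φ) (hΓ : IsPlanarDrawing G Γ)
    (hp : IncreasesAlong (yOf φ Γ) p) (he : e ∈ p.darts) (hf : f ∈ p.darts) (hef : e.snd = f.fst)
    {F : Set ℂ} (hF : ∀ᶠ z in 𝓝 (Γ e.snd), walkX (xOf φ Γ) (yOf φ Γ) p (φ z).2 < (φ z).1 → z ∈ F) :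
    IsAngleIn G Γ e.snd e.fst f.snd F := by
  have h1 := hp e he
  have h2 := hp f hf
  have hwe : ∀ k, yOf φ Γ e.fst ≤ k → k ≤ yOf φ Γ e.snd → _ := fun k => walkX_of_dart (xOf φ Γ) hp he
  have hwf : ∀ k, yOf φ Γ f.fst ≤ k → k ≤ yOf φ Γ f.snd → _ := fun k => walkX_of_dart (xOf φ Γ) hp hf
  have hvb : G.Adj e.snd f.snd := hef ▸ f.adj
  have hva := e.adj.symm
  rw [← hef] at h2 hwf
  set v := e.snd
  set a := e.fst
  set b := f.snd
  have hY : ∀ᶠ z in 𝓝 (Γ v), (φ z).2 ∈ Set.Ioo (yOf φ Γ a) (yOf φ Γ b) :=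
    (continuous_snd.comp φ.continuous).continuousAt.eventually_mem (Ioo_mem_nhds h1 h2)
  obtain ⟨ρ, hρ, hρF⟩ := Metric.eventually_nhds_iff.1 (hF.and hY)
  have hA0 := hΓ.sub_ne_zero hva
  have hApos := norm_pos_iff.2 hA0
  refine ⟨hva, hvb, ρ / ‖Γ a - Γ v‖, div_pos hρ hApos, fun r hr θ hθ => ?_⟩
  set z := Γ v + (r : ℂ) * Complex.exp ((θ : ℂ) * Complex.I) * (Γ a - Γ v) with hz
  have hzv : (r : ℂ) * Complex.exp ((θ : ℂ) * Complex.I) * (Γ a - Γ v) = z - Γ v := by rw [hz]; ring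
  have hdist : dist z (Γ v) < ρ := by
    rw [dist_eq_norm, ← hzv, norm_mul, norm_mul, Complex.norm_exp_ofReal_mul_I,
      Complex.norm_of_nonneg hr.1.le, mul_one]
    exact (lt_div_iff₀ hApos).1 hr.2
  obtain ⟨h3, h4⟩ := hρF hdist
  obtain ⟨u, hu, hcu⟩ := yOf_ref hφ
  have hcu' : ∀ z, cross (-u) (z - Γ v) = yOf φ Γ v - (φ z).2 := fun z => by
    rw [cross_neg_left, hcu, map_sub, Prod.snd_sub]; unfold yOf; ring
  -- The reference is reversed because the sector starts at the downward edge `va`, which must have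
  -- positive cross product with it.
  have key := cross_pos_of_mem_sector (u := -u) (neg_ne_zero.2 hu)
    (A := Γ a - Γ v) (B := Γ b - Γ v)
    (by rw [hcu']; exact sub_pos.2 h1) (by rw [hcu']; exact sub_neg.2 h2) hr.1 hθ
  rw [hzv, hcu', sub_nonneg, sub_neg] at key
  apply h3
  rcases le_or_gt (φ z).2 (yOf φ Γ v) with h5 | h5
  · rw [hwe _ h4.1.le h5, edgeX_symm _ _ h1.ne]
    have h6 := key.1 h5
    rw [hφ.cross_eq h1.ne'] at h6
    have := (pos_iff_pos_of_mul_pos h6).not.1 (not_lt.2 (sub_neg.2 h1).le)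
    nlinarith [sub_neg.2 h1]
  · rw [hwf _ h5.le h4.2.le]
    have h6 := key.2 h5
    rw [cross_swap, hφ.cross_eq h2.ne, ← mul_neg, mul_pos_iff_of_pos_left (sub_pos.2 h2)] at h6
    linarith

/-- If the points close to `v` on the left of an upward path through `a`, `v` and `b` belong to a
face, then the face has an angle at `v` from `vb` to `va`. -/
lemma isAngleIn_left (hφ : IsOriented φ) (hΓ : IsPlanarDrawing G Γ)
    (hp : IncreasesAlong (yOf φ Γ) p) (he : e ∈ p.darts) (hf : f ∈ p.darts) (hef : e.snd = f.fst)
    {F : Set ℂ} (hF : ∀ᶠ z in 𝓝 (Γ e.snd), (φ z).1 < walkX (xOf φ Γ) (yOf φ Γ) p (φ z).2 → z ∈ F) :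
    IsAngleIn G Γ e.snd f.snd e.fst F := by
  have h1 := hp e he
  have h2 := hp f hf
  have hwe : ∀ k, yOf φ Γ e.fst ≤ k → k ≤ yOf φ Γ e.snd → _ := fun k => walkX_of_dart (xOf φ Γ) hp he
  have hwf : ∀ k, yOf φ Γ f.fst ≤ k → k ≤ yOf φ Γ f.snd → _ := fun k => walkX_of_dart (xOf φ Γ) hp hf
  have hvb : G.Adj e.snd f.snd := hef ▸ f.adj
  have hva := e.adj.symm
  rw [← hef] at h2 hwf
  set v := e.snd
  set a := e.fst
  set b := f.snd
  have hY : ∀ᶠ z in 𝓝 (Γ v), (φ z).2 ∈ Set.Ioo (yOf φ Γ a) (yOf φ Γ b) :=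
    (continuous_snd.comp φ.continuous).continuousAt.eventually_mem (Ioo_mem_nhds h1 h2)
  obtain ⟨ρ, hρ, hρF⟩ := Metric.eventually_nhds_iff.1 (hF.and hY)
  have hB0 := hΓ.sub_ne_zero hvb
  have hBpos := norm_pos_iff.2 hB0
  refine ⟨hvb, hva, ρ / ‖Γ b - Γ v‖, div_pos hρ hBpos, fun r hr θ hθ => ?_⟩
  set z := Γ v + (r : ℂ) * Complex.exp ((θ : ℂ) * Complex.I) * (Γ b - Γ v) with hz
  have hzv : (r : ℂ) * Complex.exp ((θ : ℂ) * Complex.I) * (Γ b - Γ v) = z - Γ v := by rw [hz]; ring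
  have hdist : dist z (Γ v) < ρ := by
    rw [dist_eq_norm, ← hzv, norm_mul, norm_mul, Complex.norm_exp_ofReal_mul_I,
      Complex.norm_of_nonneg hr.1.le, mul_one]
    exact (lt_div_iff₀ hBpos).1 hr.2
  obtain ⟨h3, h4⟩ := hρF hdist
  obtain ⟨u, hu, hcu⟩ := yOf_ref hφ
  have hcu' : ∀ z, cross u (z - Γ v) = (φ z).2 - yOf φ Γ v := fun z => by
    rw [hcu, map_sub, Prod.snd_sub]; rfl
  have key := cross_pos_of_mem_sector hu (A := Γ b - Γ v) (B := Γ a - Γ v)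
    (by rw [hcu']; exact sub_pos.2 h2) (by rw [hcu']; exact sub_neg.2 h1) hr.1 hθ
  rw [hzv, hcu', sub_nonneg, sub_neg] at key
  apply h3
  rcases lt_or_ge (φ z).2 (yOf φ Γ v) with h5 | h5
  · rw [hwe _ h4.1.le h5.le, edgeX_symm _ _ h1.ne]
    have h6 := key.2 h5
    rw [cross_swap, hφ.cross_eq h1.ne', ← neg_mul, neg_sub,
      mul_pos_iff_of_pos_left (sub_pos.2 h1)] at h6
    linarith
  · rw [hwf _ h5 h4.2.le]
    have h6 := key.1 h5
    rw [hφ.cross_eq h2.ne, mul_pos_iff_of_pos_left (sub_pos.2 h2)] at h6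
    linarith

lemma turn_left_iff (hφ : IsOriented φ) (hp : IncreasesAlong (yOf φ Γ) p) (he : e ∈ p.darts) :
    0 < cross (Γ e.fst - Γ e.snd) (Γ f.snd - Γ e.snd) ↔
      edgeX (xOf φ Γ) (yOf φ Γ) e.fst e.snd (yOf φ Γ f.snd) < xOf φ Γ f.snd := by
  have h1 := hp e he
  rw [hφ.cross_eq h1.ne', edgeX_symm _ _ h1.ne, ← neg_mul_neg, neg_sub, neg_sub,
    mul_pos_iff_of_pos_left (sub_pos.2 h1), sub_pos]
  rfl

lemma turn_right_iff (hφ : IsOriented φ) (hp : IncreasesAlong (yOf φ Γ) p) (he : e ∈ p.darts) :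
    0 < cross (Γ f.snd - Γ e.snd) (Γ e.fst - Γ e.snd) ↔
      xOf φ Γ f.snd < edgeX (xOf φ Γ) (yOf φ Γ) e.fst e.snd (yOf φ Γ f.snd) := by
  have h1 := hp e he
  rw [cross_swap, hφ.cross_eq h1.ne', edgeX_symm _ _ h1.ne, ← neg_mul, neg_sub,
    mul_pos_iff_of_pos_left (sub_pos.2 h1), sub_pos]
  rfl

/-- An angle larger than `π` between an upward and a downward edge is a reflex turn. -/
lemma cross_pos_of_pi_lt (hφ : IsOriented φ) {v c d : V}
    (h : (yOf φ Γ c - yOf φ Γ v) * (yOf φ Γ d - yOf φ Γ v) < 0)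
    (hpi : Real.pi < ccwAngle (Γ c - Γ v) (Γ d - Γ v)) :
    0 < cross (Γ d - Γ v) (Γ c - Γ v) := by
  obtain ⟨u, hu, hcu⟩ := yOf_ref hφ
  have hY : ∀ w, yOf φ Γ w - yOf φ Γ v = (φ (Γ w - Γ v)).2 := fun w => by rw [map_sub]; rfl
  rw [hY, hY] at h
  have hc : Γ c - Γ v ≠ 0 := by intro h0; simp [h0] at h
  have hd : Γ d - Γ v ≠ 0 := by intro h0; simp [h0] at h
  rw [cross_swap]
  rcases cross_neg_or_of_pi_lt_ccwAngle hc hd hpi with h1 | ⟨r, hr, h1⟩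
  · linarith
  · rw [h1, ← Complex.real_smul, map_smul, Prod.smul_snd, smul_eq_mul] at h
    nlinarith [mul_nonneg hr.le (mul_self_nonneg (φ (Γ c - Γ v)).2)]

end Corner

/-! ### The polygon delimiting a face -/

/-- The boundary of a face is composed of two monotone paths sharing only their ends. -/
def IsPathFace (G : SimpleGraph V) (φ : ℂ ≃L[ℝ] ℝ × ℝ) (Γ : V → ℂ) (F : Set ℂ) : Prop :=
  ∃ (s t : V) (p q : G.Walk s t), p.IsPath ∧ q.IsPath ∧ p ≠ q ∧
    (∀ w, w ∈ p.support → w ∈ q.support → w = s ∨ w = t) ∧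
    IncreasesAlong (yOf φ Γ) p ∧ IncreasesAlong (yOf φ Γ) q ∧
    frontier F = drawnWalk Γ p ∪ drawnWalk Γ q

lemma IsPathFace.isUpwardFace {F : Set ℂ} (h : IsPathFace G φ Γ F) : IsUpwardFace G φ Γ F := by
  obtain ⟨s, t, p, q, -, -, hpq, -, hp, hq, hfr⟩ := h
  exact ⟨s, t, p, q, lt_of_increasesAlong_of_ne hp hq hpq, hp, hq, hfr⟩

/-- Disjointness of the edges is assumed separately: two copies of a single edge also share only
their ends. -/
lemma isCycle_append_reverse {s t : V} {p q : G.Walk s t} (hp : p.IsPath) (hq : q.IsPath)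
    (hst : s ≠ t) (hd : ∀ w, w ∈ p.support → w ∈ q.support → w = s ∨ w = t)
    (he : ∀ e ∈ q.edges, e ∉ p.edges) : (q.append p.reverse).IsCycle := by
  have hqn : ¬ q.Nil := fun h => hst h.eq
  have hptail : (p.reverse.support.tail).Nodup := hp.reverse.support_nodup.sublist (List.tail_sublist _)
  have hqtail : (q.support.tail).Nodup := hq.support_nodup.sublist (List.tail_sublist _)
  rw [SimpleGraph.Walk.isCycle_def]
  refine ⟨?_, ?_, ?_⟩
  · rw [SimpleGraph.Walk.isTrail_def, SimpleGraph.Walk.edges_append,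
      SimpleGraph.Walk.edges_reverse, List.nodup_append]
    refine ⟨hq.isTrail.edges_nodup, List.nodup_reverse.2 hp.isTrail.edges_nodup, ?_⟩
    rintro e h1 f h2 rfl
    exact he e h1 (List.mem_reverse.1 h2)
  · intro h
    apply hqn
    have := congrArg SimpleGraph.Walk.length h
    rw [SimpleGraph.Walk.length_append] at this
    simp at this
    exact this.1
  · rw [SimpleGraph.Walk.tail_support_append, List.nodup_append]
    refine ⟨hqtail, hptail, ?_⟩
    rintro w h1 _ h2 rfl
    have h3 : w ≠ s := by
      rintro rfl
      have := hq.support_nodup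
      rw [← q.cons_tail_support, List.nodup_cons] at this
      exact this.1 h1
    have h4 : w ≠ t := by
      rintro rfl
      have := hp.reverse.support_nodup
      rw [← p.reverse.cons_tail_support, List.nodup_cons] at this
      exact this.1 h2
    have h5 : w ∈ p.support := by
      have := List.mem_of_mem_tail h2
      simpa using this
    rcases hd w h5 (List.mem_of_mem_tail h1) with h | h
    · exact h3 h
    · exact h4 h

/-- A face bounded by a left path turning left and a right path turning right is delimited by a
strictly convex polygon. -/
lemma isDelimited_of_turns (hφ : IsOriented φ) {F : Set ℂ} {s t : V} {p q : G.Walk s t}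
    (hpp : p.IsPath) (hqp : q.IsPath) (hst : yOf φ Γ s < yOf φ Γ t)
    (hd : ∀ w, w ∈ p.support → w ∈ q.support → w = s ∨ w = t)
    (hp : IncreasesAlong (yOf φ Γ) p) (hq : IncreasesAlong (yOf φ Γ) q)
    (hlt : ∀ k ∈ Set.Ioo (yOf φ Γ s) (yOf φ Γ t),
      walkX (xOf φ Γ) (yOf φ Γ) p k < walkX (xOf φ Γ) (yOf φ Γ) q k)
    (hfr : frontier F = drawnWalk Γ p ∪ drawnWalk Γ q)
    (hc : ∀ e ∈ p.darts, ∀ f ∈ p.darts, e.snd = f.fst →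
      edgeX (xOf φ Γ) (yOf φ Γ) e.fst e.snd (yOf φ Γ f.snd) < xOf φ Γ f.snd)
    (hc' : ∀ e ∈ q.darts, ∀ f ∈ q.darts, e.snd = f.fst →
      xOf φ Γ f.snd < edgeX (xOf φ Γ) (yOf φ Γ) e.fst e.snd (yOf φ Γ f.snd)) :
    IsDelimitedByStrictlyConvexPolygon G Γ F := by
  have hn : ∀ e ∈ q.darts, ∀ f ∈ q.darts, e.snd = f.fst →
      edgeX (fun w => -xOf φ Γ w) (yOf φ Γ) e.fst e.snd (yOf φ Γ f.snd) < -xOf φ Γ f.snd :=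
    fun e he f hf h => by rw [edgeX_neg]; exact neg_lt_neg (hc' e he f hf h)
  have hn' : ∀ e ∈ p.darts, ∀ f ∈ p.darts, e.snd = f.fst →
      -xOf φ Γ f.snd < edgeX (fun w => -xOf φ Γ w) (yOf φ Γ) e.fst e.snd (yOf φ Γ f.snd) :=
    fun e he f hf h => by rw [edgeX_neg]; exact neg_lt_neg (hc e he f hf h)
  -- the vertices are on the right of the edges of `p` and on the left of the edges of `q`
  have hright : ∀ e ∈ p.darts, ∀ w, w ∈ p.support ∨ w ∈ q.support → w ≠ e.fst → w ≠ e.snd →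
      edgeX (xOf φ Γ) (yOf φ Γ) e.fst e.snd (yOf φ Γ w) < xOf φ Γ w := by
    intro e he w hw h1 h2
    by_cases hwp : w ∈ p.support
    · exact edgeX_lt_of_turns hp hc he hwp h1 h2
    · refine edgeX_lt_of_turns_of_turns hp hq hc hc' he (hw.resolve_left hwp) ?_ ?_
      · rintro rfl; exact hwp p.start_mem_support
      · rintro rfl; exact hwp p.end_mem_support
  have hleft : ∀ e ∈ q.darts, ∀ w, w ∈ p.support ∨ w ∈ q.support → w ≠ e.fst → w ≠ e.snd →
      xOf φ Γ w < edgeX (xOf φ Γ) (yOf φ Γ) e.fst e.snd (yOf φ Γ w) := by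
    intro e he w hw h1 h2
    have : edgeX (fun w => -xOf φ Γ w) (yOf φ Γ) e.fst e.snd (yOf φ Γ w) < -xOf φ Γ w := by
      by_cases hwq : w ∈ q.support
      · exact edgeX_lt_of_turns (x := fun w => -xOf φ Γ w) hq hn he hwq h1 h2
      · refine edgeX_lt_of_turns_of_turns (x := fun w => -xOf φ Γ w) hq hp hn hn' he
          (hw.resolve_right hwq) ?_ ?_
        · rintro rfl; exact hwq q.start_mem_support
        · rintro rfl; exact hwq q.end_mem_support
    rw [edgeX_neg, neg_lt_neg_iff] at this
    exact this
  -- Going up the right path and down the left one traverses the polygon counter-clockwise.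
  refine ⟨s, q.append p.reverse, isCycle_append_reverse hpp hqp
    (by rintro rfl; exact lt_irrefl _ hst) hd ?_, ?_, ?_⟩
  -- A common edge would make the two graphs agree at its inner heights, contrary to `hlt`.
  · intro e he he'
    rw [SimpleGraph.Walk.edges, List.mem_map] at he he'
    obtain ⟨e, he, rfl⟩ := he
    obtain ⟨f, hf, hfe⟩ := he'
    have h1 := hq e he
    have h2 := hp f hf
    have h3 : s(f.fst, f.snd) = s(e.fst, e.snd) := hfe
    obtain ⟨h4, h5⟩ : f.fst = e.fst ∧ f.snd = e.snd := by
      rw [Sym2.eq_iff] at h3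
      rcases h3 with h3 | ⟨h3, h4⟩
      · exact h3
      · rw [h3, h4] at h2; linarith
    have h6 := (hq.le_of_mem_support (q.dart_fst_mem_support_of_mem_darts he)).1
    have h7 := (hq.le_of_mem_support (q.dart_snd_mem_support_of_mem_darts he)).2
    obtain ⟨k, hk1, hk2⟩ := exists_between h1
    have h8 := hlt k ⟨by linarith, by linarith⟩
    rw [walkX_of_dart _ hq he hk1.le hk2.le,
      walkX_of_dart _ hp hf (by rw [h4]; exact hk1.le) (by rw [h5]; exact hk2.le), h4, h5] at h8
    exact lt_irrefl _ h8
  · rw [hfr, Set.union_comm]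
    ext z
    simp only [drawnWalk, SimpleGraph.Walk.edges_append, SimpleGraph.Walk.edges_reverse,
      List.mem_append, List.mem_reverse, Set.mem_union, Set.mem_iUnion, exists_prop]
    constructor
    · rintro (⟨e, he, hz⟩ | ⟨e, he, hz⟩)
      exacts [⟨e, Or.inl he, hz⟩, ⟨e, Or.inr he, hz⟩]
    · rintro ⟨e, he | he, hz⟩
      exacts [Or.inl ⟨e, he, hz⟩, Or.inr ⟨e, he, hz⟩]
  · intro e he w hw h1 h2
    have hw' : w ∈ p.support ∨ w ∈ q.support := by
      rw [SimpleGraph.Walk.mem_support_append_iff, SimpleGraph.Walk.support_reverse,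
        List.mem_reverse] at hw
      exact hw.symm
    rw [SimpleGraph.Walk.darts_append, List.mem_append] at he
    rcases he with he | he
    · have hle := hq e he
      rw [hφ.cross_eq hle.ne, mul_pos_iff_of_pos_left (sub_pos.2 hle), sub_pos]
      exact hleft e he w hw' h1 h2
    · rw [SimpleGraph.Walk.mem_darts_reverse] at he
      have hle := hp e.symm he
      have hle' : yOf φ Γ e.snd < yOf φ Γ e.fst := hle
      rw [hφ.cross_eq hle'.ne', edgeX_symm _ _ hle'.ne', ← neg_mul_neg, neg_sub, neg_sub,
        mul_pos_iff_of_pos_left (sub_pos.2 hle'), sub_pos]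
      exact hright e.symm he w hw' h2 h1

/-- In a strictly convex drawing, a face bounded by two monotone paths sharing only their ends is
delimited by a strictly convex polygon. -/
lemma IsPathFace.isDelimited [Finite V] (hφ : IsOriented φ) (hΓ : IsStrictlyConvexDrawing G Γ)
    {F : Set ℂ} (hF : IsFace G Γ F) (h : IsPathFace G φ Γ F) :
    IsDelimitedByStrictlyConvexPolygon G Γ F := by
  obtain ⟨s, t, p, q, hpp, hqp, hpq, hd, hp, hq, hfr⟩ := h
  have hst := lt_of_increasesAlong_of_ne hp hq hpq
  have hcp := continuous_walkX (xOf φ Γ) hp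
  have hcq := continuous_walkX (xOf φ Γ) hq
  wlog hlt : ∀ k ∈ Set.Ioo (yOf φ Γ s) (yOf φ Γ t),
      walkX (xOf φ Γ) (yOf φ Γ) p k < walkX (xOf φ Γ) (yOf φ Γ) q k generalizing p q
  · refine this q p hqp hpp hpq.symm (fun w h1 h2 => hd w h2 h1) hq hp (by rw [hfr, Set.union_comm])
      hcq hcp ?_
    exact (forall_lt_or_forall_lt hcp hcq
      (fun k hk => walkX_ne hΓ.planar hp hq hpq hd hk)).resolve_left hlt
  -- heights of the inner vertices of the paths
  have hinner : ∀ r : G.Walk s t, IncreasesAlong (yOf φ Γ) r → ∀ e ∈ r.darts, ∀ f ∈ r.darts,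
      e.snd = f.fst → yOf φ Γ e.snd ∈ Set.Ioo (yOf φ Γ s) (yOf φ Γ t) := by
    intro r hr e he f hf hef
    refine ⟨(hr.le_of_mem_support (r.dart_fst_mem_support_of_mem_darts he)).1.trans_lt (hr e he), ?_⟩
    rw [hef]
    exact (hr f hf).trans_le (hr.le_of_mem_support (r.dart_snd_mem_support_of_mem_darts hf)).2
  have hev : ∀ v, yOf φ Γ v ∈ Set.Ioo (yOf φ Γ s) (yOf φ Γ t) →
      ∀ᶠ z in 𝓝 (Γ v), (φ z).2 ∈ Set.Ioo (yOf φ Γ s) (yOf φ Γ t) := fun v hv =>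
    (continuous_snd.comp φ.continuous).continuousAt.eventually_mem (Ioo_mem_nhds hv.1 hv.2)
  have hwalk : ∀ r : G.Walk s t, IncreasesAlong (yOf φ Γ) r → ∀ e ∈ r.darts,
      walkX (xOf φ Γ) (yOf φ Γ) r (yOf φ Γ e.snd) = xOf φ Γ e.snd := fun r hr e he =>
    walkX_of_mem_support _ hr (r.dart_snd_mem_support_of_mem_darts he)
  by_cases hb : Bornology.IsBounded F
  · have hR := walkRegion_subset_face hF hb hst hp hq hlt hfr
    refine isDelimited_of_turns hφ hpp hqp hst hd hp hq hlt hfr ?_ ?_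
    · intro e he f hf hef
      have hv := hinner p hp e he f hf hef
      have hnear : ∀ᶠ z in 𝓝 (Γ e.snd), (φ z).1 < walkX (xOf φ Γ) (yOf φ Γ) q (φ z).2 := by
        refine Filter.Tendsto.eventually_lt (f := fun z => (φ z).1)
          (g := fun z => walkX (xOf φ Γ) (yOf φ Γ) q (φ z).2)
          ((continuous_fst.comp φ.continuous).tendsto _)
          ((hcq.comp (continuous_snd.comp φ.continuous)).tendsto _) ?_
        have := hlt _ hv
        rw [hwalk p hp e he] at this
        exact this
      have hang := isAngleIn_right hφ hΓ.planar hp he hf hef (F := F) (by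
        filter_upwards [hev _ hv, hnear] with z h1 h2 h3 using hR ⟨h1, h3, h2⟩)
      have := hΓ.convex_of_internal F hF hb _ _ _ hang
      rw [ccwAngle_lt_pi_iff (hΓ.planar.sub_ne_zero hang.1) (hΓ.planar.sub_ne_zero hang.2.1)] at this
      exact (turn_left_iff hφ hp he).1 this
    · intro e he f hf hef
      have hv := hinner q hq e he f hf hef
      have hnear : ∀ᶠ z in 𝓝 (Γ e.snd), walkX (xOf φ Γ) (yOf φ Γ) p (φ z).2 < (φ z).1 := by
        refine Filter.Tendsto.eventually_lt (g := fun z => (φ z).1)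
          (f := fun z => walkX (xOf φ Γ) (yOf φ Γ) p (φ z).2)
          ((hcp.comp (continuous_snd.comp φ.continuous)).tendsto _)
          ((continuous_fst.comp φ.continuous).tendsto _) ?_
        have := hlt _ hv
        rw [hwalk q hq e he] at this
        exact this
      have hang := isAngleIn_left hφ hΓ.planar hq he hf hef (F := F) (by
        filter_upwards [hev _ hv, hnear] with z h1 h2 h3 using hR ⟨h1, h2, h3⟩)
      have := hΓ.convex_of_internal F hF hb _ _ _ hang
      rw [ccwAngle_lt_pi_iff (hΓ.planar.sub_ne_zero hang.1) (hΓ.planar.sub_ne_zero hang.2.1)] at this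
      exact (turn_right_iff hφ hq he).1 this
  -- The outer face lies on the other side of each path and its angles exceed π, so the paths turn
  -- as they do around a bounded face.
  · have hout : IsOuterFace G Γ F := ⟨hF, hb⟩
    have hsign : ∀ r : G.Walk s t, IncreasesAlong (yOf φ Γ) r → ∀ e ∈ r.darts, ∀ f ∈ r.darts,
        e.snd = f.fst →
        (yOf φ Γ f.snd - yOf φ Γ e.snd) * (yOf φ Γ e.fst - yOf φ Γ e.snd) < 0 := by
      intro r hr e he f hf hef
      have h1 := hr e he
      have h2 := hr f hf
      rw [← hef] at h2
      exact mul_neg_of_pos_of_neg (sub_pos.2 h2) (sub_neg.2 h1)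
    refine isDelimited_of_turns hφ hpp hqp hst hd hp hq hlt hfr ?_ ?_
    · intro e he f hf hef
      have hv := hinner p hp e he f hf hef
      have hang := isAngleIn_left hφ hΓ.planar hp he hf hef (F := F) (by
        filter_upwards [hev _ hv] with z h1 h2
          using mem_outerFace_of_lt hout hst hp hq hlt hfr h1 h2)
      have := hΓ.concave_of_outer F hout _ _ _ hang
      exact (turn_left_iff hφ hp he).1 (cross_pos_of_pi_lt hφ (hsign p hp e he f hf hef) this)
    · intro e he f hf hef
      have hv := hinner q hq e he f hf hef
      have hm : ∀ (r : G.Walk s t) (k : ℝ), walkX (xOf (mirror φ) Γ) (yOf φ Γ) r k =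
          -walkX (xOf φ Γ) (yOf φ Γ) r k := fun r k => walkX_neg _ _ _ _
      have hang := isAngleIn_right hφ hΓ.planar hq he hf hef (F := F) (by
        filter_upwards [hev _ hv] with z h1 h2
        refine mem_outerFace_of_lt (φ := mirror φ) (p := q) (q := p) hout hst hq hp (fun k hk => ?_)
          (by rw [hfr, Set.union_comm]) h1 ?_
        · rw [yOf_mirror, hm, hm]
          exact neg_lt_neg (hlt k hk)
        · rw [yOf_mirror, hm]
          exact neg_lt_neg h2)
      have := hΓ.concave_of_outer F hout _ _ _ hang
      refine (turn_right_iff hφ hq he).1 (cross_pos_of_pi_lt hφ ?_ this)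
      rw [mul_comm]
      exact hsign q hq e he f hf hef

end PathFaces

/-! ### Hierarchical plane graphs -/

/-- The orthonormal coordinates with the unit vector `d` as second basis vector. -/
def levelCoords (d : ℂ) (hd : ‖d‖ = 1) : ℂ ≃L[ℝ] ℝ × ℝ :=
  LinearEquiv.toContinuousLinearEquiv
    { toFun := fun z => (inner ℝ (-Complex.I * d) z, inner ℝ d z)
      map_add' := fun z w => by simp [inner_add_right]
      map_smul' := fun r z => by ext <;> simp only [real_inner_smul_right] <;> rfl
      invFun := fun a => (a.1 : ℂ) * (-Complex.I * d) + (a.2 : ℂ) * d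
      left_inv := fun z => by
        have h : d.re * d.re + d.im * d.im = 1 := by
          rw [← Complex.normSq_apply, Complex.normSq_eq_norm_sq, hd, one_pow]
        apply Complex.ext
        · simp [Complex.inner]
          linear_combination z.re * h
        · simp [Complex.inner]
          linear_combination z.im * h
      right_inv := fun a => by
        have h : d.re * d.re + d.im * d.im = 1 := by
          rw [← Complex.normSq_apply, Complex.normSq_eq_norm_sq, hd, one_pow]
        ext
        · simp [Complex.inner]
          linear_combination a.1 * h
        · simp [Complex.inner]
          linear_combination a.2 * h }

lemma levelCoords_apply (d : ℂ) (hd : ‖d‖ = 1) (z : ℂ) :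
    levelCoords d hd z = (inner ℝ (-Complex.I * d) z, inner ℝ d z) := rfl

/-- The pair `(-i d, d)` is a positively oriented orthonormal basis. -/
lemma isOriented_levelCoords (d : ℂ) (hd : ‖d‖ = 1) : IsOriented (levelCoords d hd) := by
  intro P Q
  have h : d.re * d.re + d.im * d.im = 1 := by
    rw [← Complex.normSq_apply, Complex.normSq_eq_norm_sq, hd, one_pow]
  rw [levelCoords_apply, levelCoords_apply]
  simp only [cross]
  simp [Complex.inner]
  linear_combination (P.re * Q.im - P.im * Q.re) * (-h)

namespace HierarchicalPlaneGraph

variable {H : HierarchicalPlaneGraph V} {Γ Γ₁ Γ₂ : V → ℂ}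

/-- The coordinates adapted to the levels. -/
def coords (H : HierarchicalPlaneGraph V) : ℂ ≃L[ℝ] ℝ × ℝ := levelCoords H.d H.norm_d

lemma yOf_coords (h : IsLevelDrawing H.d H.γ Γ) : yOf H.coords Γ = fun v => (H.γ v : ℝ) :=
  funext fun v => h v

lemma mem_embedding_of_equivalent (h : Γ ∈ H.embedding) {Γ' : V → ℂ}
    (hΓ' : IsPlanarDrawing H.graph Γ') (he : Equivalent H.graph Γ Γ') : Γ' ∈ H.embedding := by
  obtain ⟨Γ₀, -, hE⟩ := H.embedding_isClass
  rw [hE] at h ⊢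
  exact ⟨hΓ', h.2.trans he⟩

lemma IsST.isPathFace (h : H.IsST) (hΓ : Γ ∈ H.embedding) (hl : IsLevelDrawing H.d H.γ Γ)
    {F : Set ℂ} (hF : IsFace H.graph Γ F) : IsPathFace H.graph H.coords Γ F := by
  obtain ⟨s, t, p, q, h1, h2, h3, h4, h5, h6, h7⟩ := h Γ hΓ F hF
  refine ⟨s, t, p, q, h1, h2, h3, h4, ?_, ?_, h7⟩
  · rw [yOf_coords hl]; exact h5
  · rw [yOf_coords hl]; exact h6

/-- The item of an edge directed upwards or of a vertex, with its points on the levels. -/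
lemma exists_item (u v : V) (hi : IsItem H.graph (fun v => (H.γ v : ℝ)) u v) :
    ∃ x : V ⊕ H.graph.edgeSet, ∀ Γ : V → ℂ, IsLevelDrawing H.d H.γ Γ →
      ∀ h ∈ Set.Icc (H.γ u : ℝ) (H.γ v), ∀ z, z ∈ H.item Γ x ∩ levelLine H.d h ↔
        H.coords z = (edgeX (xOf H.coords Γ) (fun v => (H.γ v : ℝ)) u v h, h) := by
  rcases hi with rfl | ⟨huv, hlt⟩
  · refine ⟨Sum.inl u, fun Γ hΓ h hh z => ?_⟩
    obtain rfl : h = H.γ u := le_antisymm hh.2 hh.1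
    rw [edgeX_self]
    constructor
    · rintro ⟨rfl, hz⟩
      exact Prod.ext rfl hz
    · intro hz
      have : z = Γ u := H.coords.injective (hz.trans (Prod.ext rfl (hΓ u).symm))
      subst this
      exact ⟨rfl, hΓ u⟩
  · refine ⟨Sum.inr ⟨s(u, v), huv⟩, fun Γ hΓ h hh z => ?_⟩
    have hy := yOf_coords hΓ
    have hseg := mem_segment_iff (φ := H.coords) (Γ := Γ) (u := u) (v := v) (by rwa [hy]) z
    rw [hy] at hseg
    constructor
    · rintro ⟨hz, hzh⟩
      have hzh' : (H.coords z).2 = h := hzh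
      have h1 := (hseg.1 hz).2
      rw [hzh'] at h1
      exact Prod.ext h1 hzh'
    · intro hz
      have h2 : (H.coords z).2 = h := by rw [hz]
      refine ⟨hseg.2 ⟨by rw [h2]; exact hh, by rw [h2, hz]⟩, h2⟩

/-- Left-to-right equivalent level drawings have the same order at all heights. -/
lemma LeftToRightEquivalent.sameOrder (h₁₂ : H.LeftToRightEquivalent Γ₁ Γ₂)
    (h₁ : IsLevelDrawing H.d H.γ Γ₁) (h₂ : IsLevelDrawing H.d H.γ Γ₂)
    (hp₁ : IsPlanarDrawing H.graph Γ₁) (hp₂ : IsPlanarDrawing H.graph Γ₂) :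
    SameOrder H.graph H.coords Γ₁ Γ₂ := by
  refine SameOrder.of_order hp₁ hp₂ ((yOf_coords h₂).trans (yOf_coords h₁).symm) ?_
  rw [yOf_coords h₁]
  intro u v u' v' hi hi' w hw hw'
  obtain ⟨x, hx⟩ := exists_item u v hi
  obtain ⟨x', hx'⟩ := exists_item u' v' hi'
  have key : ∀ Γ, IsLevelDrawing H.d H.γ Γ → (H.Precedes Γ (H.γ w) x x' ↔
      edgeX (xOf H.coords Γ) (fun v => (H.γ v : ℝ)) u v (H.γ w) <
        edgeX (xOf H.coords Γ) (fun v => (H.γ v : ℝ)) u' v' (H.γ w)) := by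
    intro Γ hΓ
    constructor
    · rintro ⟨p, hp, q, hq, hpq⟩
      rw [hx Γ hΓ _ hw] at hp
      rw [hx' Γ hΓ _ hw'] at hq
      have : (H.coords p).1 < (H.coords q).1 := hpq
      rwa [hp, hq] at this
    · intro hlt
      refine ⟨H.coords.symm _, (hx Γ hΓ _ hw _).2 (H.coords.apply_symm_apply _),
        H.coords.symm _, (hx' Γ hΓ _ hw' _).2 (H.coords.apply_symm_apply _), ?_⟩
      change (H.coords (H.coords.symm _)).1 < (H.coords (H.coords.symm _)).1
      rw [ContinuousLinearEquiv.apply_symm_apply, ContinuousLinearEquiv.apply_symm_apply]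
      exact hlt
  rw [← key Γ₁ h₁, ← key Γ₂ h₂]
  exact h₁₂ _ (H.γ w).2 x x'

lemma isUnidirectional (h₁ : IsLevelDrawing H.d H.γ Γ₁) (h₂ : IsLevelDrawing H.d H.γ Γ₂) :
    IsUnidirectional Γ₁ Γ₂ := by
  refine ⟨H.coords.symm (1, 0), ?_, fun v => ⟨(H.coords (Γ₂ v - Γ₁ v)).1, ?_⟩⟩
  · rw [Ne, map_eq_zero_iff _ H.coords.symm.injective]
    simp
  · rw [← map_smul, ContinuousLinearEquiv.eq_symm_apply]
    have hy : (H.coords (Γ₂ v)).2 = (H.coords (Γ₁ v)).2 := Eq.trans (h₂ v) (h₁ v).symm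
    ext
    · simp
    · simp [hy]

end HierarchicalPlaneGraph

end PlaneDrawing

end

/-! ### The linear morph at a fixed time -/

theorem mainTheorem5 {V : Type*} [Finite V] (H : PlaneDrawing.HierarchicalPlaneGraph V)
    (hH : H.IsSTStrictlyConvex) (Γ₁ Γ₂ : V → ℂ)
    (h₁ : H.IsStrictlyConvexLevelDrawing Γ₁) (h₂ : H.IsStrictlyConvexLevelDrawing Γ₂)
    (h₁₂ : H.LeftToRightEquivalent Γ₁ Γ₂) :
    PlaneDrawing.IsUnidirectional Γ₁ Γ₂ ∧
      PlaneDrawing.IsStrictlyConvexMorph H.toPlaneGraph Γ₁ Γ₂ := by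
  open PlaneDrawing HierarchicalPlaneGraph in
  obtain ⟨hm₁, hl₁, hc₁⟩ := h₁
  obtain ⟨hm₂, hl₂, hc₂⟩ := h₂
  refine ⟨isUnidirectional hl₁ hl₂, fun t ht => ?_⟩
  have hφ : IsOriented H.coords := isOriented_levelCoords _ _
  have ho := h₁₂.sameOrder hl₁ hl₂ hc₁.planar hc₂.planar
  have hy : ∀ u v, H.graph.Adj u v → yOf H.coords Γ₁ u ≠ yOf H.coords Γ₁ v := by
    intro u v huv h
    rw [yOf_coords hl₁] at h
    exact H.adj_ne u v huv (Subtype.ext h)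
  have hcombo : ∀ v, H.coords (linearMorph Γ₁ Γ₂ t v) =
      (1 - t) • H.coords (Γ₁ v) + t • H.coords (Γ₂ v) := by
    intro v
    rw [linearMorph, AffineMap.lineMap_apply_module, map_add, map_smul, map_smul]
  have hx : ∀ v, xOf H.coords (linearMorph Γ₁ Γ₂ t) v =
      (1 - t) * xOf H.coords Γ₁ v + t * xOf H.coords Γ₂ v := fun v =>
    congrArg Prod.fst (hcombo v)
  have hlt : IsLevelDrawing H.d H.γ (linearMorph Γ₁ Γ₂ t) := by
    intro v
    have h3 : (H.coords (linearMorph Γ₁ Γ₂ t v)).2 =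
        (1 - t) * (H.coords (Γ₁ v)).2 + t * (H.coords (Γ₂ v)).2 := congrArg Prod.snd (hcombo v)
    have h4 : (H.coords (Γ₁ v)).2 = H.γ v := hl₁ v
    have h5 : (H.coords (Γ₂ v)).2 = H.γ v := hl₂ v
    rw [h4, h5] at h3
    have h6 : (H.coords (linearMorph Γ₁ Γ₂ t v)).2 = H.γ v := by rw [h3]; ring
    exact h6
  have hyt : yOf H.coords (linearMorph Γ₁ Γ₂ t) = yOf H.coords Γ₁ :=
    (yOf_coords hlt).trans (yOf_coords hl₁).symm
  have hot := ho.combo ht hx hyt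
  have hpt := hot.isPlanarDrawing hy hc₁.planar
  -- The st condition is available only for drawings of the embedding, so it is used for `Γ₁` here
  -- and for time `t` only after `hmt`.
  have hup : ∀ F, IsFace H.graph Γ₁ F → IsUpwardFace H.graph H.coords Γ₁ F := fun F hF =>
    (hH.1.isPathFace hm₁ hl₁ hF).isUpwardFace
  have he := hot.equivalent hφ hc₁.planar hpt hy hup
  have he₂ := ho.equivalent hφ hc₁.planar hc₂.planar hy hup
  have he' : Equivalent H.graph Γ₂ (linearMorph Γ₁ Γ₂ t) :=
    ⟨fun v a b c ha hb hc => (he₂.same_order v a b c ha hb hc).symm.trans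
      (he.same_order v a b c ha hb hc),
    fun a b hab => (he₂.same_outer a b hab).symm.trans (he.same_outer a b hab)⟩
  have hmt := mem_embedding_of_equivalent hm₁ hpt he
  have hct := isStrictlyConvexDrawing_combo hφ hc₁ hc₂ hpt he he' ht hx hyt ho.y_eq
  exact ⟨hmt, hct, fun F hF => (hH.1.isPathFace hmt hlt hF).isDelimited hφ hct hF⟩
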